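/- **Setting.** Let $d\ge1$, let $\mathcal P=\{(p_z)_{z\in\mathbb Z^d}:p_z\ge0,\ \sum_zp_z=1\}$ and let $\Omega=\mathcal P^{\mathbb Z^d}$ carry its product $\sigma$-field $\mathfrak S$. For $\omega=(\omega_x)_{x\in\mathbb Z^d}\in\Omega$ write $\pi_{x,y}(\omega)=\omega_{x,y-x}$ and $(T_z\omega)_x=\omega_{x+z}$. Let $P_x^\omega$ (expectation $E_x^\omega$) be the law of the Markov chain $(X_n)_{n\ge0}$ on $\mathbb Z^d$ with $X_0=x$ and transition probabilities $\pi_{x,y}(\omega)$. Let $\Pi(\omega,A)=P_0^\omega(T_{X_1}\omega\in A)$. Let $|\cdot|$ be the Euclidean norm, fix $\hat u\in\mathbb Z^d\setminus\{0\}$, and put $\mathfrak S_\ell=\sigma\{\omega_x:x\cdot\hat u\ge\ell\}$. For probability measures $\mu,\nu$ on a measurable space let $d_{\rm Var}(\mu,\nu)=\sup_A\{\mu(A)-\nu(A)\}$, over measurable sets $A$. A $\Pi$-invariant probability measure $\mu$ is *ergodic* if $\mu(A)\in\{0,1\}$ for every measurable $A$ with $\Pi(\cdot,A)=\mathbf 1_A$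 $\mu$-a.s. For constants $\delta,M,s_0>0$ consider the following hypotheses on a probability measure $\mathbb P$ on $\Omega$: * (N) $\sum_zz\cdot\hat u\,\pi_{0,z}(\omega)\ge\delta$ for $\mathbb P$-a.e. $\omega$; * (M) $\sum_ze^{s_0|z|}\pi_{0,z}(\omega)\le e^{s_0M}$ for $\mathbb P$-a.e. $\omega$. For a path let, with $\inf\emptyset=\infty$, $$\lambda_\ell=\inf\{n\ge0:(X_n-X_0)\cdot\hat u\ge\ell\},\quad \beta=\inf\{n\ge0:X_n\cdot\hat u<X_0\cdot\hat u\},\quad H_z=\inf\{n\ge1:X_n=z\},$$ $$M_n=\max_{0\le k\le n}(X_k-X_0)\cdot\hat u,\qquad \lambda_{M_\beta+a}=\inf\{n\ge\beta:(X_n-X_0)\cdot\hat u\ge M_\beta+a\}\ \text{ if }\beta<\infty.$$ With $\theta$ the left shift on paths, let $S_0=\lambda_a$ and $S_k=S_{k-1}+\lambda_{M_\beta+a}\circ\theta^{S_{k-1}}$ as long as $S_{k-1}<\infty$ and $\beta\circ\theta^{S_{k-1}}<\infty$. Let $\tau_1^{(a)}=S_\ell$ for the $\ell$ with $S_\ell<\infty$,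 $\beta\circ\theta^{S_k}<\infty$ for $0\le k<\ell$ and $\beta\circ\theta^{S_\ell}=\infty$, and $\tau_1^{(a)}=\infty$ if there is no such $\ell$. Variables of the form $|X_t-x|$ or $|X_{t+n}-X_n|$ count as $\infty$ when the random time $t$ is infinite. **Theorem.** For all $\hat u\in\mathbb Z^d\setminus\{0\}$ and $\delta,M,s_0>0$ there are positive constants $\eta,\gamma,\kappa,(C_p)_{p\ge1}$ and $s_1\le s_0$ such that the following holds. Let $\mathbb P$ be an i.i.d. product measure on $\Omega$ that satisfies (N) and (M) with $\hat u,\delta,M,s_0$. Then there is a probability measure $\mathbb P_\infty$ on $\Omega$ such that: (a) $\mathbb P_\infty$ is invariant and ergodic for $\Pi$. (b) There are constants $0<c,C<\infty$ such that for all integers $\ell\ge0$ $$d_{\rm Var}\bigl(\mathbb P_\infty|_{\mathfrak S_\ell},\mathbb P|_{\mathfrak S_\ell}\bigr)\le Ce^{-c\ell}.$$ (c) For $\mathbb P_\infty$-a.e. $\omega$: for every $x\in\mathbb Z^d$, $\sum_zz\cdot\hat u\,\pi_{x,x+z}(\omega)\ge\delta$ and $\sum_ze^{s_0|z|}\pi_{x,x+z}(\omega)\le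 e^{s_0M}$; and for all $x\in\mathbb Z^d$, integers $n\ge0$, $s\in[0,s_1]$, real $p\ge1$, $\ell\ge1$, $a\ge1$, $q>p$, and $z\in\mathbb Z^d$ with $z\cdot\hat u\ge0$, $$E_x^\omega(e^{-sX_n\cdot\hat u})\le e^{-sx\cdot\hat u}(1-s\delta/2)^n,\qquad E_x^\omega(e^{s|X_n-x|})\le e^{sMn},$$ $$P_x^\omega(X_1\cdot\hat u\ge x\cdot\hat u+\gamma)\ge\kappa,\qquad E_x^\omega(\lambda_\ell^p)\le C_p\ell^p,\qquad E_x^\omega(|X_{\lambda_\ell}-x|^p)\le C_p\ell^p,$$ $$E_0^\omega\bigl[(M_{H_z}-z\cdot\hat u)^p\mathbf 1\{H_z<n\}\bigr]\le C_p\ell^pP_0^\omega(H_z<n)+C_ps^{-p}e^{-s\ell/2},$$ $$P_x^\omega(\beta=\infty)\ge\eta,\qquad E_x^\omega\bigl(|\tau_1^{(a)}|^p\bigr)\le C_pa^p,\qquad E_x^\omega\bigl(|X_{\tau_1^{(a)}+n}-X_n|^p\bigr)\le C_qa^q,$$ where $s^{-p}=\infty$ for $s=0$. -/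

import Mathlib

open MeasureTheory ProbabilityTheory
open scoped ENNReal

namespace RWRE

/-- The lattice `ℤ^d`. -/
abbrev Site (d : ℕ) : Type := Fin d → ℤ

/-- The simplex of probability vectors on `ℤ^d`, with the product `σ`-field of its coordinates. -/
abbrev StepLaw (d : ℕ) : Type := {p : Site d → ℝ // (∀ z, 0 ≤ p z) ∧ HasSum p 1}

/-- Environments, with the product `σ`-field. -/
abbrev Env (d : ℕ) : Type := Site d → StepLaw d

/-- Paths of the walk. -/
abbrev Path (d : ℕ) : Type := ℕ → Site d

variable {d : ℕ}

/-- The Euclidean norm of a lattice point. -/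
noncomputable def len (z : Site d) : ℝ := ‖WithLp.toLp 2 (fun i => (z i : ℝ))‖

/-- `π_{x,y}(ω) = ω_{x,y-x}`. -/
def transProb (ω : Env d) (x y : Site d) : ℝ := (ω x).1 (y - x)

/-- The natural shifts, `(T_z ω)_x = ω_{x+z}`, so that `π_{x,y}(T_z ω) = π_{x+z,y+z}(ω)`. -/
def shiftEnv (z : Site d) (ω : Env d) : Env d := fun x => ω (x + z)

/-! ### The quenched walk -/

/-- One step of the walk in the fixed environment `ω`. -/
noncomputable def stepKernel (ω : Env d) : Kernel (Site d) (Site d) :=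
  Kernel.ofFunOfCountable fun x =>
    Measure.sum fun y => ENNReal.ofReal (transProb ω x y) • Measure.dirac y

theorem stepKernel_apply (ω : Env d) (x : Site d) :
    stepKernel ω x =
      Measure.sum fun y => ENNReal.ofReal (transProb ω x y) • Measure.dirac y := rfl

instance isMarkovKernel_stepKernel (ω : Env d) : IsMarkovKernel (stepKernel ω) := by
  refine ⟨fun x => ⟨?_⟩⟩
  have h1 : HasSum (fun y => transProb ω x y) 1 :=
    (Equiv.subRight x).hasSum_iff.mpr (ω x).2.2
  rw [stepKernel_apply, Measure.sum_apply _ MeasurableSet.univ]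
  simp only [Measure.smul_apply, measure_univ, smul_eq_mul, mul_one]
  have h0 : ∀ y, 0 ≤ transProb ω x y := fun y => (ω x).2.1 _
  rw [← ENNReal.ofReal_tsum_of_nonneg h0 h1.summable, h1.tsum_eq, ENNReal.ofReal_one]

/-- The step kernels as functions of the whole past; only the present state matters. -/
noncomputable def historyKernel (ω : Env d) (n : ℕ) :
    Kernel ((_i : Finset.Iic n) → Site d) (Site d) :=
  (stepKernel ω).comap (fun h => h ⟨n, Finset.mem_Iic.mpr le_rfl⟩) (measurable_pi_apply _)

instance isMarkovKernel_historyKernel (ω : Env d) (n : ℕ) :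
    IsMarkovKernel (historyKernel ω n) := by
  unfold historyKernel; infer_instance

/-- The quenched path measure `P_x^ω` of the Markov chain with transition probabilities
`π_{x,y}(ω)` started at `x`. -/
noncomputable def quenched (ω : Env d) (x : Site d) : Measure (Path d) :=
  Kernel.traj (X := fun _ => Site d) (historyKernel ω) 0 (fun _ => x)

instance isProbabilityMeasure_quenched (ω : Env d) (x : Site d) :
    IsProbabilityMeasure (quenched ω x) := by
  unfold quenched; infer_instance

/-! ### The environment chain -/

theorem measurable_shiftEnv (z : Site d) : Measurable (shiftEnv z : Env d → Env d) :=
  measurable_pi_lambda _ fun x => measurable_pi_apply (x + z)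

theorem quenched_map_one (ω : Env d) (x : Site d) :
    (quenched ω x).map (fun X => X 1) = stepKernel ω x := by
  have h := Kernel.map_traj_succ_self (X := fun _ => Site d) (κ := historyKernel ω) (a := 0)
  have h2 := congrArg (fun k => k (fun _ => x)) h
  rw [Kernel.map_apply _ (by fun_prop)] at h2
  exact h2

theorem measurable_envStep : Measurable fun ω : Env d =>
    (quenched ω 0).map (fun X => shiftEnv (X 1) ω) := by
  refine Measure.measurable_of_measurable_coe _ fun A hA => ?_
  have key : ∀ ω : Env d, (quenched ω 0).map (fun X => shiftEnv (X 1) ω) A =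
      ∑' y, ENNReal.ofReal (transProb ω 0 y) * A.indicator 1 (shiftEnv y ω) := by
    intro ω
    have hm : Measurable fun y : Site d => shiftEnv y ω := measurable_of_countable _
    have : (quenched ω 0).map (fun X => shiftEnv (X 1) ω)
        = (stepKernel ω 0).map (fun y => shiftEnv y ω) := by
      rw [← quenched_map_one, Measure.map_map hm (measurable_pi_apply 1)]
      rfl
    rw [this, Measure.map_apply hm hA, stepKernel_apply, Measure.sum_apply _ (hm hA)]
    refine tsum_congr fun y => ?_
    rw [Measure.smul_apply, Measure.dirac_apply' _ (hm hA), smul_eq_mul]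
    rfl
  simp_rw [key]
  refine Measurable.tsum fun y => ?_
  refine Measurable.mul ?_ ((measurable_one.indicator hA).comp (measurable_shiftEnv y))
  refine ENNReal.measurable_ofReal.comp ?_
  exact (measurable_pi_apply (y - 0)).comp (measurable_subtype_coe.comp (measurable_pi_apply 0))

/-- The kernel of the environment process, `Π(ω, A) = P_0^ω(T_{X_1} ω ∈ A)`. -/
noncomputable def envKernel (d : ℕ) : Kernel (Env d) (Env d) where
  toFun ω := (quenched ω 0).map (fun X => shiftEnv (X 1) ω)
  measurable' := measurable_envStep

/-- Ergodicity of a probability measure `μ` for a Markov kernel: every almost surely invariant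
measurable set is trivial. -/
def IsErgodicFor {α : Type*} [MeasurableSpace α] (κ : Kernel α α) (μ : Measure α) : Prop :=
  ∀ A : Set α, MeasurableSet A → (∀ᵐ ω ∂μ, κ ω A = A.indicator 1 ω) → μ A = 0 ∨ μ A = 1

/-! ### Assumptions on the environment -/

/-- The vectors `ω_x` are i.i.d. under `P`. -/
def IsIIDEnv (P : Measure (Env d)) : Prop :=
  ∃ α : Measure (StepLaw d), IsProbabilityMeasure α ∧ P = Measure.infinitePi fun _ => α

/-- The drift of the step law `p` in direction `u` is at least `δ`. (For `δ > 0` the inequality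
forces the series to converge.) -/
def DriftGE (u : Site d) (δ : ℝ) (p : StepLaw d) : Prop :=
  δ ≤ ∑' z : Site d, ((z ⬝ᵥ u : ℤ) : ℝ) * p.1 z

/-- `∑_z e^{s|z|} p_z ≤ e^{sM}`; a divergent series counts as `∞`. -/
def ExpMomentLE (s M : ℝ) (p : StepLaw d) : Prop :=
  ∑' z : Site d, ENNReal.ofReal (Real.exp (s * len z) * p.1 z) ≤ ENNReal.ofReal (Real.exp (s * M))

/-- Non-nestling in direction `u` with constant `δ`. -/
def NonNestling (u : Site d) (δ : ℝ) (P : Measure (Env d)) : Prop :=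
  ∀ᵐ ω ∂P, DriftGE u δ (ω 0)

/-- The exponential moment hypothesis with constants `M` and `s`. -/
def MomentHyp (s M : ℝ) (P : Measure (Env d)) : Prop :=
  ∀ᵐ ω ∂P, ExpMomentLE s M (ω 0)

/-! ### Variation distance on the half-spaces -/

/-- `𝔖_ℓ = σ{ω_x : x·u ≥ ℓ}`. -/
@[reducible] def levelSigma (u : Site d) (ℓ : ℤ) : MeasurableSpace (Env d) :=
  ⨆ (x : Site d) (_ : ℓ ≤ x ⬝ᵥ u), MeasurableSpace.comap (fun ω : Env d => ω x) inferInstance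

theorem levelSigma_le (u : Site d) (ℓ : ℤ) :
    levelSigma u ℓ ≤ (inferInstance : MeasurableSpace (Env d)) :=
  iSup₂_le fun x _ => (measurable_pi_apply x).comap_le

/-- The variation distance `sup_A (μ(A) - ν(A))` of two probability measures. -/
noncomputable def varDist {α : Type*} {m : MeasurableSpace α} (μ ν : Measure α) : ℝ :=
  ⨆ A : {A : Set α // MeasurableSet A}, (μ.real A.1 - ν.real A.1)

/-! ### Random times of a path -/

/-- The level `(X_n - X_0)·u` relative to the starting level. -/
def level (u : Site d) (X : Path d) (n : ℕ) : ℤ := X n ⬝ᵥ u - X 0 ⬝ᵥ u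

/-- The left shift on path space. -/
def shiftPath (k : ℕ) (X : Path d) : Path d := fun n => X (n + k)

/-- `λ_ℓ`, the first time of reaching relative level `ℓ` (`⊤` if this never happens). -/
noncomputable def reachTime (u : Site d) (ℓ : ℝ) (X : Path d) : ℕ∞ :=
  ⨅ (n : ℕ) (_ : ℓ ≤ (level u X n : ℝ)), (n : ℕ∞)

/-- `β`, the first backtracking time. -/
noncomputable def backtrackTime (u : Site d) (X : Path d) : ℕ∞ :=
  ⨅ (n : ℕ) (_ : X n ⬝ᵥ u < X 0 ⬝ᵥ u), (n : ℕ∞)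

/-- `H_z`, the first hitting time of `z` after time `0`. -/
noncomputable def hitTime (z : Site d) (X : Path d) : ℕ∞ :=
  ⨅ (n : ℕ) (_ : 1 ≤ n ∧ X n = z), (n : ℕ∞)

/-- `M_n`, the maximal relative level up to time `n`. -/
def maxLevel (u : Site d) (X : Path d) (n : ℕ) : ℤ :=
  (Finset.range (n + 1)).sup' Finset.nonempty_range_add_one (level u X)

/-- `λ_{M_β+a} = inf{n ≥ β : (X_n - X_0)·u ≥ M_β + a}`, equal to `⊤` if `β = ∞`. -/
noncomputable def recoverTime (u : Site d) (a : ℝ) (X : Path d) : ℕ∞ :=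
  ⨅ (n : ℕ) (_ : backtrackTime u X ≤ n ∧
    (maxLevel u X (backtrackTime u X).toNat : ℝ) + a ≤ (level u X n : ℝ)), (n : ℕ∞)

/-- The times `S_0 = λ_a` and `S_{k+1} = S_k + λ_{M_β+a} ∘ θ^{S_k}`; the value is `⊤` from the
first undefined one on. -/
noncomputable def stageTime (u : Site d) (a : ℝ) (X : Path d) : ℕ → ℕ∞
  | 0 => reachTime u a X
  | k + 1 => stageTime u a X k + recoverTime u a (shiftPath (stageTime u a X k).toNat X)

/-- The first regeneration time `τ_1^{(a)}`: the `S_ℓ` with `β ∘ θ^{S_k} < ∞` for `k < ℓ` and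
`β ∘ θ^{S_ℓ} = ∞`. It is `⊤` if there is none. -/
noncomputable def regenTime (u : Site d) (a : ℝ) (X : Path d) : ℕ∞ :=
  ⨅ (ℓ : ℕ) (_ : (∀ k < ℓ, backtrackTime u (shiftPath (stageTime u a X k).toNat X) < ⊤) ∧
    backtrackTime u (shiftPath (stageTime u a X ℓ).toNat X) = ⊤), stageTime u a X ℓ

/-- The value of `f` at the random time `t`, with value `∞` when `t = ∞`. -/
noncomputable def atTime (t : ℕ∞) (f : ℕ → ℝ≥0∞) : ℝ≥0∞ := if t = ⊤ then ⊤ else f t.toNat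

/-! ### The exponential estimates -/

/-- The quenched estimates at the environment `ω`, with all constants displayed. Expectations are
Lebesgue integrals with values in `[0,∞]`; in `hitting` the factor `s^{-p}` is `∞` for `s = 0`. -/
structure QuenchedEstimates (u : Site d) (δ M η γ κ s₁ : ℝ) (C : ℝ → ℝ) (ω : Env d) : Prop where
  exp_bound : ∀ (x : Site d) (n : ℕ) (s : ℝ), 0 ≤ s → s ≤ s₁ →
    ∫⁻ X, ENNReal.ofReal (Real.exp (-s * ((X n ⬝ᵥ u : ℤ) : ℝ))) ∂(quenched ω x) ≤
      ENNReal.ofReal (Real.exp (-s * ((x ⬝ᵥ u : ℤ) : ℝ)) * (1 - s * δ / 2) ^ n)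
  bounded_step : ∀ (x : Site d) (n : ℕ) (s : ℝ), 0 ≤ s → s ≤ s₁ →
    ∫⁻ X, ENNReal.ofReal (Real.exp (s * len (X n - x))) ∂(quenched ω x) ≤
      ENNReal.ofReal (Real.exp (s * M * n))
  ellipticity : ∀ x : Site d,
    ENNReal.ofReal κ ≤ quenched ω x {X | ((x ⬝ᵥ u : ℤ) : ℝ) + γ ≤ ((X 1 ⬝ᵥ u : ℤ) : ℝ)}
  reach : ∀ (x : Site d) (p ℓ : ℝ), 1 ≤ p → 1 ≤ ℓ →
    ∫⁻ X, (reachTime u ℓ X : ℝ≥0∞) ^ p ∂(quenched ω x) ≤ ENNReal.ofReal (C p * ℓ ^ p)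
  reach_pos : ∀ (x : Site d) (p ℓ : ℝ), 1 ≤ p → 1 ≤ ℓ →
    ∫⁻ X, atTime (reachTime u ℓ X) (fun m => ENNReal.ofReal (len (X m - x) ^ p)) ∂(quenched ω x) ≤
      ENNReal.ofReal (C p * ℓ ^ p)
  hitting : ∀ (z : Site d) (n : ℕ) (s p ℓ : ℝ), 0 ≤ z ⬝ᵥ u → 0 ≤ s → s ≤ s₁ → 1 ≤ p → 1 ≤ ℓ →
    ∫⁻ X in {X | hitTime z X < n},
        ENNReal.ofReal (((maxLevel u X (hitTime z X).toNat - z ⬝ᵥ u : ℤ) : ℝ) ^ p)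
        ∂(quenched ω 0) ≤
      ENNReal.ofReal (C p * ℓ ^ p) * quenched ω 0 {X | hitTime z X < n} +
        ENNReal.ofReal (C p) * ENNReal.ofReal s ^ (-p) * ENNReal.ofReal (Real.exp (-s * ℓ / 2))
  no_backtrack : ∀ x : Site d, ENNReal.ofReal η ≤ quenched ω x {X | backtrackTime u X = ⊤}
  regen : ∀ (x : Site d) (p a : ℝ), 1 ≤ p → 1 ≤ a →
    ∫⁻ X, (regenTime u a X : ℝ≥0∞) ^ p ∂(quenched ω x) ≤ ENNReal.ofReal (C p * a ^ p)
  regen_pos : ∀ (x : Site d) (n : ℕ) (p q a : ℝ), 1 ≤ p → p < q → 1 ≤ a →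
    ∫⁻ X, atTime (regenTime u a X)
        (fun m => ENNReal.ofReal (len (X (m + n) - X n) ^ p)) ∂(quenched ω x) ≤
      ENNReal.ofReal (C q * a ^ q)

end RWRE

/-!
The drift and the exponential moments make `e^{-s X_n·u}` a contracting supermartingale under every
quenched law, for a small `s > 0` that depends only on the constants; together with a lower bound
for the probability of stepping up, this is all that is used about a good environment (`StepBounds`,
`GoodEnv.stepBounds`). Consequently the walk is unlikely to be below level `k` at time `n`
(`StepBounds.level_le`), and unlikely ever to lose `k` levels (`StepBounds.exists_level_le`).
The first fact gives passage times exponential tails, the second bounds the probability of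
backtracking away from one. So the stages of a regeneration time are geometric in number, and the
strong Markov property adds up their moments. A displacement is controlled by its duration, whatever
the dependence between the two (`StepBounds.lintegral_len_le`). This gives all the quenched
estimates in every good environment (`GoodEnv.quenchedEstimates`).

The measure `P∞` is a weak limit of the Cesàro averages of the laws of the environment seen from the
walk. The good environments form a compact set that is invariant under shifts
(`isCompact_goodEnv`), so a limit exists and lives on good environments
(`exists_tendsto_avgLaw`); it is invariant because the averages are invariant up to a boundary term
and the kernel is Feller (`invariant_of_tendsto_avgProb`).

At time `n` the walk has most likely never been more than `L` levels ahead of its present position,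
in which case it has not yet looked at the environment from `L` levels above that position on, and
this part is distributed as under `P` and independent of the rest (`lintegral_envLaw_le_splice`).
The bound passes to the limit (`measure_le_spliceLaw_add`): up to an error `K e^{-sL}`, in total
variation, `P∞` is the law of an environment that is distributed as `P∞` below level `L` and,
independently, as `P` from level `L` on. On the half-space of levels `≥ L` this is the variation
bound.

It also gives ergodicity (`isErgodicFor_of_spliceLaw_le`). Suppose that an invariant event and its
complement both have positive probability, and approximate the event by an event `C` that depends
on the levels between `-N` and `N`. The environment process rarely moves from `C` to `Cᶜ`, or back.
But when the walk first enters a far level, it has a fixed chance never to fall below it again,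
and then it sees a fresh environment, independent of whether it started in `C` or in `Cᶜ`. Since
the fresh walk must be in `C` or in `Cᶜ` most of the time, one of the two moves is not rare.
-/

namespace RWRE

variable {d : ℕ}

/-! ### The Markov property of the quenched walk -/

/-- The path that starts at `x` and then follows `X`. -/
def consPath (x : Site d) (X : Path d) : Path d
  | 0 => x
  | n + 1 => X n

@[simp] theorem consPath_zero (x : Site d) (X : Path d) : consPath x X 0 = x := rfl

@[simp] theorem consPath_succ (x : Site d) (X : Path d) (n : ℕ) :
    consPath x X (n + 1) = X n := rfl

@[fun_prop]
theorem measurable_consPath (x : Site d) : Measurable (consPath x : Path d → Path d) := by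
  refine measurable_pi_lambda _ fun n => ?_
  cases n with
  | zero => exact measurable_const
  | succ n => exact measurable_pi_apply n

@[fun_prop]
theorem measurable_shiftPath (k : ℕ) : Measurable (shiftPath k : Path d → Path d) :=
  measurable_pi_lambda _ fun n => measurable_pi_apply (n + k)

theorem quenched_zero (ω : Env d) (x : Site d) : ∀ᵐ X ∂(quenched ω x), X 0 = x := by
  have h := Kernel.traj_map_frestrictLe_apply (X := fun _ => Site d) (κ := historyKernel ω) 0 0
    (fun _ => x)
  rw [Kernel.partialTraj_self, Kernel.id_apply] at h
  have h2 : ∀ᵐ y ∂((quenched ω x).map (Preorder.frestrictLe (π := fun _ => Site d) 0)),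
      y ⟨0, by simp⟩ = x := by
    unfold quenched
    rw [h]
    rw [ae_dirac_iff]
    exact measurableSet_eq_fun (measurable_pi_apply _) measurable_const
  exact ae_of_ae_map (by fun_prop) h2

/-- Integrals against a step law are sums over the target. -/
theorem lintegral_stepKernel (ω : Env d) (x : Site d) (f : Site d → ℝ≥0∞) :
    ∫⁻ y, f y ∂(stepKernel ω x) = ∑' y, ENNReal.ofReal (transProb ω x y) * f y := by
  rw [stepKernel_apply, lintegral_sum_measure]
  simp [lintegral_smul_measure, lintegral_dirac]

/-- The paths that agree with `v` up to time `n`. -/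
def cyl (n : ℕ) (v : Path d) : Set (Path d) := {X | ∀ i ≤ n, X i = v i}

theorem measurableSet_cyl (n : ℕ) (v : Path d) : MeasurableSet (cyl n v) := by
  have : cyl n v = ⋂ i : ℕ, ⋂ _ : i ≤ n, (fun X : Path d => X i) ⁻¹' {v i} := by
    ext X; simp [cyl]
  rw [this]
  exact MeasurableSet.iInter fun i => MeasurableSet.iInter fun _ =>
    measurable_pi_apply i (measurableSet_singleton _)

theorem quenched_cyl_zero (ω : Env d) (x : Site d) (v : Path d) [Decidable (v 0 = x)] :
    quenched ω x (cyl 0 v) = if v 0 = x then 1 else 0 := by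
  split_ifs with h
  · rw [prob_compl_eq_zero_iff (measurableSet_cyl 0 v) |>.symm]
    filter_upwards [quenched_zero ω x] with X hX
    simp [cyl, hX, h]
  · refine measure_eq_zero_iff_ae_notMem.2 ?_
    filter_upwards [quenched_zero ω x] with X hX
    simpa [cyl, hX] using fun h' => h h'.symm

theorem quenched_cyl_succ (ω : Env d) (x : Site d) (n : ℕ) (v : Path d) :
    quenched ω x (cyl (n + 1) v) =
      quenched ω x (cyl n v) * stepKernel ω (v n) {v (n + 1)} := by
  have h := Kernel.partialTraj_compProd_eq_map_traj (X := fun _ => Site d) (κ := historyKernel ω)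
    (a := 0) (b := n) (Nat.zero_le n) (x₀ := fun _ => x)
  rw [← Kernel.traj_map_frestrictLe_apply] at h
  let c : Set ((_i : Finset.Iic n) → Site d) := {fun i : Finset.Iic n => v i.1}
  have hc : MeasurableSet c := measurableSet_singleton _
  have hm : MeasurableSet (c ×ˢ ({v (n + 1)} : Set (Site d))) := hc.prod (measurableSet_singleton _)
  have h1 := congrArg (fun μ => μ (c ×ˢ ({v (n + 1)} : Set (Site d)))) h
  have hpre : Preorder.frestrictLe (π := fun _ => Site d) n ⁻¹' c = cyl n v := by
    ext X
    simp only [c, Set.mem_preimage, Set.mem_singleton_iff, funext_iff, cyl, Set.mem_ofPred_eq,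
      Subtype.forall, Finset.mem_Iic]
    rfl
  have hpre2 : (fun X : Path d => (Preorder.frestrictLe (π := fun _ => Site d) n X, X (n + 1))) ⁻¹'
      (c ×ˢ ({v (n + 1)} : Set (Site d))) = cyl (n + 1) v := by
    ext X
    have := Set.ext_iff.1 hpre X
    simp only [Set.mem_preimage, Set.mem_prod, Set.mem_singleton_iff] at this ⊢
    rw [this]
    constructor
    · rintro ⟨h1, h2⟩ i hi
      rcases Nat.le_succ_iff.1 hi with h | h
      · exact h1 i h
      · rw [h]; exact h2
    · intro h
      exact ⟨fun i hi => h i (by omega), h _ le_rfl⟩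
  rw [Measure.map_apply (by fun_prop) hm, hpre2, Measure.compProd_apply hm,
    lintegral_map (Kernel.measurable_kernel_prodMk_left hm) (by fun_prop)] at h1
  change _ = quenched ω x _ at h1
  rw [← h1]
  have : ∀ X : Path d, historyKernel ω n (Preorder.frestrictLe (π := fun _ => Site d) n X)
      (Prod.mk (Preorder.frestrictLe (π := fun _ => Site d) n X) ⁻¹'
        (c ×ˢ ({v (n + 1)} : Set (Site d)))) =
      (cyl n v).indicator (fun _ => stepKernel ω (v n) {v (n + 1)}) X := by
    intro X
    by_cases hX : X ∈ cyl n v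
    · rw [Set.indicator_of_mem hX]
      have h2 : Preorder.frestrictLe (π := fun _ => Site d) n X ∈ c := by
        rw [← Set.mem_preimage, hpre]; exact hX
      rw [Set.mk_preimage_prod_right h2, historyKernel, Kernel.comap_apply]
      congr 2
      exact hX n le_rfl
    · rw [Set.indicator_of_notMem hX]
      have h2 : Preorder.frestrictLe (π := fun _ => Site d) n X ∉ c := by
        rw [← Set.mem_preimage, hpre]; exact hX
      rw [Set.mk_preimage_prod_right_eq_empty h2, measure_empty]
  simp_rw [this]
  rw [lintegral_indicator_const (measurableSet_cyl n v), mul_comm]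
  rfl

/-- Two probability measures on paths that agree on the cylinders are equal. -/
theorem path_measure_ext {μ ν : Measure (Path d)} [IsProbabilityMeasure μ] [IsProbabilityMeasure ν]
    (h : ∀ n v, μ (cyl n v) = ν (cyl n v)) : μ = ν := by
  refine ext_of_generate_finite {s | ∃ n v, s = cyl (d := d) n v} ?_ ?_ ?_ (by simp)
  · apply le_antisymm
    · refine iSup_le fun n => ?_
      rintro _ ⟨s, -, rfl⟩
      have : (fun X : Path d => X n) ⁻¹' s =
          ⋃ (v : Fin (n + 1) → Site d) (_ : v (Fin.last n) ∈ s),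
            cyl n (fun i => if h : i < n + 1 then v ⟨i, h⟩ else 0) := by
        ext X
        simp only [Set.mem_preimage, Set.mem_iUnion, cyl, Set.mem_ofPred_eq, exists_prop]
        constructor
        · intro hX
          refine ⟨fun i => X i, hX, fun i hi => ?_⟩
          rw [dif_pos (by omega)]
        · rintro ⟨v, hv, h⟩
          have := h n le_rfl
          rw [dif_pos (by omega)] at this
          rw [this]; exact hv
      rw [this]
      exact MeasurableSet.iUnion fun v => MeasurableSet.iUnion fun _ =>
        MeasurableSpace.measurableSet_generateFrom ⟨n, _, rfl⟩
    · refine MeasurableSpace.generateFrom_le ?_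
      rintro _ ⟨n, v, rfl⟩
      exact measurableSet_cyl n v
  · rintro _ ⟨n, v, rfl⟩ _ ⟨m, w, rfl⟩ ⟨X, hX1, hX2⟩
    refine ⟨max n m, X, ?_⟩
    ext Y
    simp only [cyl, Set.mem_inter_iff, Set.mem_ofPred_eq] at *
    constructor
    · rintro ⟨h1, h2⟩ i hi
      rcases le_max_iff.1 hi with h | h
      · rw [h1 i h, hX1 i h]
      · rw [h2 i h, hX2 i h]
    · intro h
      exact ⟨fun i hi => by rw [h i (le_max_of_le_left hi), hX1 i hi],
        fun i hi => by rw [h i (le_max_of_le_right hi), hX2 i hi]⟩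
  · rintro _ ⟨n, v, rfl⟩
    exact h n v

/-- The path measure disintegrated along the first step. -/
theorem quenched_eq_bind (ω : Env d) (x : Site d) :
    quenched ω x = (stepKernel ω x).bind fun y => (quenched ω y).map (consPath x) := by
  have hme : ∀ y, IsProbabilityMeasure ((quenched ω y).map (consPath x)) := fun y =>
    Measure.isProbabilityMeasure_map (by fun_prop)
  have hmeas : Measurable fun y => (quenched ω y).map (consPath x) := measurable_of_countable _
  have : IsProbabilityMeasure ((stepKernel ω x).bind fun y => (quenched ω y).map (consPath x)) := by
    constructor
    rw [Measure.bind_apply MeasurableSet.univ hmeas.aemeasurable]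
    simp
  refine path_measure_ext fun n v => ?_
  classical
  have key : ∀ (n : ℕ) (y : Site d), (quenched ω y).map (consPath x) (cyl (n + 1) v) =
      if v 0 = x then quenched ω y (cyl n (shiftPath 1 v)) else 0 := by
    intro n y
    rw [Measure.map_apply (by fun_prop) (measurableSet_cyl _ _)]
    split_ifs with h
    · congr 1
      ext X
      simp only [cyl, Set.mem_preimage, Set.mem_ofPred_eq, shiftPath]
      constructor
      · intro hX i hi
        exact hX (i + 1) (by omega)
      · intro hX i hi
        cases i with
        | zero => simp [h]
        | succ i => exact hX i (by omega)
    · have : consPath x ⁻¹' cyl (n + 1) v = ∅ := by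
        ext X
        simp only [cyl, Set.mem_preimage, Set.mem_ofPred_eq, Set.mem_empty_iff_false, iff_false]
        intro hX
        exact h (hX 0 (by omega)).symm
      rw [this, measure_empty]
  rw [Measure.bind_apply (measurableSet_cyl _ _) hmeas.aemeasurable]
  induction n with
  | zero =>
    have : ∀ y, (quenched ω y).map (consPath x) (cyl 0 v) = if v 0 = x then 1 else 0 := by
      intro y
      rw [Measure.map_apply (by fun_prop) (measurableSet_cyl _ _)]
      split_ifs with h
      · have : consPath x ⁻¹' cyl 0 v = Set.univ := by ext X; simp [cyl, h]
        rw [this, measure_univ]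
      · have : consPath x ⁻¹' cyl 0 v = ∅ := by
          ext X; simpa [cyl] using fun h' => h h'.symm
        rw [this, measure_empty]
    simp_rw [this, quenched_cyl_zero]
    simp
  | succ n ih =>
    rw [quenched_cyl_succ, ih]
    simp_rw [key n]
    cases n with
    | zero =>
      have h0 : ∀ y, (quenched ω y).map (consPath x) (cyl 0 v) = if v 0 = x then 1 else 0 := by
        intro y
        rw [Measure.map_apply (by fun_prop) (measurableSet_cyl _ _)]
        split_ifs with h
        · have : consPath x ⁻¹' cyl 0 v = Set.univ := by ext X; simp [cyl, h]
          rw [this, measure_univ]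
        · have : consPath x ⁻¹' cyl 0 v = ∅ := by
            ext X; simpa [cyl] using fun h' => h h'.symm
          rw [this, measure_empty]
      simp_rw [h0, quenched_cyl_zero]
      split_ifs with h
      · subst h
        rw [← lintegral_indicator_one (measurableSet_singleton _)]
        simp only [lintegral_const, measure_univ, mul_one, one_mul]
        refine lintegral_congr fun y => ?_
        simp [Set.indicator_apply, shiftPath, eq_comm]
      · simp
    | succ n =>
      simp_rw [key n, quenched_cyl_succ]
      split_ifs with h
      · rw [lintegral_mul_const _ (measurable_of_countable _)]
        rfl
      · simp

/-- First-step decomposition of quenched expectations. -/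
theorem lintegral_quenched (ω : Env d) (x : Site d) {F : Path d → ℝ≥0∞} (hF : Measurable F) :
    ∫⁻ X, F X ∂(quenched ω x) =
      ∑' y, ENNReal.ofReal (transProb ω x y) * ∫⁻ X, F (consPath x X) ∂(quenched ω y) := by
  conv_lhs => rw [quenched_eq_bind]
  have hmeas : Measurable fun y => (quenched ω y).map (consPath x) := measurable_of_countable _
  rw [Measure.lintegral_bind hmeas.aemeasurable hF.aemeasurable, lintegral_stepKernel]
  refine tsum_congr fun y => ?_
  rw [lintegral_map hF (by fun_prop)]

/-- `F` is a function of the first `n` steps `X_0, …, X_n`. -/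
def DependsUpTo {α : Type*} (n : ℕ) (F : Path d → α) : Prop :=
  ∀ X Y : Path d, (∀ i ≤ n, X i = Y i) → F X = F Y

theorem DependsUpTo.cons {α : Type*} {n : ℕ} {F : Path d → α} (hF : DependsUpTo (n + 1) F)
    (x : Site d) : DependsUpTo n fun X => F (consPath x X) := by
  intro X Y h
  refine hF _ _ fun i hi => ?_
  cases i with
  | zero => rfl
  | succ i => exact h i (by omega)

/-- A function of finitely many steps is measurable, the lattice being countable. -/
theorem DependsUpTo.measurable {α : Type*} [MeasurableSpace α] {n : ℕ} {F : Path d → α}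
    (hF : DependsUpTo n F) : Measurable F := by
  have : F = (fun v : Fin (n + 1) → Site d => F fun i => if h : i < n + 1 then v ⟨i, h⟩ else 0) ∘
      fun X i => X i := by
    funext X
    refine hF _ _ fun i hi => ?_
    rw [dif_pos (by omega)]
  rw [this]
  exact (measurable_of_countable _).comp (measurable_pi_lambda _ fun i => measurable_pi_apply _)

/-- The Markov property at time `n`. -/
theorem markov (ω : Env d) (x : Site d) (n : ℕ) {F G : Path d → ℝ≥0∞} (hF : DependsUpTo n F)
    (hG : Measurable G) :
    ∫⁻ X, F X * G (shiftPath n X) ∂(quenched ω x) =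
      ∫⁻ X, F X * ∫⁻ Y, G Y ∂(quenched ω (X n)) ∂(quenched ω x) := by
  induction n generalizing x F with
  | zero =>
    have h1 : ∀ᵐ X ∂(quenched ω x), F X = F fun _ => x := by
      filter_upwards [quenched_zero ω x] with X hX
      exact hF _ _ fun i hi => by rw [Nat.le_zero.1 hi, hX]
    calc _ = ∫⁻ X, F (fun _ => x) * G X ∂(quenched ω x) := lintegral_congr_ae <| by
            filter_upwards [h1] with X hX
            rw [hX]; rfl
      _ = ∫⁻ X, F (fun _ => x) * ∫⁻ Y, G Y ∂(quenched ω x) ∂(quenched ω x) := by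
            rw [lintegral_const_mul _ hG]; simp
      _ = _ := lintegral_congr_ae <| by
            filter_upwards [h1, quenched_zero ω x] with X hX hX'
            rw [hX, hX']
  | succ n ih =>
    have hmF := hF.measurable
    have hm : Measurable fun X : Path d => ∫⁻ Y, G Y ∂(quenched ω (X (n + 1))) :=
      (measurable_of_countable fun y => ∫⁻ Y, G Y ∂(quenched ω y)).comp (measurable_pi_apply _)
    rw [lintegral_quenched ω x (F := fun X => F X * G (shiftPath (n + 1) X)) (by fun_prop),
      lintegral_quenched ω x
        (F := fun X => F X * ∫⁻ Y, G Y ∂(quenched ω (X (n + 1)))) (hmF.mul hm)]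
    refine tsum_congr fun y => ?_
    congr 1
    exact ih y (hF.cons x)

theorem lintegral_quenched_zero (ω : Env d) (x : Site d) {F : Path d → ℝ≥0∞}
    (hF : DependsUpTo 0 F) : ∫⁻ X, F X ∂(quenched ω x) = F fun _ => x := by
  calc _ = ∫⁻ X, F (fun _ => x) ∂(quenched ω x) := lintegral_congr_ae <| by
        filter_upwards [quenched_zero ω x] with X hX
        exact hF _ _ fun i hi => by rw [Nat.le_zero.1 hi, hX]
    _ = _ := by simp

/-- Up to the exit from `D`, the walk only sees the environment in `D`. -/
theorem lintegral_quenched_congr {ω ω' : Env d} {D : Set (Site d)} (hD : ∀ x ∈ D, ω x = ω' x)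
    (x : Site d) (n : ℕ) {F : Path d → ℝ≥0∞} (hF : DependsUpTo n F)
    (hFD : ∀ X, F X ≠ 0 → ∀ i < n, X i ∈ D) :
    ∫⁻ X, F X ∂(quenched ω x) = ∫⁻ X, F X ∂(quenched ω' x) := by
  induction n generalizing x F with
  | zero =>
    rw [lintegral_quenched_zero _ _ hF, lintegral_quenched_zero _ _ hF]
  | succ n ih =>
    rw [lintegral_quenched ω x hF.measurable, lintegral_quenched ω' x hF.measurable]
    refine tsum_congr fun y => ?_
    by_cases hx : x ∈ D
    · have hp : transProb ω x y = transProb ω' x y := by unfold transProb; rw [hD x hx]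
      rw [hp, ih y (hF.cons x) fun X hX i hi => hFD _ hX (i + 1) (by omega)]
    · have : ∀ X, F (consPath x X) = 0 := by
        intro X
        by_contra h
        exact hx (hFD _ h 0 (by omega))
      simp [this]

theorem measurable_transProb (x y : Site d) : Measurable fun ω : Env d => transProb ω x y :=
  (measurable_pi_apply (y - x)).comp (measurable_subtype_coe.comp (measurable_pi_apply x))

/-- Quenched expectations of functions of finitely many steps are measurable in the environment. -/
theorem measurable_lintegral_quenched {α : Type*} [MeasurableSpace α] {e : α → Env d}
    (he : Measurable e) (x : Site d) (n : ℕ) {F : α → Path d → ℝ≥0∞}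
    (hF : ∀ a, DependsUpTo n (F a)) (hm : ∀ X, Measurable fun a => F a X) :
    Measurable fun a => ∫⁻ X, F a X ∂(quenched (e a) x) := by
  induction n generalizing x F with
  | zero =>
    simp_rw [fun a => lintegral_quenched_zero (e a) x (hF a)]
    exact hm _
  | succ n ih =>
    have h1 : ∀ a, ∫⁻ X, F a X ∂(quenched (e a) x) =
        ∑' y, ENNReal.ofReal (transProb (e a) x y) * ∫⁻ X, F a (consPath x X) ∂(quenched (e a) y) :=
      fun a => lintegral_quenched _ _ (hF a).measurable
    simp_rw [h1]
    refine Measurable.tsum fun y => Measurable.mul ?_ ?_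
    · exact ENNReal.measurable_ofReal.comp ((measurable_transProb x y).comp he)
    · exact ih y (fun a => (hF a).cons x) fun X => hm _

/-- The walk started at `x + z` is the walk started at `x` in the shifted environment, moved by
`z`. -/
theorem lintegral_quenched_add (ω : Env d) (x z : Site d) (n : ℕ) {F : Path d → ℝ≥0∞}
    (hF : DependsUpTo n F) :
    ∫⁻ X, F X ∂(quenched ω (x + z)) =
      ∫⁻ X, F (fun i => X i + z) ∂(quenched (shiftEnv z ω) x) := by
  induction n generalizing x F with
  | zero =>
    rw [lintegral_quenched_zero _ _ hF,
      lintegral_quenched_zero (F := fun X => F (fun i => X i + z))]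
    exact fun X Y h => hF _ _ fun i hi => by simp only [h i hi]
  | succ n ih =>
    have hF' : DependsUpTo (n + 1) fun X => F (fun i => X i + z) :=
      fun X Y h => hF _ _ fun i hi => by simp only [h i hi]
    rw [lintegral_quenched ω (x + z) hF.measurable,
      lintegral_quenched (shiftEnv z ω) x hF'.measurable,
      ← (Equiv.addRight z).tsum_eq]
    refine tsum_congr fun y => ?_
    have hp : transProb ω (x + z) (y + z) = transProb (shiftEnv z ω) x y := by
      simp [transProb, shiftEnv]
    rw [Equiv.coe_addRight, ih y (hF.cons (x + z)), hp]
    congr 1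
    refine lintegral_congr fun X => hF _ _ fun i _ => ?_
    cases i <;> rfl

/-! ### One step of the walk -/

theorem len_nonneg (z : Site d) : 0 ≤ len z := norm_nonneg _

theorem len_zero : len (0 : Site d) = 0 := by
  unfold len
  rw [norm_eq_zero]
  ext i
  simp

theorem len_add_le (y z : Site d) : len (y + z) ≤ len y + len z := by
  unfold len
  have : (WithLp.toLp 2 fun i => (((y + z) i : ℤ) : ℝ)) =
      WithLp.toLp 2 (fun i => (y i : ℝ)) + WithLp.toLp 2 (fun i => (z i : ℝ)) := by
    ext i; simp
  rw [this]
  exact norm_add_le _ _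

theorem len_pos {u : Site d} (hu : u ≠ 0) : 0 < len u := by
  refine norm_pos_iff.2 fun h => hu ?_
  funext i
  have := congrArg (fun v : EuclideanSpace ℝ (Fin d) => v i) h
  simpa using this

/-- The Cauchy-Schwarz inequality for the level of a lattice point. -/
theorem abs_dotProduct_le (z u : Site d) : |((z ⬝ᵥ u : ℤ) : ℝ)| ≤ len u * len z := by
  have h := abs_real_inner_le_norm (WithLp.toLp 2 fun i => (u i : ℝ))
    (WithLp.toLp 2 fun i => (z i : ℝ))
  have h2 : inner ℝ (WithLp.toLp 2 fun i => (u i : ℝ)) (WithLp.toLp 2 fun i => (z i : ℝ)) =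
      ((z ⬝ᵥ u : ℤ) : ℝ) := by
    simp [PiLp.inner_apply, dotProduct]
  rw [h2] at h
  exact h

theorem ofReal_exp_mul {a b : ℝ} :
    ENNReal.ofReal (Real.exp a) * ENNReal.ofReal (Real.exp b) = ENNReal.ofReal (Real.exp (a + b)) := by
  rw [← ENNReal.ofReal_mul (Real.exp_pos _).le, Real.exp_add]

namespace StepLaw

variable (p : StepLaw d)

theorem nonneg (z : Site d) : 0 ≤ p.1 z := p.2.1 z

variable {p}

theorem tsum_ofReal_mul {g : Site d → ℝ} (hg : ∀ z, 0 ≤ g z) (hs : Summable fun z => p.1 z * g z) :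
    ∑' z, ENNReal.ofReal (p.1 z) * ENNReal.ofReal (g z) = ENNReal.ofReal (∑' z, p.1 z * g z) := by
  rw [ENNReal.ofReal_tsum_of_nonneg (fun z => mul_nonneg (nonneg p z) (hg z)) hs]
  exact tsum_congr fun z => (ENNReal.ofReal_mul (nonneg p z)).symm

end StepLaw

variable {p : StepLaw d} {u : Site d} {δ M s₀ : ℝ}

theorem ExpMomentLE.summable (h : ExpMomentLE s₀ M p) :
    Summable fun z => p.1 z * Real.exp (s₀ * len z) := by
  have h1 : ∑' z : Site d, ENNReal.ofReal (Real.exp (s₀ * len z) * p.1 z) ≠ ⊤ :=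
    (h.trans_lt ENNReal.ofReal_lt_top).ne
  have := ENNReal.summable_toReal h1
  refine this.congr fun z => ?_
  rw [ENNReal.toReal_ofReal (mul_nonneg (Real.exp_pos _).le (p.2.1 z)), mul_comm]

theorem ExpMomentLE.tsum_le (h : ExpMomentLE s₀ M p) :
    ∑' z, p.1 z * Real.exp (s₀ * len z) ≤ Real.exp (s₀ * M) := by
  have h1 := h
  unfold ExpMomentLE at h1
  rw [← ENNReal.ofReal_tsum_of_nonneg (fun z => mul_nonneg (Real.exp_pos _).le (p.2.1 z))
    (h.summable.congr fun z => mul_comm _ _), ENNReal.ofReal_le_ofReal_iff (Real.exp_pos _).le] at h1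
  exact (tsum_congr fun z => mul_comm _ _).trans_le h1

theorem sq_le_exp {s t : ℝ} (hs : 0 < s) (ht : 0 ≤ t) :
    t ^ 2 ≤ 8 / s ^ 2 * Real.exp (s * t / 2) := by
  have h := Real.quadratic_le_exp_of_nonneg (x := s * t / 2) (by positivity)
  have h2 : (s * t / 2) ^ 2 / 2 ≤ Real.exp (s * t / 2) := by nlinarith [mul_nonneg hs.le ht]
  calc t ^ 2 = 8 / s ^ 2 * ((s * t / 2) ^ 2 / 2) := by field_simp; norm_num
    _ ≤ _ := by gcongr

theorem exp_le_quadratic (t : ℝ) : Real.exp t ≤ 1 + t + t ^ 2 * Real.exp |t| := by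
  have h := Complex.norm_exp_sub_sum_le_norm_mul_exp (t : ℂ) 2
  simp only [Finset.sum_range_succ, Finset.sum_range_zero] at h
  norm_num at h
  have h2 : Complex.exp t - (1 + t) = ((Real.exp t - (1 + t) : ℝ) : ℂ) := by push_cast; ring
  rw [h2, Complex.norm_real, Real.norm_eq_abs] at h
  linarith [le_abs_self (Real.exp t - (1 + t))]

/-- A bound for `∑_z (z·u)² e^{s|z·u|} p_z`, uniform in `s|u| ≤ s₀/2`. -/
noncomputable def momentConst (u : Site d) (M s₀ : ℝ) : ℝ :=
  8 * len u ^ 2 / s₀ ^ 2 * Real.exp (s₀ * M)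

/-- The exponent up to which the exponential estimates hold. -/
noncomputable def expRate (u : Site d) (δ M s₀ : ℝ) : ℝ :=
  min s₀ (min (s₀ / (2 * len u)) (min (δ / (2 * momentConst u M s₀)) (1 / δ)))

theorem momentConst_pos (hu : u ≠ 0) (hs₀ : 0 < s₀) : 0 < momentConst u M s₀ := by
  have := len_pos hu
  unfold momentConst; positivity

theorem expRate_pos (hu : u ≠ 0) (hδ : 0 < δ) (hs₀ : 0 < s₀) : 0 < expRate u δ M s₀ := by
  have h1 := len_pos hu
  have h2 := momentConst_pos (M := M) hu hs₀
  unfold expRate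
  refine lt_min hs₀ (lt_min ?_ (lt_min ?_ ?_)) <;> positivity

theorem expRate_le : expRate u δ M s₀ ≤ s₀ := min_le_left _ _

theorem sq_mul_exp_le (hu : u ≠ 0) (hs₀ : 0 < s₀) {s : ℝ}
    (hsu : s ≤ s₀ / (2 * len u)) (z : Site d) :
    ((z ⬝ᵥ u : ℤ) : ℝ) ^ 2 * Real.exp (s * |((z ⬝ᵥ u : ℤ) : ℝ)|) ≤
      8 * len u ^ 2 / s₀ ^ 2 * Real.exp (s₀ * len z) := by
  have hU := len_pos hu
  have h1 := abs_dotProduct_le z u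
  have h2 := sq_le_exp hs₀ (len_nonneg z)
  have h3 : ((z ⬝ᵥ u : ℤ) : ℝ) ^ 2 ≤ len u ^ 2 * len z ^ 2 := by
    rw [← sq_abs, ← mul_pow]; gcongr
  have h4 : s * |((z ⬝ᵥ u : ℤ) : ℝ)| ≤ s₀ * len z / 2 := by
    calc s * |((z ⬝ᵥ u : ℤ) : ℝ)| ≤ s₀ / (2 * len u) * (len u * len z) := by gcongr
      _ = _ := by field_simp
  calc _ ≤ (len u ^ 2 * (8 / s₀ ^ 2 * Real.exp (s₀ * len z / 2))) * Real.exp (s₀ * len z / 2) := by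
        gcongr; exact h3.trans (by gcongr)
    _ = 8 * len u ^ 2 / s₀ ^ 2 * (Real.exp (s₀ * len z / 2) * Real.exp (s₀ * len z / 2)) := by ring
    _ = _ := by rw [← Real.exp_add]; congr 2; ring

theorem summable_sq (hu : u ≠ 0) (hs₀ : 0 < s₀) (h : ExpMomentLE s₀ M p) :
    Summable fun z => p.1 z * ((z ⬝ᵥ u : ℤ) : ℝ) ^ 2 := by
  refine Summable.of_nonneg_of_le (fun z => mul_nonneg (p.2.1 z) (sq_nonneg _)) (fun z => ?_)
    (h.summable.mul_left (8 * len u ^ 2 / s₀ ^ 2))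
  have := sq_mul_exp_le hu hs₀ (s := 0) (by have := len_pos hu; positivity) z
  rw [zero_mul, Real.exp_zero, mul_one] at this
  calc _ ≤ p.1 z * (8 * len u ^ 2 / s₀ ^ 2 * Real.exp (s₀ * len z)) := by
        gcongr; exact p.2.1 z
    _ = _ := by ring

theorem tsum_sq_le (hu : u ≠ 0) (hs₀ : 0 < s₀) (h : ExpMomentLE s₀ M p) :
    ∑' z, p.1 z * ((z ⬝ᵥ u : ℤ) : ℝ) ^ 2 ≤ momentConst u M s₀ := by
  calc _ ≤ ∑' z, 8 * len u ^ 2 / s₀ ^ 2 * (p.1 z * Real.exp (s₀ * len z)) := by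
        refine (summable_sq hu hs₀ h).tsum_le_tsum (fun z => ?_) (h.summable.mul_left _)
        have := sq_mul_exp_le hu hs₀ (s := 0) (by have := len_pos hu; positivity) z
        rw [zero_mul, Real.exp_zero, mul_one] at this
        calc _ ≤ p.1 z * (8 * len u ^ 2 / s₀ ^ 2 * Real.exp (s₀ * len z)) := by
              gcongr; exact p.2.1 z
          _ = _ := by ring
    _ ≤ _ := by
        rw [tsum_mul_left]
        exact mul_le_mul_of_nonneg_left h.tsum_le (by positivity)

theorem summable_drift (hu : u ≠ 0) (hs₀ : 0 < s₀) (h : ExpMomentLE s₀ M p) :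
    Summable fun z => p.1 z * ((z ⬝ᵥ u : ℤ) : ℝ) := by
  refine Summable.of_norm_bounded (g := fun z => p.1 z + p.1 z * ((z ⬝ᵥ u : ℤ) : ℝ) ^ 2)
    (p.2.2.summable.add (summable_sq hu hs₀ h)) fun z => ?_
  rw [norm_mul, Real.norm_eq_abs, Real.norm_eq_abs, abs_of_nonneg (p.2.1 z)]
  have : |((z ⬝ᵥ u : ℤ) : ℝ)| ≤ 1 + ((z ⬝ᵥ u : ℤ) : ℝ) ^ 2 := by
    rw [← sq_abs]; nlinarith [sq_nonneg (|((z ⬝ᵥ u : ℤ) : ℝ)| - 1)]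
  calc _ ≤ p.1 z * (1 + ((z ⬝ᵥ u : ℤ) : ℝ) ^ 2) := mul_le_mul_of_nonneg_left this (p.2.1 z)
    _ = _ := by ring

theorem DriftGE.le_tsum (h : DriftGE u δ p) : δ ≤ ∑' z, p.1 z * ((z ⬝ᵥ u : ℤ) : ℝ) :=
  h.trans_eq (tsum_congr fun _ => mul_comm _ _)

/-- The drift makes `e^{-s x·u}` contract in one step. -/
theorem tsum_exp_neg_le (hu : u ≠ 0) (hδ : 0 < δ) (hs₀ : 0 < s₀) (hd : DriftGE u δ p)
    (hm : ExpMomentLE s₀ M p) {s : ℝ} (hs : 0 ≤ s) (hs1 : s ≤ expRate u δ M s₀) :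
    ∑' z, ENNReal.ofReal (p.1 z) * ENNReal.ofReal (Real.exp (-s * ((z ⬝ᵥ u : ℤ) : ℝ))) ≤
      ENNReal.ofReal (1 - s * δ / 2) := by
  have hsu : s ≤ s₀ / (2 * len u) :=
    hs1.trans ((min_le_right _ _).trans (min_le_left _ _))
  have hsB : s ≤ δ / (2 * momentConst u M s₀) :=
    hs1.trans ((min_le_right _ _).trans ((min_le_right _ _).trans (min_le_left _ _)))
  have hB := momentConst_pos (M := M) hu hs₀
  have hpt : ∀ z, p.1 z * Real.exp (-s * ((z ⬝ᵥ u : ℤ) : ℝ)) ≤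
      p.1 z + (-s) * (p.1 z * ((z ⬝ᵥ u : ℤ) : ℝ)) +
        s ^ 2 * (8 * len u ^ 2 / s₀ ^ 2 * (p.1 z * Real.exp (s₀ * len z))) := by
    intro z
    have h1 := exp_le_quadratic (-s * ((z ⬝ᵥ u : ℤ) : ℝ))
    have h2 := sq_mul_exp_le hu hs₀ hsu z
    rw [abs_mul, abs_neg, abs_of_nonneg hs] at h1
    calc _ ≤ p.1 z * (1 + -s * ((z ⬝ᵥ u : ℤ) : ℝ) + s ^ 2 *
            (8 * len u ^ 2 / s₀ ^ 2 * Real.exp (s₀ * len z))) := by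
          refine mul_le_mul_of_nonneg_left (h1.trans ?_) (p.2.1 z)
          nlinarith [mul_le_mul_of_nonneg_left h2 (sq_nonneg s)]
      _ = _ := by ring
  have hsum : Summable fun z => p.1 z + (-s) * (p.1 z * ((z ⬝ᵥ u : ℤ) : ℝ)) +
        s ^ 2 * (8 * len u ^ 2 / s₀ ^ 2 * (p.1 z * Real.exp (s₀ * len z))) :=
    (p.2.2.summable.add ((summable_drift hu hs₀ hm).mul_left _)).add
      ((hm.summable.mul_left _).mul_left _)
  have hs' := Summable.of_nonneg_of_le
    (fun z => mul_nonneg (p.2.1 z) (Real.exp_pos (-s * ((z ⬝ᵥ u : ℤ) : ℝ))).le) hpt hsum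
  rw [StepLaw.tsum_ofReal_mul (fun z => (Real.exp_pos _).le) hs']
  refine ENNReal.ofReal_le_ofReal ((hs'.tsum_le_tsum hpt hsum).trans ?_)
  rw [(p.2.2.summable.add ((summable_drift hu hs₀ hm).mul_left _)).tsum_add
      ((hm.summable.mul_left _).mul_left _),
    p.2.2.summable.tsum_add ((summable_drift hu hs₀ hm).mul_left _), p.2.2.tsum_eq,
    tsum_mul_left, tsum_mul_left, tsum_mul_left]
  have h3 := hd.le_tsum
  have h4 : 8 * len u ^ 2 / s₀ ^ 2 * ∑' z, p.1 z * Real.exp (s₀ * len z) ≤ momentConst u M s₀ :=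
    mul_le_mul_of_nonneg_left hm.tsum_le (by positivity)
  have h5 : s * momentConst u M s₀ ≤ δ / 2 := by
    calc _ ≤ δ / (2 * momentConst u M s₀) * momentConst u M s₀ := by gcongr
      _ = _ := by field_simp
  nlinarith [mul_le_mul_of_nonneg_left h3 hs, mul_le_mul_of_nonneg_left h4 (sq_nonneg s),
    mul_le_mul_of_nonneg_left h5 hs]

/-- Jensen's inequality for the exponential moments. -/
theorem tsum_exp_len_le (hs₀ : 0 < s₀) (hm : ExpMomentLE s₀ M p) {s : ℝ} (hs : 0 ≤ s)
    (hs1 : s ≤ s₀) :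
    ∑' z, ENNReal.ofReal (p.1 z) * ENNReal.ofReal (Real.exp (s * len z)) ≤
      ENNReal.ofReal (Real.exp (s * M)) := by
  have hθ0 : 0 ≤ s / s₀ := by positivity
  have hθ1 : s / s₀ ≤ 1 := (div_le_one hs₀).2 hs1
  have hpt : ∀ z, p.1 z * Real.exp (s * len z) ≤ Real.exp (s * M) * ((1 - s / s₀) * p.1 z +
      s / s₀ * Real.exp (-(s₀ * M)) * (p.1 z * Real.exp (s₀ * len z))) := by
    intro z
    have h := convexOn_exp.2 (Set.mem_univ 0) (Set.mem_univ (s₀ * len z - s₀ * M))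
      (sub_nonneg.2 hθ1) hθ0 (by ring)
    simp only [smul_eq_mul, mul_zero, zero_add, Real.exp_zero, mul_one] at h
    have h2 : s / s₀ * (s₀ * len z - s₀ * M) = s * len z - s * M := by field_simp
    rw [h2] at h
    have h3 : Real.exp (s * len z) = Real.exp (s * M) * Real.exp (s * len z - s * M) := by
      rw [← Real.exp_add]; congr 1; ring
    have h4 : Real.exp (s₀ * len z - s₀ * M) = Real.exp (-(s₀ * M)) * Real.exp (s₀ * len z) := by
      rw [← Real.exp_add]; congr 1; ring
    rw [h3]
    calc _ = (Real.exp (s * M) * p.1 z) * Real.exp (s * len z - s * M) := by ring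
      _ ≤ (Real.exp (s * M) * p.1 z) * _ :=
          mul_le_mul_of_nonneg_left h (mul_nonneg (Real.exp_pos _).le (p.2.1 z))
      _ = _ := by rw [h4]; ring
  have hsum : Summable fun z => Real.exp (s * M) * ((1 - s / s₀) * p.1 z +
      s / s₀ * Real.exp (-(s₀ * M)) * (p.1 z * Real.exp (s₀ * len z))) :=
    ((p.2.2.summable.mul_left _).add (hm.summable.mul_left _)).mul_left _
  have hs' := Summable.of_nonneg_of_le
    (fun z => mul_nonneg (p.2.1 z) (Real.exp_pos (s * len z)).le) hpt hsum
  rw [StepLaw.tsum_ofReal_mul (fun z => (Real.exp_pos _).le) hs']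
  refine ENNReal.ofReal_le_ofReal ((hs'.tsum_le_tsum hpt hsum).trans ?_)
  rw [tsum_mul_left, (p.2.2.summable.mul_left _).tsum_add (hm.summable.mul_left _), tsum_mul_left,
    tsum_mul_left, p.2.2.tsum_eq]
  have h5 : s / s₀ * Real.exp (-(s₀ * M)) * ∑' z, p.1 z * Real.exp (s₀ * len z) ≤ s / s₀ := by
    calc _ ≤ s / s₀ * Real.exp (-(s₀ * M)) * Real.exp (s₀ * M) := by
          gcongr; exact hm.tsum_le
      _ = _ := by rw [mul_assoc, ← Real.exp_add]; simp
  calc _ ≤ Real.exp (s * M) * 1 := by gcongr; linarith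
    _ = _ := mul_one _

/-- A positive drift and a bounded second moment force upward steps; levels being integers, an
upward step gains at least one level. -/
theorem le_tsum_up (hu : u ≠ 0) (hδ : 0 < δ) (hs₀ : 0 < s₀) (hd : DriftGE u δ p)
    (hm : ExpMomentLE s₀ M p) :
    ENNReal.ofReal (δ ^ 2 / momentConst u M s₀) ≤
      ∑' z, ENNReal.ofReal (p.1 z) * ENNReal.ofReal (if 1 ≤ z ⬝ᵥ u then 1 else 0) := by
  have hB := momentConst_pos (M := M) hu hs₀
  set B := momentConst u M s₀
  have hs' : Summable fun z => p.1 z * (if 1 ≤ z ⬝ᵥ u then 1 else 0 : ℝ) := by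
    refine Summable.of_nonneg_of_le (fun z => mul_nonneg (p.2.1 z) (by split_ifs <;> simp))
      (fun z => ?_) p.2.2.summable
    have := p.2.1 z
    split_ifs <;> simp [this]
  rw [StepLaw.tsum_ofReal_mul (fun z => by split_ifs <;> simp) hs']
  refine ENNReal.ofReal_le_ofReal ?_
  have hpt : ∀ z, p.1 z * ((z ⬝ᵥ u : ℤ) : ℝ) ≤ δ / (2 * B) * (p.1 z * ((z ⬝ᵥ u : ℤ) : ℝ) ^ 2) +
      B / (2 * δ) * (p.1 z * (if 1 ≤ z ⬝ᵥ u then 1 else 0 : ℝ)) := by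
    intro z
    have h0 := p.2.1 z
    have h1 : ((z ⬝ᵥ u : ℤ) : ℝ) ≤ δ / (2 * B) * ((z ⬝ᵥ u : ℤ) : ℝ) ^ 2 +
        B / (2 * δ) * (if 1 ≤ z ⬝ᵥ u then 1 else 0 : ℝ) := by
      split_ifs with h
      · have : δ / (2 * B) * ((z ⬝ᵥ u : ℤ) : ℝ) ^ 2 + B / (2 * δ) * 1 - ((z ⬝ᵥ u : ℤ) : ℝ) =
            (δ * ((z ⬝ᵥ u : ℤ) : ℝ) - B) ^ 2 / (2 * B * δ) := by field_simp; ring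
        have h3 : 0 ≤ (δ * ((z ⬝ᵥ u : ℤ) : ℝ) - B) ^ 2 / (2 * B * δ) := by positivity
        linarith
      · have : ((z ⬝ᵥ u : ℤ) : ℝ) ≤ 0 := by exact_mod_cast (by omega : z ⬝ᵥ u ≤ 0)
        have h3 : 0 ≤ δ / (2 * B) * ((z ⬝ᵥ u : ℤ) : ℝ) ^ 2 := by positivity
        linarith
    calc _ ≤ p.1 z * _ := mul_le_mul_of_nonneg_left h1 h0
      _ = _ := by ring
  have h1 := (summable_drift hu hs₀ hm).tsum_le_tsum hpt
    (((summable_sq hu hs₀ hm).mul_left _).add (hs'.mul_left _))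
  rw [((summable_sq hu hs₀ hm).mul_left _).tsum_add (hs'.mul_left _), tsum_mul_left,
    tsum_mul_left] at h1
  have h2 := hd.le_tsum
  have h3 : δ / (2 * B) * ∑' z, p.1 z * ((z ⬝ᵥ u : ℤ) : ℝ) ^ 2 ≤ δ / 2 := by
    calc _ ≤ δ / (2 * B) * B := by gcongr; exact tsum_sq_le hu hs₀ hm
      _ = _ := by field_simp
  set t := ∑' z, p.1 z * (if 1 ≤ z ⬝ᵥ u then 1 else 0 : ℝ)
  have h4 : δ / 2 ≤ B / (2 * δ) * t := by linarith
  rw [div_le_iff₀ hB]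
  calc δ ^ 2 = 2 * δ * (δ / 2) := by ring
    _ ≤ 2 * δ * (B / (2 * δ) * t) := by gcongr
    _ = _ := by field_simp

/-! ### Analytic preliminaries -/

theorem rpow_le_exp {t q a : ℝ} (ht : 0 ≤ t) (hq : 0 < q) (ha : 0 < a) :
    t ^ q ≤ (q / a) ^ q * Real.exp (a * t) := by
  have h1 : t ≤ q / a * Real.exp (a * t / q) := by
    have := Real.add_one_le_exp (a * t / q)
    calc t = q / a * (a * t / q) := by field_simp
      _ ≤ _ := by gcongr; linarith
  calc t ^ q ≤ (q / a * Real.exp (a * t / q)) ^ q := by gcongr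
    _ = _ := by
      rw [Real.mul_rpow (by positivity) (Real.exp_pos _).le, ← Real.exp_mul]
      congr 2; field_simp

theorem tsum_ofReal_exp {a b : ℝ} (ha : 0 ≤ a) (hb : 0 < b) :
    ∑' n : ℕ, ENNReal.ofReal (a * Real.exp (-b * n)) =
      ENNReal.ofReal (a / (1 - Real.exp (-b))) := by
  have h1 : Real.exp (-b) < 1 := Real.exp_lt_one_iff.2 (by linarith)
  have h2 : ∀ n : ℕ, a * Real.exp (-b * n) = a * Real.exp (-b) ^ n := fun n => by
    rw [← Real.exp_nat_mul]; ring_nf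
  simp_rw [h2]
  rw [← ENNReal.ofReal_tsum_of_nonneg (fun n => mul_nonneg ha (pow_nonneg (Real.exp_pos _).le n))
    ((summable_geometric_of_lt_one (Real.exp_pos _).le h1).mul_left a), tsum_mul_left,
    tsum_geometric_of_lt_one (Real.exp_pos _).le h1, div_eq_mul_inv]

theorem one_sub_exp_pos {b : ℝ} (hb : 0 < b) : 0 < 1 - Real.exp (-b) := by
  have : Real.exp (-b) < 1 := Real.exp_lt_one_iff.2 (by linarith)
  linarith

/-- The constant in the moment bound `lintegral_rpow_le_of_tail`. -/
noncomputable def tailConst (p c : ℝ) : ℝ :=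
  (p / (c / 4)) ^ p * Real.exp (c / 4 + c / 2) / (1 - Real.exp (-(c / 4)))

theorem tailConst_nonneg {p c : ℝ} (hp : 0 < p) (hc : 0 < c) : 0 ≤ tailConst p c := by
  have := one_sub_exp_pos (b := c / 4) (by linarith)
  unfold tailConst; positivity

/-- A random time whose tail is exponential from `K` on has `p`-th moments of order `K^p`. -/
theorem lintegral_rpow_le_of_tail {α : Type*} [MeasurableSpace α] {μ : Measure α}
    (hμ : μ Set.univ ≤ 1) {T : α → ℕ∞} (hT : Measurable T) {p c K D : ℝ} (hp : 0 < p)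
    (hc : 0 < c) (hK : 0 ≤ K) (hD : 0 ≤ D)
    (tail : ∀ n : ℕ, μ {x | (n : ℕ∞) < T x} ≤ ENNReal.ofReal (D * Real.exp (c * (K - n)))) :
    ∫⁻ x, (T x : ℝ≥0∞) ^ p ∂μ ≤ ENNReal.ofReal ((2 * K) ^ p + D * tailConst p c) := by
  classical
  let f : ℕ → α → ℝ≥0∞ := fun n x =>
    {x | (n : ℕ∞) < T x}.indicator (fun _ => if 2 * K < n + 1 then
      ENNReal.ofReal (((n : ℝ) + 1) ^ p) else 0) x
  have hms : ∀ n : ℕ, MeasurableSet {x | (n : ℕ∞) < T x} := fun n =>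
    hT (MeasurableSet.of_discrete (s := Set.Ioi (n : ℕ∞)))
  have hf : ∀ n, Measurable (f n) := fun n => measurable_const.indicator (hms n)
  have hpt : ∀ x, (T x : ℝ≥0∞) ^ p ≤ ENNReal.ofReal ((2 * K) ^ p) + ∑' n, f n x := by
    intro x
    rcases eq_or_ne (T x) ⊤ with h | h
    · obtain ⟨N, hN⟩ := exists_nat_gt (2 * K)
      have h1 : ∀ m : ℕ, 1 ≤ f (m + N) x := by
        intro m
        have h2 : 2 * K < ((m + N : ℕ) : ℝ) + 1 := by push_cast; linarith [m.cast_nonneg (α := ℝ)]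
        simp only [f]
        rw [Set.indicator_of_mem (by simp only [Set.mem_ofPred_eq, h]; exact ENat.natCast_lt_top _),
          if_pos h2,
          ← ENNReal.ofReal_one]
        refine ENNReal.ofReal_le_ofReal (Real.one_le_rpow ?_ hp.le)
        linarith [(m + N).cast_nonneg (α := ℝ)]
      have h3 : ∑' n, f n x = ⊤ := by
        rw [eq_top_iff]
        calc (⊤ : ℝ≥0∞) = ∑' _ : ℕ, (1 : ℝ≥0∞) :=
              (ENNReal.tsum_const_eq_top_of_ne_zero one_ne_zero).symm
          _ ≤ ∑' m : ℕ, f (m + N) x := ENNReal.tsum_le_tsum h1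
          _ ≤ _ := ENNReal.tsum_comp_le_tsum_of_injective (add_left_injective N) fun n => f n x
      rw [h3, add_top]; exact le_top
    · obtain ⟨m, hm⟩ := ENat.ne_top_iff_exists.1 h
      rw [← hm, ENat.toENNReal_coe, ← ENNReal.ofReal_natCast,
        ENNReal.ofReal_rpow_of_nonneg m.cast_nonneg hp.le]
      by_cases hmK : (m : ℝ) ≤ 2 * K
      · exact (ENNReal.ofReal_le_ofReal (by gcongr)).trans le_self_add
      · obtain ⟨n, rfl⟩ : ∃ n, m = n + 1 := Nat.exists_eq_succ_of_ne_zero (by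
          rintro rfl; simp at hmK; linarith)
        refine le_trans ?_ (le_add_left (ENNReal.le_tsum n))
        simp only [f]
        rw [Set.indicator_of_mem (by
          simp only [Set.mem_ofPred_eq, ← hm]; exact_mod_cast Nat.lt_succ_self n), if_pos]
        · push_cast; rfl
        · push_cast at hmK; linarith
  have hint : ∀ n, ∫⁻ x, f n x ∂μ ≤ ENNReal.ofReal
      ((D * ((p / (c / 4)) ^ p * Real.exp (c / 4 + c / 2))) * Real.exp (-(c / 4) * n)) := by
    intro n
    simp only [f]
    rw [lintegral_indicator_const (hms n)]
    split_ifs with h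
    · refine (mul_le_mul_right (tail n) _).trans ?_
      rw [← ENNReal.ofReal_mul (by positivity)]
      refine ENNReal.ofReal_le_ofReal ?_
      have h1 := rpow_le_exp (t := (n : ℝ) + 1) (by positivity) hp (a := c / 4) (by positivity)
      have h2 : Real.exp (c * (K - n)) ≤ Real.exp (c / 2 - c / 2 * n) := by
        refine Real.exp_le_exp.2 ?_
        nlinarith
      calc _ ≤ ((p / (c / 4)) ^ p * Real.exp (c / 4 * (n + 1))) *
            (D * Real.exp (c / 2 - c / 2 * n)) := by gcongr
        _ = D * (p / (c / 4)) ^ p * (Real.exp (c / 4 * (n + 1)) * Real.exp (c / 2 - c / 2 * n)) := by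
            ring
        _ = D * (p / (c / 4)) ^ p * (Real.exp (c / 4 + c / 2) * Real.exp (-(c / 4) * n)) := by
            rw [← Real.exp_add, ← Real.exp_add]; ring_nf
        _ = _ := by ring
    · simp
  calc ∫⁻ x, (T x : ℝ≥0∞) ^ p ∂μ ≤ ∫⁻ x, ENNReal.ofReal ((2 * K) ^ p) + ∑' n, f n x ∂μ :=
        lintegral_mono hpt
    _ = ENNReal.ofReal ((2 * K) ^ p) * μ Set.univ + ∑' n, ∫⁻ x, f n x ∂μ := by
        rw [lintegral_add_left measurable_const, lintegral_const,
          lintegral_tsum fun n => (hf n).aemeasurable]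
    _ ≤ ENNReal.ofReal ((2 * K) ^ p) * 1 + ∑' n : ℕ, ENNReal.ofReal
      ((D * ((p / (c / 4)) ^ p * Real.exp (c / 4 + c / 2))) * Real.exp (-(c / 4) * n)) := by
        gcongr with n; exact hint n
    _ = _ := by
        rw [tsum_ofReal_exp (by positivity) (by positivity), mul_one,
          ← ENNReal.ofReal_add (by positivity)]
        · congr 2; unfold tailConst; ring
        · have := one_sub_exp_pos (b := c / 4) (by positivity)
          positivity

/-! ### Exponential estimates for the quenched walk -/

/-- Environments all of whose step laws satisfy the drift and the moment hypothesis. -/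
def GoodEnv (u : Site d) (δ M s₀ : ℝ) (ω : Env d) : Prop :=
  ∀ x, DriftGE u δ (ω x) ∧ ExpMomentLE s₀ M (ω x)

theorem tsum_transProb (ω : Env d) (x : Site d) (f : Site d → ℝ≥0∞) :
    ∑' y, ENNReal.ofReal (transProb ω x y) * f y =
      ∑' z, ENNReal.ofReal ((ω x).1 z) * f (x + z) := by
  rw [← (Equiv.addLeft x).tsum_eq]
  refine tsum_congr fun z => ?_
  simp [transProb]

theorem tsum_transProb_eq_one (ω : Env d) (x : Site d) :
    ∑' y, ENNReal.ofReal (transProb ω x y) = 1 := by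
  have h := tsum_transProb ω x fun _ => 1
  simp only [mul_one] at h
  rw [h, ← ENNReal.ofReal_tsum_of_nonneg (ω x).2.1 (ω x).2.2.summable, (ω x).2.2.tsum_eq,
    ENNReal.ofReal_one]

/-- The one-step estimates, at a fixed exponent `s`, from which the moment bounds follow. -/
structure StepBounds (u : Site d) (s c M κ : ℝ) (ω : Env d) : Prop where
  s_pos : 0 < s
  c_pos : 0 < c
  M_pos : 0 < M
  exp_level : ∀ x, ∑' y, ENNReal.ofReal (transProb ω x y) *
      ENNReal.ofReal (Real.exp (-s * ((y ⬝ᵥ u : ℤ) : ℝ))) ≤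
    ENNReal.ofReal (Real.exp (-s * ((x ⬝ᵥ u : ℤ) : ℝ) - c))
  exp_len : ∀ x, ∑' y, ENNReal.ofReal (transProb ω x y) *
      ENNReal.ofReal (Real.exp (s * len (y - x))) ≤ ENNReal.ofReal (Real.exp (s * M))
  up : ∀ x, ENNReal.ofReal κ ≤ ∑' y, ENNReal.ofReal (transProb ω x y) *
      ENNReal.ofReal (if x ⬝ᵥ u + 1 ≤ y ⬝ᵥ u then 1 else 0)

theorem DependsUpTo.measurableSet {n : ℕ} {S : Set (Path d)} (h : DependsUpTo n fun X => X ∈ S) :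
    MeasurableSet S := measurableSet_setOfPred.2 h.measurable

theorem quenched_apply (ω : Env d) (x : Site d) {S : Set (Path d)} (hS : MeasurableSet S) :
    quenched ω x S =
      ∑' y, ENNReal.ofReal (transProb ω x y) * quenched ω y (consPath x ⁻¹' S) := by
  rw [← lintegral_indicator_one hS, lintegral_quenched ω x (measurable_one.indicator hS)]
  refine tsum_congr fun y => ?_
  congr 1
  rw [← lintegral_indicator_one (measurable_consPath x hS)]
  rfl

theorem lintegral_exp_level_le {u : Site d} {s r : ℝ} {ω : Env d} (hr : 0 ≤ r)
    (h : ∀ x, ∑' y, ENNReal.ofReal (transProb ω x y) *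
      ENNReal.ofReal (Real.exp (-s * ((y ⬝ᵥ u : ℤ) : ℝ))) ≤
      ENNReal.ofReal (Real.exp (-s * ((x ⬝ᵥ u : ℤ) : ℝ)) * r)) (x : Site d) (n : ℕ) :
    ∫⁻ X, ENNReal.ofReal (Real.exp (-s * ((X n ⬝ᵥ u : ℤ) : ℝ))) ∂(quenched ω x) ≤
      ENNReal.ofReal (Real.exp (-s * ((x ⬝ᵥ u : ℤ) : ℝ)) * r ^ n) := by
  have hdep : ∀ n, DependsUpTo n fun X : Path d =>
      ENNReal.ofReal (Real.exp (-s * ((X n ⬝ᵥ u : ℤ) : ℝ))) := fun n X Y h => by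
    simp only [h n le_rfl]
  induction n generalizing x with
  | zero => rw [lintegral_quenched_zero _ _ (hdep 0)]; simp
  | succ n ih =>
    rw [lintegral_quenched _ _ (hdep _).measurable]
    calc _ ≤ ∑' y, ENNReal.ofReal (transProb ω x y) *
            (ENNReal.ofReal (Real.exp (-s * ((y ⬝ᵥ u : ℤ) : ℝ))) * ENNReal.ofReal (r ^ n)) := by
          refine ENNReal.tsum_le_tsum fun y => mul_le_mul_right ((ih y).trans_eq ?_) _
          rw [ENNReal.ofReal_mul (Real.exp_pos _).le]
      _ = (∑' y, ENNReal.ofReal (transProb ω x y) *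
            ENNReal.ofReal (Real.exp (-s * ((y ⬝ᵥ u : ℤ) : ℝ)))) * ENNReal.ofReal (r ^ n) := by
          rw [← ENNReal.tsum_mul_right]; simp_rw [mul_assoc]
      _ ≤ ENNReal.ofReal (Real.exp (-s * ((x ⬝ᵥ u : ℤ) : ℝ)) * r) * ENNReal.ofReal (r ^ n) := by
          gcongr; exact h x
      _ = _ := by
          rw [← ENNReal.ofReal_mul (by positivity)]; congr 1; ring

theorem lintegral_exp_len_le {s M : ℝ} (hs : 0 ≤ s) {ω : Env d}
    (h : ∀ x, ∑' y, ENNReal.ofReal (transProb ω x y) *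
      ENNReal.ofReal (Real.exp (s * len (y - x))) ≤ ENNReal.ofReal (Real.exp (s * M)))
    (x : Site d) (n : ℕ) :
    ∫⁻ X, ENNReal.ofReal (Real.exp (s * len (X n - x))) ∂(quenched ω x) ≤
      ENNReal.ofReal (Real.exp (s * M * n)) := by
  have hdep : ∀ n x, DependsUpTo n fun X : Path d =>
      ENNReal.ofReal (Real.exp (s * len (X n - x))) := fun n x X Y h => by
    simp only [h n le_rfl]
  induction n generalizing x with
  | zero => rw [lintegral_quenched_zero _ _ (hdep 0 x)]; simp [len_zero]
  | succ n ih =>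
    rw [lintegral_quenched _ _ (hdep _ x).measurable]
    calc _ ≤ ∑' y, ENNReal.ofReal (transProb ω x y) *
            (ENNReal.ofReal (Real.exp (s * len (y - x))) *
              ENNReal.ofReal (Real.exp (s * M * n))) := by
          refine ENNReal.tsum_le_tsum fun y => mul_le_mul_right ?_ _
          calc _ ≤ ∫⁻ X, ENNReal.ofReal (Real.exp (s * len (y - x))) *
                ENNReal.ofReal (Real.exp (s * len (X n - y))) ∂(quenched ω y) := by
                refine lintegral_mono fun X => ?_
                rw [ofReal_exp_mul]
                refine ENNReal.ofReal_le_ofReal (Real.exp_le_exp.2 ?_)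
                rw [← mul_add]
                refine mul_le_mul_of_nonneg_left ?_ hs
                have := len_add_le (y - x) (X n - y)
                rwa [show y - x + (X n - y) = X n - x by abel] at this
            _ = ENNReal.ofReal (Real.exp (s * len (y - x))) *
                ∫⁻ X, ENNReal.ofReal (Real.exp (s * len (X n - y))) ∂(quenched ω y) :=
                lintegral_const_mul _ (hdep n y).measurable
            _ ≤ _ := mul_le_mul_right (ih y) _
      _ = (∑' y, ENNReal.ofReal (transProb ω x y) *
            ENNReal.ofReal (Real.exp (s * len (y - x)))) *
              ENNReal.ofReal (Real.exp (s * M * n)) := by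
          rw [← ENNReal.tsum_mul_right]; simp_rw [mul_assoc]
      _ ≤ ENNReal.ofReal (Real.exp (s * M)) * ENNReal.ofReal (Real.exp (s * M * n)) := by
          gcongr; exact h x
      _ = _ := by
          rw [ofReal_exp_mul]; congr 2; push_cast; ring

namespace StepBounds

variable {u : Site d} {s c M κ : ℝ} {ω : Env d}

theorem lintegral_exp_level (H : StepBounds u s c M κ ω) (x : Site d) (n : ℕ) :
    ∫⁻ X, ENNReal.ofReal (Real.exp (-s * ((X n ⬝ᵥ u : ℤ) : ℝ))) ∂(quenched ω x) ≤
      ENNReal.ofReal (Real.exp (-s * ((x ⬝ᵥ u : ℤ) : ℝ) - c * n)) := by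
  refine (lintegral_exp_level_le (r := Real.exp (-c)) (Real.exp_pos _).le (fun x => ?_)
    x n).trans_eq ?_
  · rw [← Real.exp_add]; exact H.exp_level x
  · rw [← Real.exp_nat_mul, ← Real.exp_add]; congr 2; ring

/-- At time `n` the walk is unlikely to be below level `k`. -/
theorem level_le (H : StepBounds u s c M κ ω) (x : Site d) (n : ℕ) (k : ℝ) :
    quenched ω x {X | ((X n ⬝ᵥ u : ℤ) : ℝ) ≤ ((x ⬝ᵥ u : ℤ) : ℝ) + k} ≤
      ENNReal.ofReal (Real.exp (s * k - c * n)) := by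
  have hs := H.s_pos
  have hdep : DependsUpTo n fun X : Path d =>
      X ∈ {X : Path d | ((X n ⬝ᵥ u : ℤ) : ℝ) ≤ ((x ⬝ᵥ u : ℤ) : ℝ) + k} := fun X Y h => by
    simp only [Set.mem_ofPred_eq, h n le_rfl]
  rw [← lintegral_indicator_one hdep.measurableSet]
  calc _ ≤ ∫⁻ X, ENNReal.ofReal (Real.exp (s * (((x ⬝ᵥ u : ℤ) : ℝ) + k))) *
        ENNReal.ofReal (Real.exp (-s * ((X n ⬝ᵥ u : ℤ) : ℝ))) ∂(quenched ω x) := by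
        refine lintegral_mono (Set.indicator_le fun X hX => ?_)
        rw [ofReal_exp_mul, Pi.one_apply, ← ENNReal.ofReal_one]
        refine ENNReal.ofReal_le_ofReal (Real.one_le_exp ?_)
        have : 0 ≤ s * (((x ⬝ᵥ u : ℤ) : ℝ) + k - ((X n ⬝ᵥ u : ℤ) : ℝ)) :=
          mul_nonneg hs.le (sub_nonneg.2 hX)
        linarith
    _ = ENNReal.ofReal (Real.exp (s * (((x ⬝ᵥ u : ℤ) : ℝ) + k))) *
        ∫⁻ X, ENNReal.ofReal (Real.exp (-s * ((X n ⬝ᵥ u : ℤ) : ℝ))) ∂(quenched ω x) := by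
        refine lintegral_const_mul _ (DependsUpTo.measurable (n := n) fun X Y h => ?_)
        simp only [h n le_rfl]
    _ ≤ ENNReal.ofReal (Real.exp (s * (((x ⬝ᵥ u : ℤ) : ℝ) + k))) *
        ENNReal.ofReal (Real.exp (-s * ((x ⬝ᵥ u : ℤ) : ℝ) - c * n)) := by
        gcongr; exact H.lintegral_exp_level x n
    _ = _ := by rw [ofReal_exp_mul]; congr 2; ring

theorem tsum_exp_level_le (H : StepBounds u s c M κ ω) (x : Site d) (b : ℤ) :
    ∑' y, ENNReal.ofReal (transProb ω x y) *
        ENNReal.ofReal (Real.exp (-s * (((y ⬝ᵥ u : ℤ) : ℝ) - b))) ≤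
      ENNReal.ofReal (Real.exp (-s * (((x ⬝ᵥ u : ℤ) : ℝ) - b))) := by
  have hs := H.s_pos
  calc _ = (∑' y, ENNReal.ofReal (transProb ω x y) *
        ENNReal.ofReal (Real.exp (-s * ((y ⬝ᵥ u : ℤ) : ℝ)))) * ENNReal.ofReal (Real.exp (s * b)) := by
        rw [← ENNReal.tsum_mul_right]
        refine tsum_congr fun y => ?_
        rw [mul_assoc, ofReal_exp_mul]; congr 3; ring
    _ ≤ ENNReal.ofReal (Real.exp (-s * ((x ⬝ᵥ u : ℤ) : ℝ) - c)) *
          ENNReal.ofReal (Real.exp (s * b)) := by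
        gcongr; exact H.exp_level x
    _ ≤ _ := by
        rw [ofReal_exp_mul]
        refine ENNReal.ofReal_le_ofReal (Real.exp_le_exp.2 ?_)
        linarith [H.c_pos]

/-- The maximal inequality for the supermartingale `e^{-s X_n·u}`, proved by first-step
analysis. -/
theorem exists_level_le (H : StepBounds u s c M κ ω) (x : Site d) (b : ℤ) :
    quenched ω x {X | ∃ n, X n ⬝ᵥ u ≤ b} ≤
      ENNReal.ofReal (Real.exp (-s * (((x ⬝ᵥ u : ℤ) : ℝ) - b))) := by
  have hs := H.s_pos
  let S : ℕ → Set (Path d) := fun N => {X | ∃ n ≤ N, X n ⬝ᵥ u ≤ b}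
  have hdep : ∀ N, DependsUpTo N fun X => X ∈ S N := fun N X Y h => by
    simp only [S, Set.mem_ofPred_eq, eq_iff_iff]
    exact exists_congr fun n => and_congr_right fun hn => by rw [h n hn]
  have hle : ∀ N x, x ⬝ᵥ u ≤ b → quenched ω x (S N) ≤
      ENNReal.ofReal (Real.exp (-s * (((x ⬝ᵥ u : ℤ) : ℝ) - b))) := fun N x hx => by
    refine prob_le_one.trans ?_
    rw [← ENNReal.ofReal_one]
    refine ENNReal.ofReal_le_ofReal (Real.one_le_exp ?_)
    have : ((x ⬝ᵥ u : ℤ) : ℝ) ≤ b := by exact_mod_cast hx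
    nlinarith
  have key : ∀ N x, quenched ω x (S N) ≤
      ENNReal.ofReal (Real.exp (-s * (((x ⬝ᵥ u : ℤ) : ℝ) - b))) := by
    intro N
    induction N with
    | zero =>
      intro x
      by_cases hx : x ⬝ᵥ u ≤ b
      · exact hle 0 x hx
      · refine le_trans (le_of_eq (measure_eq_zero_iff_ae_notMem.2 ?_)) zero_le
        filter_upwards [quenched_zero ω x] with X hX
        simpa [S, hX] using hx
    | succ N ih =>
      intro x
      by_cases hx : x ⬝ᵥ u ≤ b
      · exact hle _ x hx
      · rw [quenched_apply _ _ (hdep _).measurableSet]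
        refine le_trans (ENNReal.tsum_le_tsum fun y => mul_le_mul_right ?_ _)
          (H.tsum_exp_level_le x b)
        refine (measure_mono ?_).trans (ih y)
        rintro X ⟨n, hn, h⟩
        cases n with
        | zero => exact absurd h hx
        | succ n => exact ⟨n, by omega, h⟩
  have hU : {X : Path d | ∃ n, X n ⬝ᵥ u ≤ b} = ⋃ N, S N := by
    ext X
    simp only [S, Set.mem_ofPred_eq, Set.mem_iUnion]
    exact ⟨fun ⟨n, h⟩ => ⟨n, n, le_rfl, h⟩, fun ⟨_, n, _, h⟩ => ⟨n, h⟩⟩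
  have hmono : Monotone S := fun N N' h X ⟨n, hn, hX⟩ => ⟨n, hn.trans h, hX⟩
  rw [hU, hmono.measure_iUnion]
  exact iSup_le fun N => key N x

/-- Having reached level `a`, the walk is unlikely to return to level `b < a`. -/
theorem exists_fall_le (H : StepBounds u s c M κ ω) (x : Site d) (a b : ℤ) :
    quenched ω x {X | ∃ i j, i ≤ j ∧ a ≤ X i ⬝ᵥ u ∧ X j ⬝ᵥ u ≤ b} ≤
      ENNReal.ofReal (Real.exp (-s * ((a : ℝ) - b))) := by
  have hs := H.s_pos
  let S : ℕ → Set (Path d) := fun N => {X | ∃ i j, i ≤ j ∧ j ≤ N ∧ a ≤ X i ⬝ᵥ u ∧ X j ⬝ᵥ u ≤ b}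
  have hdep : ∀ N, DependsUpTo N fun X => X ∈ S N := fun N X Y h => by
    simp only [S, Set.mem_ofPred_eq, eq_iff_iff]
    exact exists_congr fun i => exists_congr fun j => and_congr_right fun hij =>
      and_congr_right fun hj => by rw [h j hj, h i (hij.trans hj)]
  have hle : ∀ N x, a ≤ x ⬝ᵥ u → quenched ω x (S N) ≤
      ENNReal.ofReal (Real.exp (-s * ((a : ℝ) - b))) := fun N x hx => by
    refine le_trans (measure_mono ?_) ((H.exists_level_le x b).trans
      (ENNReal.ofReal_le_ofReal (Real.exp_le_exp.2 ?_)))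
    · rintro X ⟨i, j, -, -, -, h⟩
      exact ⟨j, h⟩
    · have : (a : ℝ) ≤ ((x ⬝ᵥ u : ℤ) : ℝ) := by exact_mod_cast hx
      nlinarith
  have key : ∀ N x, quenched ω x (S N) ≤ ENNReal.ofReal (Real.exp (-s * ((a : ℝ) - b))) := by
    intro N
    induction N with
    | zero =>
      intro x
      by_cases hx : a ≤ x ⬝ᵥ u
      · exact hle 0 x hx
      · refine le_trans (le_of_eq (measure_eq_zero_iff_ae_notMem.2 ?_)) zero_le
        filter_upwards [quenched_zero ω x] with X hX
        rintro ⟨i, j, hij, hj, h, -⟩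
        obtain rfl : i = 0 := by omega
        exact hx (hX ▸ h)
    | succ N ih =>
      intro x
      by_cases hx : a ≤ x ⬝ᵥ u
      · exact hle _ x hx
      · rw [quenched_apply _ _ (hdep _).measurableSet]
        calc _ ≤ ∑' y, ENNReal.ofReal (transProb ω x y) *
              ENNReal.ofReal (Real.exp (-s * ((a : ℝ) - b))) := by
              refine ENNReal.tsum_le_tsum fun y => mul_le_mul_right ?_ _
              refine (measure_mono ?_).trans (ih y)
              rintro X ⟨i, j, hij, hj, h, h'⟩
              cases i with
              | zero => exact absurd h hx
              | succ i =>
                obtain ⟨j, rfl⟩ : ∃ k, j = k + 1 := ⟨j - 1, by omega⟩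
                exact ⟨i, j, by omega, by omega, h, h'⟩
          _ = _ := by rw [ENNReal.tsum_mul_right, tsum_transProb_eq_one, one_mul]
  have hU : {X : Path d | ∃ i j, i ≤ j ∧ a ≤ X i ⬝ᵥ u ∧ X j ⬝ᵥ u ≤ b} = ⋃ N, S N := by
    ext X
    simp only [S, Set.mem_ofPred_eq, Set.mem_iUnion]
    exact ⟨fun ⟨i, j, h, h'⟩ => ⟨j, i, j, h, le_rfl, h'⟩, fun ⟨_, i, j, h, _, h'⟩ => ⟨i, j, h, h'⟩⟩
  have hmono : Monotone S := fun N N' h X ⟨i, j, hij, hj, hX⟩ => ⟨i, j, hij, hj.trans h, hX⟩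
  rw [hU, hmono.measure_iUnion]
  exact iSup_le fun N => key N x

end StepBounds

/-! ### Random times -/

/-- The first time at which `P` holds. `reachTime`, `backtrackTime`,
`hitTime` and `recoverTime` unfold to it. -/
noncomputable def firstTime (P : ℕ → Prop) : ℕ∞ := ⨅ (n : ℕ) (_ : P n), (n : ℕ∞)

theorem firstTime_le {P : ℕ → Prop} {n : ℕ} (h : P n) : firstTime P ≤ n := iInf₂_le n h

theorem firstTime_eq_top_iff {P : ℕ → Prop} : firstTime P = ⊤ ↔ ∀ n, ¬ P n := by
  unfold firstTime
  rw [iInf₂_eq_top]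
  exact forall_congr' fun n => ⟨fun h hn => ENat.natCast_ne_top n (h hn), fun h hn => absurd hn h⟩

theorem firstTime_eq_coe_iff {P : ℕ → Prop} {m : ℕ} :
    firstTime P = m ↔ P m ∧ ∀ k < m, ¬ P k := by
  constructor
  · intro h
    have hlt : ∀ k < m, ¬ P k := fun k hk hP => by
      have := firstTime_le hP
      rw [h] at this
      exact absurd (by exact_mod_cast this) (not_le.2 hk)
    refine ⟨?_, hlt⟩
    by_contra hm
    have : ((m + 1 : ℕ) : ℕ∞) ≤ firstTime P := le_iInf₂ fun n hn => by
      have h1 : m < n := by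
        by_contra h2
        rcases lt_or_eq_of_le (not_lt.1 h2) with h3 | h3
        · exact hlt n h3 hn
        · exact hm (h3 ▸ hn)
      exact_mod_cast h1
    rw [h] at this
    exact absurd (by exact_mod_cast this) (not_le.2 (Nat.lt_succ_self m))
  · rintro ⟨h1, h2⟩
    refine le_antisymm (firstTime_le h1) (le_iInf₂ fun n hn => ?_)
    have : m ≤ n := not_lt.1 fun h => h2 n h hn
    exact_mod_cast this

theorem not_of_lt_firstTime {P : ℕ → Prop} {n : ℕ} (h : (n : ℕ∞) < firstTime P) : ¬ P n :=
  fun hn => absurd (firstTime_le hn) (not_le.2 h)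

/-- Stopping times of the walk. -/
def IsStop (T : Path d → ℕ∞) : Prop := ∀ m : ℕ, DependsUpTo m fun X => T X = m

theorem isStop_firstTime {P : Path d → ℕ → Prop} (h : ∀ n, DependsUpTo n fun X => P X n) :
    IsStop fun X => firstTime (P X) := by
  intro m X Y hXY
  simp only [firstTime_eq_coe_iff]
  have h1 : ∀ k ≤ m, P X k = P Y k := fun k hk => h k X Y fun i hi => hXY i (hi.trans hk)
  rw [h1 m le_rfl, eq_iff_iff]
  exact and_congr_right fun _ => forall₂_congr fun k hk => by rw [h1 k hk.le]

theorem IsStop.measurableSet {T : Path d → ℕ∞} (h : IsStop T) (m : ℕ) :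
    MeasurableSet {X | T X = m} := (h m).measurableSet

theorem IsStop.measurable {T : Path d → ℕ∞} (h : IsStop T) : Measurable T := by
  refine measurable_to_countable' fun t => ?_
  induction t using ENat.recTopCoe with
  | coe m => exact h.measurableSet m
  | top =>
    have : T ⁻¹' {⊤} = (⋃ m : ℕ, {X | T X = m})ᶜ := by
      ext X
      simp only [Set.mem_preimage, Set.mem_singleton_iff, Set.mem_compl_iff, Set.mem_iUnion,
        Set.mem_ofPred_eq]
      constructor
      · rintro h ⟨m, hm⟩
        rw [h] at hm
        exact ENat.natCast_ne_top m hm.symm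
      · intro h
        by_contra h2
        obtain ⟨m, hm⟩ := ENat.ne_top_iff_exists.1 h2
        exact h ⟨m, hm.symm⟩
    rw [this]
    exact (MeasurableSet.iUnion h.measurableSet).compl

theorem dependsUpTo_level (u : Site d) (n : ℕ) : DependsUpTo n fun X => level u X n :=
  fun X Y h => by simp only [level, h n le_rfl, h 0 (Nat.zero_le n)]

theorem isStop_reachTime (u : Site d) (ℓ : ℝ) : IsStop (reachTime u ℓ) :=
  isStop_firstTime fun n X Y h => by simp only [dependsUpTo_level u n X Y h]

theorem isStop_backtrackTime (u : Site d) : IsStop (backtrackTime u) :=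
  isStop_firstTime fun n X Y h => by simp only [h n le_rfl, h 0 (Nat.zero_le n)]

theorem isStop_hitTime (z : Site d) : IsStop (hitTime z) :=
  isStop_firstTime fun n X Y h => by simp only [h n le_rfl]

theorem dependsUpTo_maxLevel (u : Site d) (n : ℕ) : DependsUpTo n fun X => maxLevel u X n :=
  fun X Y h => Finset.sup'_congr _ rfl fun i hi => by
    have hi : i ≤ n := by simpa [Nat.lt_succ_iff] using hi
    exact dependsUpTo_level u i X Y fun j hj => h j (hj.trans hi)

theorem exists_maxLevel_eq (u : Site d) (X : Path d) (n : ℕ) :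
    ∃ i ≤ n, maxLevel u X n = level u X i := by
  obtain ⟨i, hi, h⟩ := Finset.exists_mem_eq_sup' (Finset.nonempty_range_add_one (n := n))
    (level u X)
  exact ⟨i, by simpa [Nat.lt_succ_iff] using hi, h⟩

theorem level_le_maxLevel (u : Site d) (X : Path d) {i n : ℕ} (h : i ≤ n) :
    level u X i ≤ maxLevel u X n :=
  Finset.le_sup' (level u X) (Finset.mem_range.2 (Nat.lt_succ_of_le h))

theorem isStop_recoverTime (u : Site d) (a : ℝ) : IsStop (recoverTime u a) := by
  refine isStop_firstTime fun n => ?_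
  have key : ∀ X Y : Path d, (∀ i ≤ n, X i = Y i) → backtrackTime u X ≤ n ∧
      (maxLevel u X (backtrackTime u X).toNat : ℝ) + a ≤ (level u X n : ℝ) →
      backtrackTime u Y ≤ n ∧
      (maxLevel u Y (backtrackTime u Y).toNat : ℝ) + a ≤ (level u Y n : ℝ) := by
    rintro X Y h ⟨h1, h2⟩
    obtain ⟨m, hm⟩ := ENat.ne_top_iff_exists.1 (h1.trans_lt (ENat.natCast_lt_top n)).ne
    have hmn : m ≤ n := by rw [← hm] at h1; exact_mod_cast h1
    have hm' : backtrackTime u Y = m :=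
      (isStop_backtrackTime u m X Y fun i hi => h i (hi.trans hmn)).mp hm.symm
    have e1 : maxLevel u X m = maxLevel u Y m :=
      dependsUpTo_maxLevel u m X Y fun i hi => h i (hi.trans hmn)
    have e2 : level u X n = level u Y n := dependsUpTo_level u n X Y h
    rw [← hm, ENat.toNat_natCast, e1, e2] at h2
    rw [hm', ENat.toNat_natCast]
    exact ⟨by exact_mod_cast hmn, h2⟩
  exact fun X Y h => propext ⟨key X Y h, key Y X fun i hi => (h i hi).symm⟩

theorem isStop_stageTime (u : Site d) (a : ℝ) (k : ℕ) : IsStop fun X => stageTime u a X k := by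
  induction k with
  | zero => exact isStop_reachTime u a
  | succ k ih =>
    intro m
    have key : ∀ X Y : Path d, (∀ i ≤ m, X i = Y i) → stageTime u a X (k + 1) = m →
        stageTime u a Y (k + 1) = m := by
      intro X Y h hX
      simp only [stageTime] at hX ⊢
      have h1 : stageTime u a X k ≠ ⊤ := fun h1 => by
        rw [h1, top_add] at hX; exact ENat.natCast_ne_top m hX.symm
      obtain ⟨j, hj⟩ := ENat.ne_top_iff_exists.1 h1
      rw [← hj, ENat.toNat_natCast] at hX
      have h2 : recoverTime u a (shiftPath j X) ≠ ⊤ := fun h1 => by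
        rw [h1, add_top] at hX; exact ENat.natCast_ne_top m hX.symm
      obtain ⟨r, hr⟩ := ENat.ne_top_iff_exists.1 h2
      rw [← hr] at hX
      have hjr : j + r = m := by exact_mod_cast hX
      have hjY : stageTime u a Y k = j :=
        (ih j X Y fun i hi => h i (by omega)).mp hj.symm
      have hrY : recoverTime u a (shiftPath j Y) = r :=
        (isStop_recoverTime u a r (shiftPath j X) (shiftPath j Y)
          fun i hi => h (i + j) (by omega)).mp hr.symm
      rw [hjY, ENat.toNat_natCast, hrY]
      exact hX
    exact fun X Y h => propext ⟨key X Y h, key Y X fun i hi => (h i hi).symm⟩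

/-- The strong Markov property, as an inequality. -/
theorem strong_markov_le (ω : Env d) (x : Site d) {T : Path d → ℕ∞} (hT : IsStop T)
    {G : Path d → ℝ≥0∞} (hG : Measurable G) {g : ℝ≥0∞}
    (hg : ∀ y, ∫⁻ Y, G Y ∂(quenched ω y) ≤ g) (F : ℕ → ℝ≥0∞) :
    ∫⁻ X in {X | T X < ⊤}, F (T X).toNat * G (shiftPath (T X).toNat X) ∂(quenched ω x) ≤
      (∫⁻ X in {X | T X < ⊤}, F (T X).toNat ∂(quenched ω x)) * g := by
  have hU : {X | T X < ⊤} = ⋃ m : ℕ, {X | T X = m} := by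
    ext X
    simp only [Set.mem_ofPred_eq, Set.mem_iUnion]
    constructor
    · intro h
      obtain ⟨m, hm⟩ := ENat.ne_top_iff_exists.1 h.ne
      exact ⟨m, hm.symm⟩
    · rintro ⟨m, hm⟩
      rw [hm]; exact ENat.natCast_lt_top m
  have hd : Pairwise (Function.onFun Disjoint fun m : ℕ => {X | T X = m}) := by
    intro m m' hmm
    refine Set.disjoint_left.2 fun X h h' => hmm ?_
    have : (m : ℕ∞) = m' := by rw [← show T X = m from h, ← show T X = m' from h']
    exact_mod_cast this
  rw [hU, lintegral_iUnion hT.measurableSet hd, lintegral_iUnion hT.measurableSet hd,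
    ← ENNReal.tsum_mul_right]
  refine ENNReal.tsum_le_tsum fun m => ?_
  classical
  have hdep : DependsUpTo m fun X => {X | T X = m}.indicator (fun _ => F m) X := fun X Y h => by
    have := hT m X Y h
    simp only [Set.indicator_apply, Set.mem_ofPred_eq, this]
  calc _ = ∫⁻ X in {X | T X = m}, F m * G (shiftPath m X) ∂(quenched ω x) := by
        refine setLIntegral_congr_fun (hT.measurableSet m) fun X hX => ?_
        have hX : T X = m := hX
        simp only [hX, ENat.toNat_natCast]
    _ = ∫⁻ X, {X | T X = m}.indicator (fun _ => F m) X * G (shiftPath m X) ∂(quenched ω x) := by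
        rw [← lintegral_indicator (hT.measurableSet m)]
        refine lintegral_congr fun X => ?_
        simp only [Set.indicator_apply]
        split_ifs <;> simp
    _ = ∫⁻ X, {X | T X = m}.indicator (fun _ => F m) X * ∫⁻ Y, G Y ∂(quenched ω (X m))
          ∂(quenched ω x) := markov ω x m hdep hG
    _ ≤ ∫⁻ X, {X | T X = m}.indicator (fun _ => F m) X * g ∂(quenched ω x) := by
        gcongr; exact hg _
    _ = (∫⁻ X, {X | T X = m}.indicator (fun _ => F m) X ∂(quenched ω x)) * g :=
        lintegral_mul_const _ hdep.measurable
    _ = _ := by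
        rw [lintegral_indicator (hT.measurableSet m)]
        congr 1
        refine setLIntegral_congr_fun (hT.measurableSet m) fun X hX => ?_
        have hX : T X = m := hX
        simp only [hX, ENat.toNat_natCast]

namespace StepBounds

variable {u : Site d} {s c M κ : ℝ} {ω : Env d}

/-- With probability `κ` the first step goes up by at least one level. To fall below its starting
level afterwards, the walk has to lose more than one level, which has probability at most
`e^{-s}`. -/
theorem no_backtrack (H : StepBounds u s c M κ ω) (hκ : 0 ≤ κ) (x : Site d) :
    ENNReal.ofReal (κ * (1 - Real.exp (-s))) ≤ quenched ω x {X | backtrackTime u X = ⊤} := by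
  have hs := H.s_pos
  have hms : MeasurableSet {X : Path d | backtrackTime u X = ⊤} :=
    (isStop_backtrackTime u).measurable (measurableSet_singleton _)
  rw [quenched_apply _ _ hms, ENNReal.ofReal_mul hκ]
  calc _ ≤ (∑' y, ENNReal.ofReal (transProb ω x y) *
      ENNReal.ofReal (if x ⬝ᵥ u + 1 ≤ y ⬝ᵥ u then 1 else 0)) *
        ENNReal.ofReal (1 - Real.exp (-s)) := by gcongr; exact H.up x
    _ = ∑' y, ENNReal.ofReal (transProb ω x y) *
      (ENNReal.ofReal (if x ⬝ᵥ u + 1 ≤ y ⬝ᵥ u then 1 else 0) *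
        ENNReal.ofReal (1 - Real.exp (-s))) := by
        rw [← ENNReal.tsum_mul_right]; simp_rw [mul_assoc]
    _ ≤ _ := by
        refine ENNReal.tsum_le_tsum fun y => mul_le_mul_right ?_ _
        split_ifs with hy
        · have hS : MeasurableSet {X : Path d | ∃ n, X n ⬝ᵥ u ≤ x ⬝ᵥ u - 1} := by
            rw [Set.ofPred_exists]
            exact MeasurableSet.iUnion fun n => DependsUpTo.measurableSet (n := n) fun X Y h => by
              simp only [Set.mem_ofPred_eq, h n le_rfl]
          have h1 := H.exists_level_le y (x ⬝ᵥ u - 1)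
          have h2 : consPath x ⁻¹' {X | backtrackTime u X = ⊤} =
              {X : Path d | ∃ n, X n ⬝ᵥ u ≤ x ⬝ᵥ u - 1}ᶜ := by
            ext X
            simp only [Set.mem_preimage, Set.mem_ofPred_eq, Set.mem_compl_iff, not_exists]
            refine firstTime_eq_top_iff.trans ⟨fun h n hn => h (n + 1) ?_, fun h n hn => ?_⟩
            · simp only [consPath_succ, consPath_zero]; omega
            · cases n with
              | zero => simp at hn
              | succ n =>
                simp only [consPath_succ, consPath_zero] at hn
                exact h n (by omega)
          rw [h2, prob_compl_eq_one_sub hS, ENNReal.ofReal_one, one_mul,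
            ENNReal.ofReal_sub _ (Real.exp_pos _).le, ENNReal.ofReal_one]
          refine tsub_le_tsub_left (h1.trans (ENNReal.ofReal_le_ofReal (Real.exp_le_exp.2 ?_))) _
          have h3 : ((x ⬝ᵥ u : ℤ) : ℝ) + 1 ≤ ((y ⬝ᵥ u : ℤ) : ℝ) := by exact_mod_cast hy
          push_cast
          nlinarith
        · simp

theorem lintegral_reachTime_le (H : StepBounds u s c M κ ω) (x : Site d) {p ℓ : ℝ} (hp : 1 ≤ p)
    (hℓ : 1 ≤ ℓ) :
    ∫⁻ X, (reachTime u ℓ X : ℝ≥0∞) ^ p ∂(quenched ω x) ≤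
      ENNReal.ofReal (((2 * s / c) ^ p + tailConst p c) * ℓ ^ p) := by
  have hs := H.s_pos
  have hc := H.c_pos
  refine (lintegral_rpow_le_of_tail (by simp) (isStop_reachTime u ℓ).measurable
    (p := p) (c := c) (K := s * ℓ / c) (D := 1) (by linarith) hc (by positivity) zero_le_one
    fun n => ?_).trans (ENNReal.ofReal_le_ofReal ?_)
  · rw [one_mul, show c * (s * ℓ / c - n) = s * ℓ - c * n by field_simp]
    refine le_trans (measure_mono_ae ?_) (H.level_le x n ℓ)
    filter_upwards [quenched_zero ω x] with X hX h
    have h := not_of_lt_firstTime h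
    simp only [level, hX] at h
    push_cast at h
    change ((X n ⬝ᵥ u : ℤ) : ℝ) ≤ ((x ⬝ᵥ u : ℤ) : ℝ) + ℓ
    linarith
  · have h1 : 1 ≤ ℓ ^ p := Real.one_le_rpow hℓ (by linarith)
    have h2 := tailConst_nonneg (p := p) (by linarith) hc
    rw [show 2 * (s * ℓ / c) = 2 * s / c * ℓ by ring, Real.mul_rpow (by positivity) (by linarith)]
    nlinarith

/-- The constant in `lintegral_len_le`. -/
noncomputable def posConst (s M q : ℝ) : ℝ :=
  (q / (s / 2)) ^ q / (1 - Real.exp (-(s * M)))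

/-- The displacement during a random time `T` is of the order of `T`, whatever the dependence
between the two: displacements that exceed `4M` times their duration are summable. -/
theorem lintegral_len_le (H : StepBounds u s c M κ ω) (x : Site d) (n : ℕ) (T : Path d → ℕ∞)
    {p q : ℝ} (hp : 1 ≤ p) (hpq : p ≤ q) :
    ∫⁻ X, atTime (T X) (fun m => ENNReal.ofReal (len (X (m + n) - X n) ^ p)) ∂(quenched ω x) ≤
      ENNReal.ofReal (1 + posConst s M q) +
        ENNReal.ofReal ((4 * M) ^ q) * ∫⁻ X, (T X : ℝ≥0∞) ^ q ∂(quenched ω x) := by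
  have hs := H.s_pos
  have hM := H.M_pos
  have hq : 0 < q := by linarith
  let f : ℕ → Path d → ℝ≥0∞ := fun j X => ENNReal.ofReal
    ((q / (s / 2)) ^ q * Real.exp (-(2 * s * M * j)) * Real.exp (s * len (X (j + n) - X n)))
  have hf : ∀ j, Measurable (f j) := fun j => DependsUpTo.measurable (n := j + n) fun X Y h => by
    simp only [f, h (j + n) le_rfl, h n (by omega)]
  have hlenp : ∀ t : ℝ, 0 ≤ t → t ^ p ≤ 1 + t ^ q := by
    intro t ht
    rcases le_total t 1 with h | h
    · have := Real.rpow_le_one ht h (by linarith : 0 ≤ p)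
      have := Real.rpow_nonneg ht q
      linarith
    · have := Real.rpow_le_rpow_of_exponent_le h hpq
      linarith
  have hpt : ∀ X, atTime (T X) (fun m => ENNReal.ofReal (len (X (m + n) - X n) ^ p)) ≤
      ENNReal.ofReal ((4 * M) ^ q) * (T X : ℝ≥0∞) ^ q + (1 + ∑' j, f j X) := by
    intro X
    unfold atTime
    split_ifs with h
    · rw [h, ENat.toENNReal_top, ENNReal.top_rpow_of_pos hq, ENNReal.mul_top, top_add]
      exact (ENNReal.ofReal_pos.2 (by positivity)).ne'
    · obtain ⟨m, hm⟩ := ENat.ne_top_iff_exists.1 h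
      rw [← hm, ENat.toNat_natCast, ENat.toENNReal_coe]
      set t := len (X (m + n) - X n) with ht
      have ht0 : 0 ≤ t := len_nonneg _
      rw [add_left_comm]
      refine (ENNReal.ofReal_le_ofReal (hlenp t ht0)).trans ?_
      rw [ENNReal.ofReal_add zero_le_one (by positivity), ENNReal.ofReal_one]
      gcongr
      by_cases htm : t ≤ 4 * M * m
      · refine le_trans ?_ le_self_add
        rw [← ENNReal.ofReal_natCast, ENNReal.ofReal_rpow_of_nonneg m.cast_nonneg hq.le,
          ← ENNReal.ofReal_mul (by positivity), ← Real.mul_rpow (by positivity) m.cast_nonneg]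
        gcongr
      · refine le_trans ?_ (le_add_left (ENNReal.le_tsum m))
        refine ENNReal.ofReal_le_ofReal ((rpow_le_exp ht0 hq (half_pos hs)).trans ?_)
        rw [mul_assoc, ← Real.exp_add]
        gcongr
        nlinarith
  have hint : ∀ j, ∫⁻ X, f j X ∂(quenched ω x) ≤
      ENNReal.ofReal ((q / (s / 2)) ^ q * Real.exp (-(s * M) * j)) := by
    intro j
    have hdep : Measurable fun Y : Path d => ENNReal.ofReal (Real.exp (s * len (Y j - Y 0))) :=
      DependsUpTo.measurable (n := j) fun X Y h => by simp only [h j le_rfl, h 0 (Nat.zero_le _)]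
    have h1 : ∀ y, ∫⁻ Y, ENNReal.ofReal (Real.exp (s * len (Y j - Y 0))) ∂(quenched ω y) ≤
        ENNReal.ofReal (Real.exp (s * M * j)) := by
      intro y
      refine le_trans (le_of_eq (lintegral_congr_ae ?_))
        (lintegral_exp_len_le hs.le H.exp_len y j)
      filter_upwards [quenched_zero ω y] with Y hY
      rw [hY]
    have h2 := markov ω x n (F := fun _ => 1) (fun _ _ _ => rfl) hdep
    simp only [one_mul] at h2
    calc _ = ENNReal.ofReal ((q / (s / 2)) ^ q * Real.exp (-(2 * s * M * j))) *
          ∫⁻ X, ENNReal.ofReal (Real.exp (s * len (shiftPath n X j - shiftPath n X 0)))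
            ∂(quenched ω x) := by
          rw [← lintegral_const_mul _ (by
            exact hdep.comp (measurable_shiftPath n))]
          refine lintegral_congr fun X => ?_
          simp only [f, shiftPath, zero_add]
          rw [ENNReal.ofReal_mul (by positivity)]
      _ ≤ ENNReal.ofReal ((q / (s / 2)) ^ q * Real.exp (-(2 * s * M * j))) *
          ENNReal.ofReal (Real.exp (s * M * j)) := by
          rw [h2]
          gcongr
          refine (lintegral_mono fun X => h1 _).trans ?_
          simp
      _ = _ := by
          rw [← ENNReal.ofReal_mul (by positivity), mul_assoc, ← Real.exp_add]
          congr 3; ring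
  have hE := one_sub_exp_pos (b := s * M) (by positivity)
  calc _ ≤ ∫⁻ X, ENNReal.ofReal ((4 * M) ^ q) * (T X : ℝ≥0∞) ^ q + (1 + ∑' j, f j X)
          ∂(quenched ω x) := lintegral_mono hpt
    _ = ENNReal.ofReal ((4 * M) ^ q) * ∫⁻ X, (T X : ℝ≥0∞) ^ q ∂(quenched ω x) +
        (1 + ∑' j, ∫⁻ X, f j X ∂(quenched ω x)) := by
        have hm : Measurable fun X => 1 + ∑' j, f j X :=
          measurable_const.add (Measurable.tsum fun j => hf j)
        rw [lintegral_add_right _ hm,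
          lintegral_const_mul' _ _ ENNReal.ofReal_ne_top, lintegral_add_left measurable_const,
          lintegral_tsum fun j => (hf j).aemeasurable]
        simp
    _ ≤ ENNReal.ofReal ((4 * M) ^ q) * ∫⁻ X, (T X : ℝ≥0∞) ^ q ∂(quenched ω x) +
        (1 + ∑' j : ℕ, ENNReal.ofReal ((q / (s / 2)) ^ q * Real.exp (-(s * M) * j))) := by
        gcongr with j; exact hint j
    _ = _ := by
        rw [tsum_ofReal_exp (by positivity) (by positivity), add_comm,
          ENNReal.ofReal_add zero_le_one (by unfold posConst; positivity), ENNReal.ofReal_one]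
        rfl

/-- If `M_{H_z}` exceeds `z·u` by more than `k`, then the walk has been at level `z·u + k + 1` and
lost `k + 1` levels afterwards, which is unlikely. The values up to `ℓ` give the first term of the
bound, the larger ones the second. -/
theorem lintegral_hitting_le (H : StepBounds u s c M κ ω) (z : Site d) (n : ℕ) {p ℓ : ℝ}
    (hp : 1 ≤ p) (hℓ : 1 ≤ ℓ) :
    ∫⁻ X in {X | hitTime z X < n},
        ENNReal.ofReal (((maxLevel u X (hitTime z X).toNat - z ⬝ᵥ u : ℤ) : ℝ) ^ p)
        ∂(quenched ω 0) ≤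
      ENNReal.ofReal (ℓ ^ p) * quenched ω 0 {X | hitTime z X < n} +
        ENNReal.ofReal ((p / (s / 4)) ^ p / (1 - Real.exp (-(s / 4))) *
          Real.exp (-(s * ℓ / 2))) := by
  have hs := H.s_pos
  have hp0 : 0 < p := by linarith
  let E : ℕ → Set (Path d) := fun k =>
    {X | ∃ i j, i ≤ j ∧ z ⬝ᵥ u + (k + 1) ≤ X i ⬝ᵥ u ∧ X j ⬝ᵥ u ≤ z ⬝ᵥ u}
  have hE : ∀ k, MeasurableSet (E k) := fun k => by
    simp only [E, Set.ofPred_exists]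
    refine MeasurableSet.iUnion fun i => MeasurableSet.iUnion fun j => ?_
    refine DependsUpTo.measurableSet (n := max i j) fun X Y h => ?_
    simp only [Set.mem_ofPred_eq, h i (le_max_left _ _), h j (le_max_right _ _)]
  let f : ℕ → Path d → ℝ≥0∞ := fun k => (E k).indicator fun _ =>
    if ℓ < k + 1 then ENNReal.ofReal (((k : ℝ) + 1) ^ p) else 0
  have hf : ∀ k, Measurable (f k) := fun k => measurable_const.indicator (hE k)
  have hpt : ∀ᵐ X ∂(quenched ω 0), X ∈ {X | hitTime z X < n} →
      ENNReal.ofReal (((maxLevel u X (hitTime z X).toNat - z ⬝ᵥ u : ℤ) : ℝ) ^ p) ≤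
        ENNReal.ofReal (ℓ ^ p) + ∑' k, f k X := by
    filter_upwards [quenched_zero ω 0] with X hX hH
    obtain ⟨m, hm⟩ := ENat.ne_top_iff_exists.1 (lt_trans hH (ENat.natCast_lt_top n)).ne
    have hXm : X m = z := (firstTime_eq_coe_iff.1 hm.symm).1.2
    rw [← hm, ENat.toNat_natCast]
    obtain ⟨i, hi, hmax⟩ := exists_maxLevel_eq u X m
    have hlev : ∀ i, level u X i = X i ⬝ᵥ u := fun i => by simp [level, hX]
    have hW : 0 ≤ maxLevel u X m - z ⬝ᵥ u := by
      have := level_le_maxLevel u X (le_refl m)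
      rw [hlev, hXm] at this
      omega
    obtain ⟨w, hw⟩ := Int.eq_ofNat_of_zero_le hW
    rw [hw]
    by_cases hwl : (w : ℝ) ≤ ℓ
    · refine le_trans (ENNReal.ofReal_le_ofReal ?_) le_self_add
      push_cast
      gcongr
    · obtain ⟨k, rfl⟩ : ∃ k, w = k + 1 := Nat.exists_eq_succ_of_ne_zero (by
        rintro rfl; simp at hwl; linarith)
      refine le_trans ?_ (le_add_left (ENNReal.le_tsum k))
      have hXE : X ∈ E k := by
        refine ⟨i, m, hi, ?_, by rw [hXm]⟩
        rw [← hlev i, ← hmax]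
        push_cast at hw
        omega
      simp only [f]
      rw [Set.indicator_of_mem hXE, if_pos (by push_cast at hwl; linarith)]
      push_cast
      rfl
  have hint : ∀ k, ∫⁻ X, f k X ∂(quenched ω 0) ≤ ENNReal.ofReal
      (((p / (s / 4)) ^ p * Real.exp (-(s * ℓ / 2))) * Real.exp (-(s / 4) * k)) := by
    intro k
    simp only [f]
    rw [lintegral_indicator_const (hE k)]
    split_ifs with h
    · have h1 := H.exists_fall_le 0 (z ⬝ᵥ u + (k + 1)) (z ⬝ᵥ u)
      refine (mul_le_mul_right h1 _).trans ?_
      rw [← ENNReal.ofReal_mul (by positivity)]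
      refine ENNReal.ofReal_le_ofReal ?_
      have h2 := rpow_le_exp (t := (k : ℝ) + 1) (by positivity) hp0 (a := s / 4) (by positivity)
      calc _ ≤ ((p / (s / 4)) ^ p * Real.exp (s / 4 * (k + 1))) *
            Real.exp (-s * (((z ⬝ᵥ u + (k + 1) : ℤ) : ℝ) - ((z ⬝ᵥ u : ℤ) : ℝ))) := by gcongr
        _ = (p / (s / 4)) ^ p * Real.exp (s / 4 * (k + 1) - s * (k + 1)) := by
          rw [mul_assoc, ← Real.exp_add]
          congr 2
          push_cast
          ring
        _ ≤ (p / (s / 4)) ^ p * Real.exp (-(s * ℓ / 2) + -(s / 4) * k) := by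
          gcongr
          nlinarith
        _ = _ := by rw [Real.exp_add]; ring
    · simp
  have hSm : MeasurableSet {X : Path d | hitTime z X < n} :=
    (isStop_hitTime z).measurable (MeasurableSet.of_discrete (s := Set.Iio (n : ℕ∞)))
  have hE4 := one_sub_exp_pos (b := s / 4) (by positivity)
  calc _ ≤ ∫⁻ X in {X | hitTime z X < n}, ENNReal.ofReal (ℓ ^ p) + ∑' k, f k X
          ∂(quenched ω 0) := lintegral_mono_ae ((ae_restrict_iff' hSm).2 hpt)
    _ = ENNReal.ofReal (ℓ ^ p) * quenched ω 0 {X | hitTime z X < n} +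
        ∫⁻ X in {X | hitTime z X < n}, ∑' k, f k X ∂(quenched ω 0) := by
        rw [lintegral_add_left measurable_const, setLIntegral_const]
    _ ≤ ENNReal.ofReal (ℓ ^ p) * quenched ω 0 {X | hitTime z X < n} +
        ∑' k, ∫⁻ X, f k X ∂(quenched ω 0) := by
        rw [← lintegral_tsum fun k => (hf k).aemeasurable]
        gcongr
        exact Measure.restrict_le_self
    _ ≤ ENNReal.ofReal (ℓ ^ p) * quenched ω 0 {X | hitTime z X < n} +
        ∑' k : ℕ, ENNReal.ofReal
          (((p / (s / 4)) ^ p * Real.exp (-(s * ℓ / 2))) * Real.exp (-(s / 4) * k)) := by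
        gcongr with k; exact hint k
    _ = _ := by
        rw [tsum_ofReal_exp (by positivity) (by positivity)]
        congr 2; ring

end StepBounds

/-! ### Regeneration times -/

theorem backtrackTime_lt_top_of_recoverTime {u : Site d} {a : ℝ} {X : Path d}
    (h : recoverTime u a X < ⊤) : backtrackTime u X < ⊤ := by
  obtain ⟨m, hm⟩ := ENat.ne_top_iff_exists.1 h.ne
  exact (firstTime_eq_coe_iff.1 hm.symm).1.1.trans_lt (ENat.natCast_lt_top m)

theorem stageTime_lt_top_of_succ {u : Site d} {a : ℝ} {X : Path d} {k : ℕ}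
    (h : stageTime u a X (k + 1) < ⊤) : stageTime u a X k < ⊤ :=
  lt_of_le_of_lt le_self_add h

theorem recoverTime_lt_top_of_stageTime {u : Site d} {a : ℝ} {X : Path d} {k : ℕ}
    (h : stageTime u a X (k + 1) < ⊤) :
    recoverTime u a (shiftPath (stageTime u a X k).toNat X) < ⊤ :=
  lt_of_le_of_lt le_add_self h

/-- Splitting a `p`-th power of a sum: the first summand keeps a factor close to one. -/
theorem add_rpow_le {p θ : ℝ} (hp : 0 ≤ p) (hθ : 0 < θ) (x y : ℝ≥0∞) :
    (x + y) ^ p ≤ ENNReal.ofReal ((1 + θ) ^ p) * x ^ p + ENNReal.ofReal ((1 + 1 / θ) ^ p) * y ^ p := by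
  have h1 : ∀ t : ℝ, 0 < t → ∀ z : ℝ≥0∞,
      ENNReal.ofReal ((1 + t) ^ p) * z ^ p = ((1 + ENNReal.ofReal t) * z) ^ p := by
    intro t ht z
    rw [ENNReal.mul_rpow_of_nonneg _ _ hp, ← ENNReal.ofReal_one, ← ENNReal.ofReal_add zero_le_one ht.le,
      ENNReal.ofReal_rpow_of_nonneg (by positivity) hp]
  rw [h1 θ hθ, h1 (1 / θ) (by positivity)]
  rcases le_total y (ENNReal.ofReal θ * x) with h | h
  · refine le_trans (ENNReal.rpow_le_rpow ?_ hp) le_self_add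
    rw [add_mul, one_mul]; gcongr
  · refine le_trans (ENNReal.rpow_le_rpow ?_ hp) le_add_self
    rw [add_mul, one_mul, add_comm]
    gcongr
    calc x = ENNReal.ofReal (1 / θ) * (ENNReal.ofReal θ * x) := by
          rw [← mul_assoc, ← ENNReal.ofReal_mul (by positivity), one_div_mul_cancel hθ.ne',
            ENNReal.ofReal_one, one_mul]
      _ ≤ _ := by gcongr

theorem tsum_le_of_recursion {v : ℕ → ℝ≥0∞} {A B q b : ℝ} (hA : 0 ≤ A) (hB : 0 ≤ B) (hq : 0 ≤ q)
    (hq1 : q < 1) (hb : 0 ≤ b) (hb1 : b < 1) (h0 : v 0 ≤ ENNReal.ofReal A)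
    (hv : ∀ k, v (k + 1) ≤ ENNReal.ofReal q * v k + ENNReal.ofReal (B * b ^ k)) :
    ∑' k, v k ≤ ENNReal.ofReal ((A + B / (1 - b)) / (1 - q)) := by
  have hb' : 0 < 1 - b := by linarith
  have hq' : 0 < 1 - q := by linarith
  rw [ENNReal.tsum_eq_iSup_nat]
  refine iSup_le fun K => ?_
  have hgeo : ∀ K, ∑ k ∈ Finset.range K, ENNReal.ofReal (B * b ^ k) ≤
      ENNReal.ofReal (B / (1 - b)) := by
    intro K
    refine (ENNReal.sum_le_tsum _).trans (le_of_eq ?_)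
    rw [← ENNReal.ofReal_tsum_of_nonneg (fun n => by positivity)
      ((summable_geometric_of_lt_one hb hb1).mul_left B), tsum_mul_left,
      tsum_geometric_of_lt_one hb hb1, div_eq_mul_inv]
  induction K with
  | zero => simp
  | succ K ih =>
    rw [Finset.sum_range_succ']
    calc _ ≤ ∑ k ∈ Finset.range K, (ENNReal.ofReal q * v k + ENNReal.ofReal (B * b ^ k)) +
          ENNReal.ofReal A := by gcongr; exact hv _
      _ = ENNReal.ofReal q * ∑ k ∈ Finset.range K, v k +
          ∑ k ∈ Finset.range K, ENNReal.ofReal (B * b ^ k) + ENNReal.ofReal A := by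
          rw [Finset.sum_add_distrib, ← Finset.mul_sum]
      _ ≤ ENNReal.ofReal q * ENNReal.ofReal ((A + B / (1 - b)) / (1 - q)) +
          ENNReal.ofReal (B / (1 - b)) + ENNReal.ofReal A := by
          gcongr; exact hgeo K
      _ = _ := by
          rw [← ENNReal.ofReal_mul hq, ← ENNReal.ofReal_add (by positivity) (by positivity),
            ← ENNReal.ofReal_add (by positivity) hA]
          congr 1
          field_simp
          ring

namespace StepBounds

variable {u : Site d} {s c M κ : ℝ} {ω : Env d}

/-- The constant in the moment bound for `λ_ℓ`. -/
noncomputable def reachConst (s c p : ℝ) : ℝ := (2 * s / c) ^ p + tailConst p c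

/-- The constant in the moment bound for `λ_{M_β+a}`. -/
noncomputable def recoverConst (s c p : ℝ) : ℝ :=
  (4 * s / c) ^ p + (1 / (1 - Real.exp (-c)) + 2) * tailConst p (c / 2)

/-- If the recovery takes longer than `n`, then the walk backtracks after time `n`, or it has
climbed to a level of order `n` and fallen back, or its level at time `n` is too small. -/
theorem recoverTime_tail (H : StepBounds u s c M κ ω) (x : Site d) {a : ℝ} (ha : 0 ≤ a) (n : ℕ) :
    quenched ω x ({X | (n : ℕ∞) < recoverTime u a X} ∩ {X | backtrackTime u X < ⊤}) ≤
      ENNReal.ofReal ((1 / (1 - Real.exp (-c)) + 2) *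
        Real.exp (c / 2 * (2 * s * a / c - n))) := by
  have hs := H.s_pos
  have hc := H.c_pos
  have hcE := one_sub_exp_pos hc
  let A₁ : Set (Path d) := ⋃ j : ℕ, {X | ((X (j + n) ⬝ᵥ u : ℤ) : ℝ) ≤ ((x ⬝ᵥ u : ℤ) : ℝ) + 0}
  let A₂ : Set (Path d) := {X | ∃ i j, i ≤ j ∧ x ⬝ᵥ u + ⌈c / (2 * s) * n⌉ ≤ X i ⬝ᵥ u ∧
    X j ⬝ᵥ u ≤ x ⬝ᵥ u}
  let A₃ : Set (Path d) := {X | ((X n ⬝ᵥ u : ℤ) : ℝ) ≤ ((x ⬝ᵥ u : ℤ) : ℝ) + (a + c / (2 * s) * n)}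
  have hsub : ({X | (n : ℕ∞) < recoverTime u a X} ∩ {X | backtrackTime u X < ⊤} : Set (Path d))
      ≤ᵐ[quenched ω x] (A₁ ∪ A₂ ∪ A₃ : Set (Path d)) := by
    filter_upwards [quenched_zero ω x] with X hX
    rintro ⟨hR, hβ⟩
    obtain ⟨m, hm⟩ := ENat.ne_top_iff_exists.1 (ne_of_lt hβ)
    have hβm : X m ⬝ᵥ u < X 0 ⬝ᵥ u := (firstTime_eq_coe_iff.1 hm.symm).1
    rw [hX] at hβm
    rcases le_total n m with hnm | hmn
    · refine Or.inl (Or.inl (Set.mem_iUnion.2 ⟨m - n, ?_⟩))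
      have : ((X m ⬝ᵥ u : ℤ) : ℝ) ≤ ((x ⬝ᵥ u : ℤ) : ℝ) := by exact_mod_cast hβm.le
      rw [Set.mem_ofPred_eq, Nat.sub_add_cancel hnm, add_zero]
      exact this
    · have hR := not_of_lt_firstTime hR
      rw [not_and] at hR
      have hR := hR (by rw [← hm]; exact_mod_cast hmn)
      rw [← hm, ENat.toNat_natCast, not_le] at hR
      obtain ⟨i, hi, hmax⟩ := exists_maxLevel_eq u X m
      by_cases hε : c / (2 * s) * n < (maxLevel u X m : ℝ)
      · refine Or.inl (Or.inr ⟨i, m, hi, ?_, hβm.le⟩)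
        have h1 : ⌈c / (2 * s) * n⌉ ≤ maxLevel u X m := Int.ceil_le.2 hε.le
        rw [hmax, level, hX] at h1
        omega
      · refine Or.inr ?_
        have h2 : (level u X n : ℝ) = ((X n ⬝ᵥ u : ℤ) : ℝ) - ((x ⬝ᵥ u : ℤ) : ℝ) := by
          simp [level, hX]
        change ((X n ⬝ᵥ u : ℤ) : ℝ) ≤ ((x ⬝ᵥ u : ℤ) : ℝ) + (a + c / (2 * s) * n)
        linarith
  have hK : c / 2 * (2 * s * a / c - n) = s * a - c / 2 * n := by field_simp
  have hsa : 0 ≤ s * a := by positivity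
  have hE : Real.exp (-(c / 2 * n)) ≤ Real.exp (s * a - c / 2 * n) :=
    Real.exp_le_exp.2 (by linarith)
  have h₁ : quenched ω x A₁ ≤
      ENNReal.ofReal (1 / (1 - Real.exp (-c)) * Real.exp (s * a - c / 2 * n)) := by
    calc _ ≤ ∑' j : ℕ, ENNReal.ofReal (Real.exp (-(c * n)) * Real.exp (-c * j)) := by
          refine (measure_iUnion_le _).trans (ENNReal.tsum_le_tsum fun j => ?_)
          refine (H.level_le x (j + n) 0).trans_eq ?_
          rw [← Real.exp_add]; congr 2; push_cast; ring
      _ = ENNReal.ofReal (Real.exp (-(c * n)) / (1 - Real.exp (-c))) :=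
          tsum_ofReal_exp (Real.exp_pos _).le hc
      _ ≤ _ := by
          refine ENNReal.ofReal_le_ofReal ?_
          rw [div_eq_mul_one_div, mul_comm]
          gcongr
          nlinarith [(n.cast_nonneg : (0 : ℝ) ≤ n)]
  have h₂ : quenched ω x A₂ ≤ ENNReal.ofReal (Real.exp (s * a - c / 2 * n)) := by
    refine (H.exists_fall_le x _ _).trans (ENNReal.ofReal_le_ofReal ((Real.exp_le_exp.2 ?_).trans hE))
    have := Int.le_ceil (c / (2 * s) * (n : ℝ))
    push_cast
    have h3 : s * (c / (2 * s) * n) = c / 2 * n := by field_simp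
    nlinarith
  have h₃ : quenched ω x A₃ ≤ ENNReal.ofReal (Real.exp (s * a - c / 2 * n)) := by
    refine (H.level_le x n _).trans (ENNReal.ofReal_le_ofReal (Real.exp_le_exp.2 (le_of_eq ?_)))
    field_simp; ring
  calc _ ≤ quenched ω x (A₁ ∪ A₂ ∪ A₃) := measure_mono_ae hsub
    _ ≤ quenched ω x A₁ + quenched ω x A₂ + quenched ω x A₃ :=
        (measure_union_le _ _).trans (by gcongr; exact measure_union_le _ _)
    _ ≤ _ := add_le_add (add_le_add h₁ h₂) h₃
    _ = _ := by
        rw [← ENNReal.ofReal_add (by positivity) (by positivity),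
          ← ENNReal.ofReal_add (by positivity) (by positivity), hK]
        congr 1; ring

theorem lintegral_recoverTime_le (H : StepBounds u s c M κ ω) (x : Site d) {p a : ℝ} (hp : 1 ≤ p)
    (ha : 1 ≤ a) :
    ∫⁻ X in {X | backtrackTime u X < ⊤}, (recoverTime u a X : ℝ≥0∞) ^ p ∂(quenched ω x) ≤
      ENNReal.ofReal (recoverConst s c p * a ^ p) := by
  have hs := H.s_pos
  have hc := H.c_pos
  have hcE := one_sub_exp_pos hc
  have hRm := (isStop_recoverTime u a).measurable
  refine (lintegral_rpow_le_of_tail (by simpa using prob_le_one) hRm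
    (p := p) (c := c / 2) (K := 2 * s * a / c) (D := 1 / (1 - Real.exp (-c)) + 2) (by linarith)
    (by positivity) (by positivity) (by positivity) fun n => ?_).trans
    (ENNReal.ofReal_le_ofReal ?_)
  · have hS : MeasurableSet {X : Path d | (n : ℕ∞) < recoverTime u a X} :=
      hRm (MeasurableSet.of_discrete (s := Set.Ioi (n : ℕ∞)))
    rw [Measure.restrict_apply hS]
    exact H.recoverTime_tail x (by linarith) n
  · have h1 : 1 ≤ a ^ p := Real.one_le_rpow ha (by linarith)
    have h2 := tailConst_nonneg (p := p) (c := c / 2) (by linarith) (by positivity)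
    have h3 : 0 ≤ (1 / (1 - Real.exp (-c)) + 2) * tailConst p (c / 2) := by positivity
    rw [show 2 * (2 * s * a / c) = 4 * s / c * a by ring, Real.mul_rpow (by positivity) (by linarith),
      recoverConst]
    nlinarith

theorem measurableSet_backtrackTime_lt : MeasurableSet {X : Path d | backtrackTime u X < ⊤} :=
  (isStop_backtrackTime u).measurable (MeasurableSet.of_discrete (s := Set.Iio (⊤ : ℕ∞)))

theorem measurableSet_stageTime_lt (a : ℝ) (k : ℕ) :
    MeasurableSet {X : Path d | stageTime u a X k < ⊤} :=
  (isStop_stageTime u a k).measurable (MeasurableSet.of_discrete (s := Set.Iio (⊤ : ℕ∞)))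

theorem stageTime_lt_subset (a : ℝ) (k : ℕ) :
    {X : Path d | stageTime u a X (k + 1) < ⊤} ⊆ {X : Path d | stageTime u a X k < ⊤} :=
  fun _ h => stageTime_lt_top_of_succ h

theorem backtrack_prob_le (H : StepBounds u s c M κ ω) (hκ : 0 ≤ κ) (x : Site d) :
    quenched ω x {X | backtrackTime u X < ⊤} ≤
      ENNReal.ofReal (1 - κ * (1 - Real.exp (-s))) := by
  have hs := H.s_pos
  have h1 := H.no_backtrack hκ x
  have h2 : {X : Path d | backtrackTime u X < ⊤} = {X | backtrackTime u X = ⊤}ᶜ := by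
    ext X
    simp only [Set.mem_ofPred_eq, Set.mem_compl_iff]
    exact lt_top_iff_ne_top
  have hms : MeasurableSet {X : Path d | backtrackTime u X = ⊤} :=
    (isStop_backtrackTime u).measurable (measurableSet_singleton _)
  rw [h2, prob_compl_eq_one_sub hms,
    ENNReal.ofReal_sub _ (mul_nonneg hκ (one_sub_exp_pos hs).le), ENNReal.ofReal_one]
  exact tsub_le_tsub_left h1 _

/-- Each stage after the first is reached only after a backtracking of the previous one. -/
theorem stageTime_prob_le (H : StepBounds u s c M κ ω) (hκ : 0 ≤ κ) (x : Site d) (a : ℝ) (k : ℕ) :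
    quenched ω x {X | stageTime u a X k < ⊤} ≤
      ENNReal.ofReal (1 - κ * (1 - Real.exp (-s))) ^ k := by
  induction k with
  | zero => simpa using prob_le_one
  | succ k ih =>
    have hsm := strong_markov_le ω x (isStop_stageTime u a k)
      (G := {X : Path d | backtrackTime u X < ⊤}.indicator 1)
      (measurable_one.indicator measurableSet_backtrackTime_lt)
      (g := ENNReal.ofReal (1 - κ * (1 - Real.exp (-s))))
      (fun y => by
        rw [lintegral_indicator_one measurableSet_backtrackTime_lt]
        exact H.backtrack_prob_le hκ y) (fun _ => 1)
    rw [setLIntegral_one] at hsm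
    calc _ = ∫⁻ X in {X | stageTime u a X k < ⊤},
          {X | stageTime u a X (k + 1) < ⊤}.indicator 1 X ∂(quenched ω x) := by
          rw [lintegral_indicator_one (measurableSet_stageTime_lt a (k + 1)),
            Measure.restrict_apply (measurableSet_stageTime_lt a (k + 1)),
            Set.inter_eq_left.2 (stageTime_lt_subset a k)]
      _ ≤ _ := by
          refine le_trans (lintegral_mono fun X => ?_) (hsm.trans (by gcongr))
          by_cases hX : stageTime u a X (k + 1) < ⊤
          · have h1 : shiftPath (stageTime u a X k).toNat X ∈ {X : Path d | backtrackTime u X < ⊤} :=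
              backtrackTime_lt_top_of_recoverTime (recoverTime_lt_top_of_stageTime hX)
            rw [Set.indicator_of_mem h1]
            simp [hX]
          · rw [Set.indicator_of_notMem (show X ∉ {X | stageTime u a X (k + 1) < ⊤} from hX)]
            exact zero_le
      _ = _ := (pow_succ _ _).symm

/-- `S_{k+1}` is `S_k` plus a recovery time, and `S_k` is followed by a backtracking with a
probability below one. For small `θ` the factor of the moment of `S_k` is still below one. -/
theorem lintegral_stageTime_succ_le (H : StepBounds u s c M κ ω) (hκ : 0 ≤ κ) (x : Site d)
    {p a θ : ℝ} (hp : 1 ≤ p) (ha : 1 ≤ a) (hθ : 0 < θ) (k : ℕ) :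
    ∫⁻ X in {X | stageTime u a X (k + 1) < ⊤}, ((stageTime u a X (k + 1)).toNat : ℝ≥0∞) ^ p
        ∂(quenched ω x) ≤
      ENNReal.ofReal ((1 + θ) ^ p) * ENNReal.ofReal (1 - κ * (1 - Real.exp (-s))) *
        ∫⁻ X in {X | stageTime u a X k < ⊤}, ((stageTime u a X k).toNat : ℝ≥0∞) ^ p
          ∂(quenched ω x) +
      ENNReal.ofReal ((1 + 1 / θ) ^ p) * ENNReal.ofReal (recoverConst s c p * a ^ p) *
        quenched ω x {X | stageTime u a X k < ⊤} := by
  have hB := measurableSet_backtrackTime_lt (u := u)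
  have hRm : Measurable fun X : Path d => (recoverTime u a X : ℝ≥0∞) ^ p :=
    (measurable_of_countable fun t : ℕ∞ => (t : ℝ≥0∞) ^ p).comp (isStop_recoverTime u a).measurable
  have hsm₁ := strong_markov_le ω x (isStop_stageTime u a k)
      (G := {X : Path d | backtrackTime u X < ⊤}.indicator 1)
      (measurable_one.indicator hB)
      (g := ENNReal.ofReal (1 - κ * (1 - Real.exp (-s))))
      (fun y => by
        rw [lintegral_indicator_one hB]
        exact H.backtrack_prob_le hκ y) (fun m => (m : ℝ≥0∞) ^ p)
  have hsm₂ := strong_markov_le ω x (isStop_stageTime u a k)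
      (G := {X : Path d | backtrackTime u X < ⊤}.indicator
        fun X => (recoverTime u a X : ℝ≥0∞) ^ p)
      (hRm.indicator hB)
      (g := ENNReal.ofReal (recoverConst s c p * a ^ p))
      (fun y => by
        rw [lintegral_indicator hB]
        exact H.lintegral_recoverTime_le y hp ha) (fun _ => 1)
  rw [setLIntegral_one] at hsm₂
  simp only [one_mul] at hsm₂
  have hmeas₁ : Measurable fun X : Path d => ((stageTime u a X k).toNat : ℝ≥0∞) ^ p *
      {X : Path d | backtrackTime u X < ⊤}.indicator 1
        (shiftPath (stageTime u a X k).toNat X) := by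
    have hS := (isStop_stageTime u a k).measurable
    refine Measurable.mul ((measurable_of_countable fun t : ℕ∞ => (t.toNat : ℝ≥0∞) ^ p).comp hS) ?_
    refine (measurable_one.indicator hB).comp ?_
    have : Measurable fun q : ℕ × Path d => shiftPath q.1 q.2 :=
      measurable_from_prod_countable_right fun m => measurable_shiftPath m
    exact this.comp (((measurable_of_countable ENat.toNat).comp hS).prodMk measurable_id)
  calc _ = ∫⁻ X in {X | stageTime u a X k < ⊤}, {X | stageTime u a X (k + 1) < ⊤}.indicator
          (fun X => ((stageTime u a X (k + 1)).toNat : ℝ≥0∞) ^ p) X ∂(quenched ω x) := by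
        rw [setLIntegral_indicator (measurableSet_stageTime_lt a (k + 1)),
          Set.inter_eq_left.2 (stageTime_lt_subset a k)]
    _ ≤ ∫⁻ X in {X | stageTime u a X k < ⊤},
        (ENNReal.ofReal ((1 + θ) ^ p) * (((stageTime u a X k).toNat : ℝ≥0∞) ^ p *
          {X : Path d | backtrackTime u X < ⊤}.indicator 1
            (shiftPath (stageTime u a X k).toNat X)) +
        ENNReal.ofReal ((1 + 1 / θ) ^ p) * ({X : Path d | backtrackTime u X < ⊤}.indicator
          (fun X => (recoverTime u a X : ℝ≥0∞) ^ p)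
            (shiftPath (stageTime u a X k).toNat X))) ∂(quenched ω x) := by
        refine lintegral_mono fun X => ?_
        by_cases hX : stageTime u a X (k + 1) < ⊤
        · have hR := recoverTime_lt_top_of_stageTime hX
          have h1 : shiftPath (stageTime u a X k).toNat X ∈ {X : Path d | backtrackTime u X < ⊤} :=
            backtrackTime_lt_top_of_recoverTime hR
          have hX' : X ∈ {X | stageTime u a X (k + 1) < ⊤} := hX
          rw [Set.indicator_of_mem h1, Set.indicator_of_mem h1, Set.indicator_of_mem hX',
            Pi.one_apply, mul_one]
          refine le_trans (le_of_eq ?_) (add_rpow_le (by linarith) hθ _ _)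
          congr 1
          simp only [stageTime]
          obtain ⟨i, hi⟩ := ENat.ne_top_iff_exists.1 (stageTime_lt_top_of_succ hX).ne
          obtain ⟨j, hj⟩ := ENat.ne_top_iff_exists.1 hR.ne
          rw [← hj, ← hi, ← Nat.cast_add, ENat.toNat_natCast, ENat.toNat_natCast,
            ENat.toENNReal_coe]
          push_cast; rfl
        · rw [Set.indicator_of_notMem (show X ∉ {X | stageTime u a X (k + 1) < ⊤} from hX)]
          exact zero_le
    _ = ENNReal.ofReal ((1 + θ) ^ p) * ∫⁻ X in {X | stageTime u a X k < ⊤},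
          (((stageTime u a X k).toNat : ℝ≥0∞) ^ p *
          {X : Path d | backtrackTime u X < ⊤}.indicator 1
            (shiftPath (stageTime u a X k).toNat X)) ∂(quenched ω x) +
        ENNReal.ofReal ((1 + 1 / θ) ^ p) * ∫⁻ X in {X | stageTime u a X k < ⊤},
          ({X : Path d | backtrackTime u X < ⊤}.indicator
          (fun X => (recoverTime u a X : ℝ≥0∞) ^ p)
            (shiftPath (stageTime u a X k).toNat X)) ∂(quenched ω x) := by
        rw [lintegral_add_left (hmeas₁.const_mul _),
          lintegral_const_mul' _ _ ENNReal.ofReal_ne_top,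
          lintegral_const_mul' _ _ ENNReal.ofReal_ne_top]
    _ ≤ _ := add_le_add (mul_le_mul_right hsm₁ _) (mul_le_mul_right hsm₂ _)
    _ = _ := by ring

/-- Almost surely the construction of the regeneration time stops at a finite stage. -/
theorem ae_regenTime_le (H : StepBounds u s c M κ ω) (hκ : 0 < κ) (x : Site d) {a : ℝ}
    (ha : 1 ≤ a) :
    ∀ᵐ X ∂(quenched ω x), ∃ k, stageTime u a X k < ⊤ ∧ regenTime u a X ≤ stageTime u a X k := by
  have hs := H.s_pos
  have h0 : ∀ᵐ X ∂(quenched ω x), stageTime u a X 0 < ⊤ := by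
    have h1 := H.lintegral_reachTime_le x le_rfl ha
    have hm : Measurable fun X : Path d => (reachTime u a X : ℝ≥0∞) ^ (1 : ℝ) :=
      (measurable_of_countable fun t : ℕ∞ => (t : ℝ≥0∞) ^ (1 : ℝ)).comp
        (isStop_reachTime u a).measurable
    filter_upwards [ae_lt_top hm (h1.trans_lt ENNReal.ofReal_lt_top).ne] with X hX
    rw [ENNReal.rpow_one] at hX
    exact ENat.toENNReal_lt_top.1 hX
  have hR : ∀ y, ∀ᵐ X ∂(quenched ω y), backtrackTime u X < ⊤ → recoverTime u a X < ⊤ := by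
    intro y
    have h1 := H.lintegral_recoverTime_le y le_rfl ha
    have hm : Measurable fun X : Path d => (recoverTime u a X : ℝ≥0∞) ^ (1 : ℝ) :=
      (measurable_of_countable fun t : ℕ∞ => (t : ℝ≥0∞) ^ (1 : ℝ)).comp
        (isStop_recoverTime u a).measurable
    refine (ae_restrict_iff' measurableSet_backtrackTime_lt).1 ?_
    filter_upwards [ae_lt_top hm (h1.trans_lt ENNReal.ofReal_lt_top).ne] with X hX
    rw [ENNReal.rpow_one] at hX
    exact ENat.toENNReal_lt_top.1 hX
  let N : Set (Path d) := {X | backtrackTime u X < ⊤ ∧ ¬ recoverTime u a X < ⊤}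
  have hN : MeasurableSet N := measurableSet_backtrackTime_lt.inter
    ((isStop_recoverTime u a).measurable (MeasurableSet.of_discrete (s := Set.Iio (⊤ : ℕ∞)))).compl
  have hk : ∀ᵐ X ∂(quenched ω x), ∀ k, stageTime u a X k < ⊤ →
      shiftPath (stageTime u a X k).toNat X ∉ N := by
    refine ae_all_iff.2 fun k => ?_
    have hsm := strong_markov_le ω x (isStop_stageTime u a k) (G := N.indicator 1)
      (measurable_one.indicator hN) (g := 0) (fun y => by
        rw [lintegral_indicator_one hN]
        refine (measure_eq_zero_iff_ae_notMem.2 ?_).le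
        filter_upwards [hR y] with X hX h
        exact h.2 (hX h.1)) (fun _ => 1)
    simp only [mul_zero, one_mul, nonpos_iff_eq_zero] at hsm
    have hS := (isStop_stageTime u a k).measurable
    have hsh : Measurable fun q : ℕ × Path d => shiftPath q.1 q.2 :=
      measurable_from_prod_countable_right fun m => measurable_shiftPath m
    have hm : Measurable fun X : Path d => shiftPath (stageTime u a X k).toNat X :=
      hsh.comp (((measurable_of_countable ENat.toNat).comp hS).prodMk measurable_id)
    have hmN : Measurable fun X : Path d =>
        N.indicator (1 : Path d → ℝ≥0∞) (shiftPath (stageTime u a X k).toNat X) :=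
      (measurable_one.indicator hN).comp hm
    rw [lintegral_eq_zero_iff hmN] at hsm
    have := (ae_restrict_iff' (measurableSet_stageTime_lt a k)).1 hsm
    filter_upwards [this] with X hX h hXN
    have := hX h
    rw [Set.indicator_of_mem hXN] at this
    simp at this
  have hfin : ∀ᵐ X ∂(quenched ω x), ∃ k, ¬ stageTime u a X k < ⊤ := by
    have h1 : quenched ω x (⋂ k, {X | stageTime u a X k < ⊤}) = 0 := by
      have hb : ENNReal.ofReal (1 - κ * (1 - Real.exp (-s))) < 1 := by
        rw [ENNReal.ofReal_lt_one]
        have := mul_pos hκ (one_sub_exp_pos hs)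
        linarith
      refine le_antisymm (ge_of_tendsto' (ENNReal.tendsto_pow_atTop_nhds_zero_of_lt_one hb)
        fun k => ?_) zero_le
      exact (measure_mono (Set.iInter_subset _ k)).trans (H.stageTime_prob_le hκ.le x a k)
    filter_upwards [measure_eq_zero_iff_ae_notMem.1 h1] with X hX
    simpa using hX
  filter_upwards [h0, hk, hfin] with X h0 hk hfin
  classical
  obtain ⟨j, hj⟩ : ∃ j, Nat.find hfin = j + 1 := Nat.exists_eq_succ_of_ne_zero fun h => by
    have := Nat.find_spec hfin
    rw [h] at this
    exact this h0
  have hfin' : ∀ i ≤ j, stageTime u a X i < ⊤ := fun i hi => by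
    exact not_not.1 (Nat.find_min hfin (m := i) (by omega))
  have htop : ¬ stageTime u a X (j + 1) < ⊤ := hj ▸ Nat.find_spec hfin
  refine ⟨j, hfin' j le_rfl, iInf₂_le j ⟨fun i hi => ?_, ?_⟩⟩
  · exact backtrackTime_lt_top_of_recoverTime (recoverTime_lt_top_of_stageTime (hfin' (i + 1) hi))
  · by_contra hβ
    have hr : recoverTime u a (shiftPath (stageTime u a X j).toNat X) < ⊤ := by
      by_contra hr
      exact hk j (hfin' j le_rfl) ⟨lt_top_iff_ne_top.2 hβ, hr⟩
    refine htop ?_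
    simp only [stageTime]
    exact ENat.add_lt_top.2 ⟨hfin' j le_rfl, hr⟩

/-- The constant in the moment bound for `τ_1^{(a)}`. -/
noncomputable def regenConst (s c κ p : ℝ) : ℝ :=
  let b := 1 - κ * (1 - Real.exp (-s))
  let ρ := 2 / (1 + b)
  (reachConst s c p + (1 + 1 / (ρ ^ (1 / p) - 1)) ^ p * recoverConst s c p / (1 - b)) / (1 - ρ * b)

theorem reachConst_nonneg {p : ℝ} (hp : 1 ≤ p) (hs : 0 < s) (hc : 0 < c) :
    0 ≤ reachConst s c p := by
  have := tailConst_nonneg (p := p) (c := c) (by linarith) hc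
  unfold reachConst; positivity

theorem recoverConst_nonneg {p : ℝ} (hp : 1 ≤ p) (hs : 0 < s) (hc : 0 < c) :
    0 ≤ recoverConst s c p := by
  have := tailConst_nonneg (p := p) (c := c / 2) (by linarith) (by positivity)
  have := one_sub_exp_pos hc
  unfold recoverConst; positivity

/-- The moments of the stages satisfy a recursion with a factor below one, so they can be summed
over the number of the last stage. -/
theorem lintegral_regenTime_le (H : StepBounds u s c M κ ω) (hκ : 0 < κ) (x : Site d)
    {p a : ℝ} (hp : 1 ≤ p) (ha : 1 ≤ a) :
    ∫⁻ X, (regenTime u a X : ℝ≥0∞) ^ p ∂(quenched ω x) ≤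
      ENNReal.ofReal (regenConst s c κ p * a ^ p) := by
  have hs := H.s_pos
  have hc := H.c_pos
  set b := 1 - κ * (1 - Real.exp (-s)) with hb
  have hb1 : b < 1 := by
    have := mul_pos hκ (one_sub_exp_pos hs)
    linarith
  have hb0 : 0 ≤ b := by
    have := (H.no_backtrack hκ.le x).trans prob_le_one
    rw [ENNReal.ofReal_le_one] at this
    linarith
  -- `1 < ρ` and `ρ * b < 1`; below `θ` is chosen such that `(1 + θ) ^ p = ρ`
  set ρ := 2 / (1 + b) with hρ
  have hρ1 : 1 < ρ := by rw [hρ, lt_div_iff₀ (by linarith)]; linarith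
  set θ := ρ ^ (1 / p) - 1 with hθ
  have hθ0 : 0 < θ := by
    have := Real.one_lt_rpow hρ1 (z := 1 / p) (by positivity)
    linarith
  have hθp : (1 + θ) ^ p = ρ := by
    rw [hθ, add_sub_cancel, ← Real.rpow_mul (by linarith), one_div_mul_cancel (by linarith),
      Real.rpow_one]
  have hρb : ρ * b < 1 := by
    rw [hρ, div_mul_eq_mul_div, div_lt_one (by linarith)]; linarith
  have ha0 : 0 ≤ a ^ p := by positivity
  have hrec := recoverConst_nonneg (c := c) hp hs hc
  have hrea := reachConst_nonneg (c := c) hp hs hc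
  let v : ℕ → ℝ≥0∞ := fun k =>
    ∫⁻ X in {X | stageTime u a X k < ⊤}, ((stageTime u a X k).toNat : ℝ≥0∞) ^ p ∂(quenched ω x)
  have hv : ∑' k, v k ≤ ENNReal.ofReal ((reachConst s c p * a ^ p +
      (1 + 1 / θ) ^ p * (recoverConst s c p * a ^ p) / (1 - b)) / (1 - ρ * b)) := by
    refine tsum_le_of_recursion (by positivity) (by positivity) (by positivity) hρb hb0 hb1 ?_
      fun k => ?_
    · refine le_trans (lintegral_mono_ae ?_) ((setLIntegral_le_lintegral _ _).trans
        (H.lintegral_reachTime_le x hp ha))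
      filter_upwards [ae_restrict_mem (measurableSet_stageTime_lt a 0)] with X hX
      obtain ⟨m, hm⟩ := ENat.ne_top_iff_exists.1 (ne_of_lt hX)
      rw [← hm]
      simp only [stageTime] at hm
      rw [← hm, ENat.toNat_natCast, ENat.toENNReal_coe]
    · refine (H.lintegral_stageTime_succ_le hκ.le x hp ha hθ0 k).trans ?_
      rw [hθp, ← ENNReal.ofReal_mul (by linarith)]
      gcongr
      rw [← ENNReal.ofReal_mul (by positivity : 0 ≤ (1 + 1 / θ) ^ p),
        ENNReal.ofReal_mul (p := (1 + 1 / θ) ^ p * (recoverConst s c p * a ^ p)) (by positivity)]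
      gcongr
      rw [ENNReal.ofReal_pow hb0]
      exact H.stageTime_prob_le hκ.le x a k
  calc _ ≤ ∫⁻ X, ∑' k, {X | stageTime u a X k < ⊤}.indicator
          (fun X => ((stageTime u a X k).toNat : ℝ≥0∞) ^ p) X ∂(quenched ω x) := by
        refine lintegral_mono_ae ?_
        filter_upwards [H.ae_regenTime_le hκ x ha] with X ⟨k, hk, hle⟩
        refine le_trans ?_ (ENNReal.le_tsum k)
        rw [Set.indicator_of_mem (show X ∈ {X | stageTime u a X k < ⊤} from hk)]
        refine ENNReal.rpow_le_rpow ?_ (by linarith)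
        refine (ENat.toENNReal_le.2 hle).trans (le_of_eq ?_)
        obtain ⟨m, hm⟩ := ENat.ne_top_iff_exists.1 hk.ne
        rw [← hm, ENat.toNat_natCast, ENat.toENNReal_coe]
    _ = ∑' k, v k := by
        rw [lintegral_tsum]
        · exact tsum_congr fun k => lintegral_indicator (measurableSet_stageTime_lt a k) _
        · intro k
          refine Measurable.aemeasurable (Measurable.indicator ?_ (measurableSet_stageTime_lt a k))
          exact (measurable_of_countable fun t : ℕ∞ => (t.toNat : ℝ≥0∞) ^ p).comp
            (isStop_stageTime u a k).measurable
    _ ≤ _ := hv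
    _ = _ := by
        simp only [regenConst, ← hb, ← hρ, ← hθ]
        congr 1; ring

end StepBounds

/-! ### The quenched estimates -/

variable {u : Site d} {δ M s₀ : ℝ} {ω : Env d}

theorem GoodEnv.exp_level (hG : GoodEnv u δ M s₀ ω) (hu : u ≠ 0) (hδ : 0 < δ) (hs₀ : 0 < s₀)
    {s : ℝ} (hs : 0 ≤ s) (hs1 : s ≤ expRate u δ M s₀) (x : Site d) :
    ∑' y, ENNReal.ofReal (transProb ω x y) *
      ENNReal.ofReal (Real.exp (-s * ((y ⬝ᵥ u : ℤ) : ℝ))) ≤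
      ENNReal.ofReal (Real.exp (-s * ((x ⬝ᵥ u : ℤ) : ℝ)) * (1 - s * δ / 2)) := by
  rw [tsum_transProb, ENNReal.ofReal_mul (Real.exp_pos _).le]
  calc _ = ENNReal.ofReal (Real.exp (-s * ((x ⬝ᵥ u : ℤ) : ℝ))) * ∑' z,
        ENNReal.ofReal ((ω x).1 z) * ENNReal.ofReal (Real.exp (-s * ((z ⬝ᵥ u : ℤ) : ℝ))) := by
        rw [← ENNReal.tsum_mul_left]
        refine tsum_congr fun z => ?_
        rw [mul_left_comm, ofReal_exp_mul, add_dotProduct]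
        congr 3; push_cast; ring
    _ ≤ _ := by
        gcongr
        exact tsum_exp_neg_le hu hδ hs₀ (hG x).1 (hG x).2 hs hs1

theorem GoodEnv.exp_len (hG : GoodEnv u δ M s₀ ω) (hs₀ : 0 < s₀) {s : ℝ} (hs : 0 ≤ s)
    (hs1 : s ≤ s₀) (x : Site d) :
    ∑' y, ENNReal.ofReal (transProb ω x y) * ENNReal.ofReal (Real.exp (s * len (y - x))) ≤
      ENNReal.ofReal (Real.exp (s * M)) := by
  rw [tsum_transProb]
  simp only [add_sub_cancel_left]
  exact tsum_exp_len_le hs₀ (hG x).2 hs hs1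

theorem GoodEnv.stepBounds (hG : GoodEnv u δ M s₀ ω) (hu : u ≠ 0) (hδ : 0 < δ) (hM : 0 < M)
    (hs₀ : 0 < s₀) :
    StepBounds u (expRate u δ M s₀) (expRate u δ M s₀ * δ / 2) M (δ ^ 2 / momentConst u M s₀) ω := by
  have hs := expRate_pos (M := M) hu hδ hs₀
  refine ⟨hs, by positivity, hM, fun x => ?_, fun x => ?_, fun x => ?_⟩
  · refine (hG.exp_level hu hδ hs₀ hs.le le_rfl x).trans (ENNReal.ofReal_le_ofReal ?_)
    rw [sub_eq_add_neg (-expRate u δ M s₀ * _), Real.exp_add]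
    gcongr
    exact Real.one_sub_le_exp_neg _
  · exact hG.exp_len hs₀ hs.le expRate_le x
  · rw [tsum_transProb]
    simpa [add_dotProduct] using le_tsum_up hu hδ hs₀ (hG x).1 (hG x).2

/-- The moment constants `C_p`. -/
noncomputable def momentBound (s c M κ p : ℝ) : ℝ :=
  1 + StepBounds.reachConst s c p +
    (1 + StepBounds.posConst s M p + (4 * M) ^ p * StepBounds.reachConst s c p) +
    (p / (s / 4)) ^ p / (1 - Real.exp (-(s / 4))) * s ^ p + StepBounds.regenConst s c κ p +
    (1 + StepBounds.posConst s M p + (4 * M) ^ p * StepBounds.regenConst s c κ p)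

variable {u : Site d} {δ M s₀ : ℝ} {ω : Env d}

theorem atTime_congr {t : ℕ∞} {f g : ℕ → ℝ≥0∞} (h : ∀ m, f m = g m) : atTime t f = atTime t g := by
  simp only [atTime, h]

theorem posConst_nonneg {s q : ℝ} (hs : 0 < s) (hM : 0 < M) (hq : 0 < q) :
    0 ≤ StepBounds.posConst s M q := by
  have := one_sub_exp_pos (b := s * M) (by positivity)
  unfold StepBounds.posConst; positivity

/-- `regenConst` is meaningful once `η = κ(1 - e^{-s})` is at most one. -/
theorem regenConst_nonneg {s c κ p : ℝ} (hp : 1 ≤ p) (hs : 0 < s) (hc : 0 < c) (hκ : 0 < κ)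
    (h1 : κ * (1 - Real.exp (-s)) ≤ 1) : 0 ≤ StepBounds.regenConst s c κ p := by
  have h2 := mul_pos hκ (one_sub_exp_pos hs)
  have h3 := StepBounds.reachConst_nonneg (c := c) hp hs hc
  have h4 := StepBounds.recoverConst_nonneg (c := c) hp hs hc
  unfold StepBounds.regenConst
  set b := 1 - κ * (1 - Real.exp (-s)) with hb
  have hb0 : 0 ≤ b := by linarith
  have hb1 : b < 1 := by linarith
  have h5 : 1 < 2 / (1 + b) := by rw [lt_div_iff₀ (by linarith)]; linarith
  have h6 : 1 < (2 / (1 + b)) ^ (1 / p) := Real.one_lt_rpow h5 (by positivity)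
  have h7 : 2 / (1 + b) * b < 1 := by rw [div_mul_eq_mul_div, div_lt_one (by linarith)]; linarith
  have h8 : 0 < (2 / (1 + b)) ^ (1 / p) - 1 := by linarith
  refine div_nonneg (add_nonneg h3 (div_nonneg (mul_nonneg ?_ h4) (by linarith))) (by linarith)
  positivity

theorem one_le_momentBound {s c κ p : ℝ} (hp : 1 ≤ p) (hs : 0 < s) (hc : 0 < c) (hM : 0 < M)
    (hκ : 0 < κ) (h1 : κ * (1 - Real.exp (-s)) ≤ 1) : 1 ≤ momentBound s c M κ p := by
  have hE4 := one_sub_exp_pos (b := s / 4) (by positivity)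
  have h2 := StepBounds.reachConst_nonneg (c := c) hp hs hc
  have h3 := posConst_nonneg (q := p) hs hM (by linarith)
  have h4 := regenConst_nonneg hp hs hc hκ h1
  have h5 : 0 ≤ (p / (s / 4)) ^ p / (1 - Real.exp (-(s / 4))) * s ^ p := by positivity
  have h6 : 0 ≤ (4 * M) ^ p * StepBounds.reachConst s c p := by positivity
  have h7 : 0 ≤ (4 * M) ^ p * StepBounds.regenConst s c κ p := by positivity
  unfold momentBound
  linarith

/-- All the quenched estimates, at an environment with the drift and moment hypotheses. -/
theorem GoodEnv.quenchedEstimates (hG : GoodEnv u δ M s₀ ω) (hu : u ≠ 0) (hδ : 0 < δ) (hM : 0 < M)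
    (hs₀ : 0 < s₀) {s c κ : ℝ} (hs : s = expRate u δ M s₀) (hc : c = s * δ / 2)
    (hκ0 : 0 < κ) (hκ : κ ≤ δ ^ 2 / momentConst u M s₀) :
    QuenchedEstimates u δ M (κ * (1 - Real.exp (-s))) 1 κ s (momentBound s c M κ) ω := by
  have H : StepBounds u s c M κ ω := by
    have h := hG.stepBounds hu hδ hM hs₀
    rw [hc, hs]
    exact ⟨h.s_pos, h.c_pos, h.M_pos, h.exp_level, h.exp_len,
      fun x => (ENNReal.ofReal_le_ofReal hκ).trans (h.up x)⟩
  have hs0 := H.s_pos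
  have hc0 := H.c_pos
  have hη1 : κ * (1 - Real.exp (-s)) ≤ 1 := by
    have := (H.no_backtrack hκ0.le 0).trans prob_le_one
    rwa [ENNReal.ofReal_le_one] at this
  have hE4 := one_sub_exp_pos (b := s / 4) (by positivity)
  have nn1 : ∀ p, 1 ≤ p → 0 ≤ StepBounds.reachConst s c p := fun p hp =>
    StepBounds.reachConst_nonneg hp hs0 hc0
  have nn2 : ∀ p, 1 ≤ p → 0 ≤ 1 + StepBounds.posConst s M p := fun p hp =>
    add_nonneg zero_le_one (posConst_nonneg hs0 hM (by linarith))
  have nn3 : ∀ p, 1 ≤ p → 0 ≤ StepBounds.regenConst s c κ p := fun p hp =>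
    regenConst_nonneg hp hs0 hc0 hκ0 hη1
  have nn4 : ∀ p : ℝ, 1 ≤ p → 0 ≤ (p / (s / 4)) ^ p / (1 - Real.exp (-(s / 4))) * s ^ p :=
    fun p hp => by positivity
  have nn5 : ∀ p : ℝ, 0 ≤ (4 * M) ^ p := fun p => by positivity
  have pos_le : ∀ (x : Site d) (n : ℕ) (T : Path d → ℕ∞) (p q a K : ℝ), 1 ≤ p → p ≤ q → 1 ≤ a →
      0 ≤ K → 1 + StepBounds.posConst s M q + (4 * M) ^ q * K ≤ momentBound s c M κ q →
      ∫⁻ X, (T X : ℝ≥0∞) ^ q ∂(quenched ω x) ≤ ENNReal.ofReal (K * a ^ q) →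
      ∫⁻ X, atTime (T X) (fun m => ENNReal.ofReal (len (X (m + n) - X n) ^ p)) ∂(quenched ω x) ≤
        ENNReal.ofReal (momentBound s c M κ q * a ^ q) := by
    intro x n T p q a K hp hpq ha hK hle hT
    refine (H.lintegral_len_le x n T hp hpq).trans ?_
    have haq : 1 ≤ a ^ q := Real.one_le_rpow ha (by linarith)
    have hq := nn2 q (hp.trans hpq)
    have hK' : 0 ≤ (4 * M) ^ q * K := mul_nonneg (nn5 q) hK
    calc _ ≤ ENNReal.ofReal (1 + StepBounds.posConst s M q) +
          ENNReal.ofReal ((4 * M) ^ q) * ENNReal.ofReal (K * a ^ q) := by gcongr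
      _ = ENNReal.ofReal (1 + StepBounds.posConst s M q + (4 * M) ^ q * K * a ^ q) := by
          rw [← ENNReal.ofReal_mul (nn5 q), ← ENNReal.ofReal_add hq (by positivity)]
          congr 1; ring
      _ ≤ _ := ENNReal.ofReal_le_ofReal (by nlinarith)
  refine ⟨?_, ?_, ?_, ?_, ?_, ?_, ?_, ?_, ?_⟩
  · intro x n t ht ht1
    refine lintegral_exp_level_le ?_ (fun x => ?_) x n
    · have h1 : t ≤ 1 / δ := by
        rw [hs] at ht1
        exact ht1.trans ((min_le_right _ _).trans ((min_le_right _ _).trans (min_le_right _ _)))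
      have : t * δ ≤ 1 := by rwa [le_div_iff₀ hδ] at h1
      linarith
    · exact hG.exp_level hu hδ hs₀ ht (hs ▸ ht1) x
  · intro x n t ht ht1
    exact lintegral_exp_len_le ht (fun x => hG.exp_len hs₀ ht (ht1.trans (hs ▸ expRate_le)) x) x n
  · intro x
    refine (H.up x).trans (le_of_eq ?_)
    have hS : MeasurableSet {y : Site d | ((x ⬝ᵥ u : ℤ) : ℝ) + 1 ≤ ((y ⬝ᵥ u : ℤ) : ℝ)} :=
      MeasurableSet.of_discrete
    have h1 : quenched ω x {X | ((x ⬝ᵥ u : ℤ) : ℝ) + 1 ≤ ((X 1 ⬝ᵥ u : ℤ) : ℝ)} =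
        stepKernel ω x {y : Site d | ((x ⬝ᵥ u : ℤ) : ℝ) + 1 ≤ ((y ⬝ᵥ u : ℤ) : ℝ)} := by
      rw [← quenched_map_one, Measure.map_apply (measurable_pi_apply 1) hS]
      rfl
    rw [h1, ← lintegral_indicator_one hS, lintegral_stepKernel]
    refine tsum_congr fun y => ?_
    congr 1
    by_cases hy : x ⬝ᵥ u + 1 ≤ y ⬝ᵥ u
    · rw [if_pos hy, Set.indicator_of_mem]
      · simp
      · exact_mod_cast hy
    · rw [if_neg hy, Set.indicator_of_notMem]
      · simp
      · exact_mod_cast hy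
  · intro x p ℓ hp hℓ
    refine (H.lintegral_reachTime_le x hp hℓ).trans (ENNReal.ofReal_le_ofReal ?_)
    gcongr
    have := nn1 p hp; have := nn2 p hp; have := nn3 p hp; have := nn4 p hp
    have := mul_nonneg (nn5 p) (nn1 p hp); have := mul_nonneg (nn5 p) (nn3 p hp)
    unfold momentBound
    rw [StepBounds.reachConst] at *
    linarith
  · intro x p ℓ hp hℓ
    have h := pos_le x 0 (reachTime u ℓ) p p ℓ (StepBounds.reachConst s c p) hp le_rfl hℓ (nn1 p hp)
      (by
        have := nn1 p hp; have := nn2 p hp; have := nn3 p hp; have := nn4 p hp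
        have := mul_nonneg (nn5 p) (nn1 p hp); have := mul_nonneg (nn5 p) (nn3 p hp)
        unfold momentBound
        linarith) (H.lintegral_reachTime_le x hp hℓ)
    refine le_trans (le_of_eq (lintegral_congr_ae ?_)) h
    filter_upwards [quenched_zero ω x] with X hX
    exact atTime_congr fun m => by rw [hX, add_zero]
  · intro z n t p ℓ _ ht ht1 hp hℓ
    refine (H.lintegral_hitting_le z n hp hℓ).trans ?_
    have hCp1 : 1 ≤ momentBound s c M κ p := one_le_momentBound hp hs0 hc0 hM hκ0 hη1
    have hCp2 : (p / (s / 4)) ^ p / (1 - Real.exp (-(s / 4))) * s ^ p ≤ momentBound s c M κ p := by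
      have := nn1 p hp; have := nn2 p hp; have := nn3 p hp; have := nn4 p hp
      have := mul_nonneg (nn5 p) (nn1 p hp); have := mul_nonneg (nn5 p) (nn3 p hp)
      unfold momentBound
      linarith
    have h1 : ENNReal.ofReal (s ^ (-p)) ≤ ENNReal.ofReal t ^ (-p) := by
      rw [← ENNReal.ofReal_rpow_of_pos hs0, ENNReal.rpow_neg, ENNReal.rpow_neg]
      exact ENNReal.inv_le_inv.2 (ENNReal.rpow_le_rpow (ENNReal.ofReal_le_ofReal ht1) (by linarith))
    refine add_le_add ?_ ?_
    · gcongr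
      have : 0 ≤ ℓ ^ p := by positivity
      nlinarith
    · calc _ = ENNReal.ofReal ((p / (s / 4)) ^ p / (1 - Real.exp (-(s / 4))) * s ^ p) *
            ENNReal.ofReal (s ^ (-p)) * ENNReal.ofReal (Real.exp (-(s * ℓ / 2))) := by
            rw [← ENNReal.ofReal_mul (by positivity), ← ENNReal.ofReal_mul (by positivity),
              mul_assoc _ (s ^ p), ← Real.rpow_add hs0, add_neg_cancel, Real.rpow_zero, mul_one]
        _ ≤ _ := by
            gcongr
            nlinarith
  · exact H.no_backtrack hκ0.le
  · intro x p a hp ha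
    refine (H.lintegral_regenTime_le hκ0 x hp ha).trans (ENNReal.ofReal_le_ofReal ?_)
    gcongr
    have := nn1 p hp; have := nn2 p hp; have := nn3 p hp; have := nn4 p hp
    have := mul_nonneg (nn5 p) (nn1 p hp); have := mul_nonneg (nn5 p) (nn3 p hp)
    unfold momentBound
    linarith
  · intro x n p q a hp hpq ha
    have hq : 1 ≤ q := hp.trans hpq.le
    refine pos_le x n (regenTime u a) p q a (StepBounds.regenConst s c κ q) hp hpq.le ha
      (nn3 q hq) ?_ (H.lintegral_regenTime_le hκ0 x hq ha)
    have := nn1 q hq; have := nn2 q hq; have := nn3 q hq; have := nn4 q hq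
    have := mul_nonneg (nn5 q) (nn1 q hq); have := mul_nonneg (nn5 q) (nn3 q hq)
    unfold momentBound
    linarith

/-! ### The process of the environment seen from the walk -/

/-- `E_0^ω f(T_{X_n} ω)`, the `n`-step transition operator of the environment process. -/
noncomputable def envOp (n : ℕ) (f : Env d → ℝ≥0∞) (ω : Env d) : ℝ≥0∞ :=
  ∫⁻ X, f (shiftEnv (X n) ω) ∂(quenched ω 0)

theorem shiftEnv_add (y z : Site d) (ω : Env d) :
    shiftEnv (y + z) ω = shiftEnv y (shiftEnv z ω) := by
  funext x; simp [shiftEnv, add_assoc]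

theorem shiftEnv_zero (ω : Env d) : shiftEnv 0 ω = ω := by
  funext x; simp [shiftEnv]

theorem dependsUpTo_apply {α : Type*} (g : Site d → α) (n : ℕ) :
    DependsUpTo n fun X : Path d => g (X n) := fun X Y h => by simp only [h n le_rfl]

theorem DependsUpTo.indicator {α : Type*} [Zero α] {n : ℕ} {S : Set (Path d)} {F : Path d → α}
    (hS : DependsUpTo n fun X => X ∈ S) (hF : DependsUpTo n F) : DependsUpTo n (S.indicator F) := by
  intro X Y h
  have h1 : X ∈ S ↔ Y ∈ S := iff_of_eq (hS X Y h)
  by_cases hX : X ∈ S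
  · rw [Set.indicator_of_mem hX, Set.indicator_of_mem (h1.1 hX), hF X Y h]
  · rw [Set.indicator_of_notMem hX, Set.indicator_of_notMem fun hY => hX (h1.2 hY)]

theorem measurable_envOp (n : ℕ) {f : Env d → ℝ≥0∞} (hf : Measurable f) :
    Measurable (envOp n f) :=
  measurable_lintegral_quenched measurable_id 0 n
    (fun ω => dependsUpTo_apply (fun z => f (shiftEnv z ω)) n)
    fun _ => hf.comp (measurable_shiftEnv _)

theorem envOp_zero (f : Env d → ℝ≥0∞) : envOp 0 f = f := by
  funext ω
  rw [envOp, lintegral_quenched_zero _ _ (dependsUpTo_apply (fun z => f (shiftEnv z ω)) 0),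
    shiftEnv_zero]

theorem envOp_mono {n : ℕ} {f g : Env d → ℝ≥0∞} (h : f ≤ g) : envOp n f ≤ envOp n g :=
  fun _ => lintegral_mono fun _ => h _

theorem envOp_succ_eq_tsum (n : ℕ) (f : Env d → ℝ≥0∞) (ω : Env d) :
    envOp (n + 1) f ω =
      ∑' y, ENNReal.ofReal (transProb ω 0 y) * envOp n f (shiftEnv y ω) := by
  have hF : Measurable fun X : Path d => f (shiftEnv (X (n + 1)) ω) :=
    (dependsUpTo_apply (fun z => f (shiftEnv z ω)) (n + 1)).measurable
  have h1 := lintegral_quenched ω 0 hF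
  have h2 : ∀ y, ∫⁻ X, f (shiftEnv (X n) ω) ∂(quenched ω y) = envOp n f (shiftEnv y ω) := by
    intro y
    have h := lintegral_quenched_add ω 0 y n (dependsUpTo_apply (fun z => f (shiftEnv z ω)) n)
    rw [zero_add] at h
    rw [h]
    unfold envOp
    exact lintegral_congr fun X => by rw [shiftEnv_add]
  unfold envOp at h2 ⊢
  rw [h1]
  exact tsum_congr fun y => congrArg _ (h2 y)

theorem envOp_one_eq_tsum (f : Env d → ℝ≥0∞) (ω : Env d) :
    envOp 1 f ω = ∑' y, ENNReal.ofReal (transProb ω 0 y) * f (shiftEnv y ω) := by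
  rw [envOp_succ_eq_tsum, envOp_zero]

theorem envOp_succ (n : ℕ) (f : Env d → ℝ≥0∞) : envOp (n + 1) f = envOp 1 (envOp n f) := by
  funext ω
  rw [envOp_succ_eq_tsum, envOp_one_eq_tsum]

theorem lintegral_envKernel (ω : Env d) {f : Env d → ℝ≥0∞} (hf : Measurable f) :
    ∫⁻ ω', f ω' ∂(envKernel d ω) = envOp 1 f ω := by
  have hm : Measurable fun X : Path d => shiftEnv (X 1) ω :=
    (measurable_of_countable fun z => shiftEnv z ω).comp (measurable_pi_apply 1)
  change ∫⁻ ω', f ω' ∂((quenched ω 0).map fun X => shiftEnv (X 1) ω) = _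
  rw [lintegral_map hf hm]
  rfl

theorem lintegral_bind_envKernel (μ : Measure (Env d)) {f : Env d → ℝ≥0∞} (hf : Measurable f) :
    ∫⁻ ω, f ω ∂(μ.bind (envKernel d)) = ∫⁻ ω, envOp 1 f ω ∂μ := by
  rw [Measure.lintegral_bind (envKernel d).measurable.aemeasurable hf.aemeasurable]
  simp_rw [lintegral_envKernel _ hf]

/-- The law of the environment process at time `n`, started from `μ`. -/
noncomputable def envLaw (μ : Measure (Env d)) (n : ℕ) : Measure (Env d) :=
  (fun ν => ν.bind (envKernel d))^[n] μ

theorem lintegral_envLaw (μ : Measure (Env d)) (n : ℕ) {f : Env d → ℝ≥0∞} (hf : Measurable f) :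
    ∫⁻ ω, f ω ∂(envLaw μ n) = ∫⁻ ω, envOp n f ω ∂μ := by
  induction n generalizing μ with
  | zero => simp [envLaw, envOp_zero]
  | succ n ih =>
    have h : envLaw μ (n + 1) = envLaw (μ.bind (envKernel d)) n := rfl
    rw [h, ih, lintegral_bind_envKernel _ (measurable_envOp n hf), ← envOp_succ]

theorem lintegral_envLaw_succ (μ : Measure (Env d)) (n : ℕ) {f : Env d → ℝ≥0∞}
    (hf : Measurable f) :
    ∫⁻ ω, f ω ∂(envLaw μ (n + 1)) = ∫⁻ ω, envOp 1 f ω ∂(envLaw μ n) := by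
  have h : envLaw μ (n + 1) = (envLaw μ n).bind (envKernel d) :=
    Function.iterate_succ_apply' _ _ _
  rw [h, lintegral_bind_envKernel _ hf]

theorem envOp_const (n : ℕ) (c : ℝ≥0∞) (ω : Env d) : envOp n (fun _ => c) ω = c := by
  simp [envOp]

instance isProbabilityMeasure_envLaw (μ : Measure (Env d)) [IsProbabilityMeasure μ] (n : ℕ) :
    IsProbabilityMeasure (envLaw μ n) := by
  constructor
  have h := lintegral_envLaw μ n (f := fun _ => 1) measurable_const
  simp only [envOp_const] at h
  simpa using h

theorem lintegral_envOp_of_invariant {μ : Measure (Env d)} (hμ : Kernel.Invariant (envKernel d) μ)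
    (n : ℕ) {f : Env d → ℝ≥0∞} (hf : Measurable f) : ∫⁻ ω, envOp n f ω ∂μ = ∫⁻ ω, f ω ∂μ := by
  induction n with
  | zero => rw [envOp_zero]
  | succ n ih =>
    rw [envOp_succ, ← lintegral_bind_envKernel _ (measurable_envOp n hf), hμ.def, ih]

/-! ### Splicing two environments along a level -/

/-- The environment that is `ω` below level `L` and `ω'` from level `L` on. -/
def splice (u : Site d) (L : ℤ) (ω ω' : Env d) : Env d :=
  fun x => if x ⬝ᵥ u < L then ω x else ω' x

theorem measurable_splice (u : Site d) (L : ℤ) :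
    Measurable fun q : Env d × Env d => splice u L q.1 q.2 := by
  refine measurable_pi_lambda _ fun x => ?_
  unfold splice
  split_ifs
  · exact (measurable_pi_apply x).comp measurable_fst
  · exact (measurable_pi_apply x).comp measurable_snd

theorem continuous_splice (u : Site d) (L : ℤ) (ω' : Env d) :
    Continuous fun ω : Env d => splice u L ω ω' := by
  refine continuous_pi fun x => ?_
  unfold splice
  split_ifs
  · exact continuous_apply x
  · exact continuous_const

theorem shiftEnv_splice (u : Site d) (L : ℤ) (z : Site d) (ω ω' : Env d) :
    shiftEnv z (splice u (L + z ⬝ᵥ u) ω ω') =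
      splice u L (shiftEnv z ω) (shiftEnv z ω') := by
  funext x
  simp [shiftEnv, splice, add_dotProduct]

section iid

variable {P : Measure (Env d)}

theorem IsIIDEnv.isProbabilityMeasure (h : IsIIDEnv P) : IsProbabilityMeasure P := by
  obtain ⟨α, hα, rfl⟩ := h
  infer_instance

theorem IsIIDEnv.map_shiftEnv (h : IsIIDEnv P) (z : Site d) : P.map (shiftEnv z) = P := by
  obtain ⟨α, hα, rfl⟩ := h
  refine Measure.eq_infinitePi _ fun s t ht => ?_
  classical
  rw [Measure.map_apply (measurable_shiftEnv z)
    (MeasurableSet.pi s.countable_toSet fun i _ => ht i)]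
  have : shiftEnv z ⁻¹' (Set.pi s t) =
      Set.pi (s.map (Equiv.addRight z).toEmbedding : Finset (Site d)) fun x => t (x - z) := by
    ext ω
    simp only [Set.mem_preimage, Set.mem_pi, shiftEnv, Finset.coe_map, Set.mem_image,
      Equiv.coe_toEmbedding, Equiv.coe_addRight]
    constructor
    · rintro h _ ⟨i, hi, rfl⟩
      simpa using h i hi
    · intro h i hi
      simpa using h (i + z) ⟨i, hi, rfl⟩
  rw [this, Measure.infinitePi_pi _ (fun i _ => ht _), Finset.prod_map]
  simp

theorem IsIIDEnv.map_splice (h : IsIIDEnv P) (u : Site d) (L : ℤ) :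
    (P.prod P).map (fun q => splice u L q.1 q.2) = P := by
  have := h.isProbabilityMeasure
  obtain ⟨α, hα, rfl⟩ := h
  refine Measure.eq_infinitePi _ fun s t ht => ?_
  classical
  rw [Measure.map_apply (measurable_splice u L)
    (MeasurableSet.pi s.countable_toSet fun i _ => ht i)]
  have : (fun q : Env d × Env d => splice u L q.1 q.2) ⁻¹' (Set.pi s t) =
      (Set.pi (s.filter fun x => x ⬝ᵥ u < L : Finset (Site d)) t) ×ˢ
      (Set.pi (s.filter fun x => ¬ x ⬝ᵥ u < L : Finset (Site d)) t) := by
    ext q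
    simp only [Set.mem_preimage, Set.mem_pi, splice, Set.mem_prod, Finset.coe_filter,
      Set.mem_ofPred_eq]
    constructor
    · intro h
      refine ⟨fun x hx => ?_, fun x hx => ?_⟩
      · have := h x hx.1; rwa [if_pos hx.2] at this
      · have := h x hx.1; rwa [if_neg hx.2] at this
    · rintro ⟨h1, h2⟩ x hx
      split_ifs with h3
      · exact h1 x ⟨hx, h3⟩
      · exact h2 x ⟨hx, h3⟩
  rw [this, Measure.prod_prod, Measure.infinitePi_pi _ (fun i _ => ht _),
    Measure.infinitePi_pi _ (fun i _ => ht _), Finset.prod_filter_mul_prod_filter_not]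

theorem IsIIDEnv.lintegral_shiftEnv (h : IsIIDEnv P) (z : Site d) {f : Env d → ℝ≥0∞}
    (hf : Measurable f) : ∫⁻ ω, f (shiftEnv z ω) ∂P = ∫⁻ ω, f ω ∂P := by
  conv_rhs => rw [← h.map_shiftEnv z, lintegral_map hf (measurable_shiftEnv z)]

theorem IsIIDEnv.lintegral_splice (h : IsIIDEnv P) (u : Site d) (L : ℤ) {f : Env d → ℝ≥0∞}
    (hf : Measurable f) : ∫⁻ ω, ∫⁻ ω', f (splice u L ω ω') ∂P ∂P = ∫⁻ ω, f ω ∂P := by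
  have := h.isProbabilityMeasure
  conv_rhs => rw [← h.map_splice u L, lintegral_map hf (measurable_splice u L)]
  have hm : Measurable fun q : Env d × Env d => f (splice u L q.1 q.2) :=
    hf.comp (measurable_splice u L)
  rw [lintegral_prod _ hm.aemeasurable]

theorem IsIIDEnv.ae_goodEnv (h : IsIIDEnv P) {u : Site d} {δ M s₀ : ℝ} (hN : NonNestling u δ P)
    (hM : MomentHyp s₀ M P) : ∀ᵐ ω ∂P, GoodEnv u δ M s₀ ω := by
  refine ae_all_iff.2 fun x => ?_
  have h1 : ∀ᵐ ω ∂P, DriftGE u δ (ω 0) ∧ ExpMomentLE s₀ M (ω 0) := hN.and hM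
  rw [← h.map_shiftEnv x] at h1
  filter_upwards [ae_of_ae_map (measurable_shiftEnv x).aemeasurable h1] with ω hω
  simpa [shiftEnv] using hω

end iid

/-- Integrals of a function of the path that involves its `n`-th position can be summed over that
position. -/
theorem lintegral_eq_tsum_position {μ : Measure (Path d)} (n : ℕ) {Φ : Site d → Path d → ℝ≥0∞}
    (hΦ : ∀ z, Measurable (Φ z)) :
    ∫⁻ X, Φ (X n) X ∂μ = ∑' z, ∫⁻ X, {X : Path d | X n = z}.indicator (Φ z) X ∂μ := by
  have hm : ∀ z, MeasurableSet {X : Path d | X n = z} := fun z =>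
    DependsUpTo.measurableSet (n := n) fun X Y h => by simp only [Set.mem_ofPred_eq, h n le_rfl]
  rw [← lintegral_tsum fun z => ((hΦ z).indicator (hm z)).aemeasurable]
  refine lintegral_congr fun X => ?_
  rw [tsum_eq_single (X n)]
  · rw [Set.indicator_of_mem]; rfl
  · intro z hz
    rw [Set.indicator_of_notMem]
    exact fun h => hz h.symm

namespace StepBounds

variable {u : Site d} {s c M κ : ℝ} {ω : Env d}

/-- The walk rarely has been more than `L` levels ahead of its present level. -/
theorem ahead_le (H : StepBounds u s c M κ ω) (x : Site d) (L : ℤ) (n : ℕ) :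
    quenched ω x {X | ∃ k < n, X n ⬝ᵥ u + L ≤ X k ⬝ᵥ u} ≤
      ENNReal.ofReal (1 / (1 - Real.exp (-c)) * Real.exp (-s * L)) := by
  have hc := H.c_pos
  have hdep : ∀ j : ℕ, DependsUpTo j fun X : Path d =>
      {X : Path d | X j ⬝ᵥ u + L ≤ X 0 ⬝ᵥ u}.indicator (1 : Path d → ℝ≥0∞) X := fun j X Y h => by
    simp only [Set.indicator_apply, Set.mem_ofPred_eq, h j le_rfl, h 0 (Nat.zero_le j)]
    rfl
  have hms : ∀ j : ℕ, MeasurableSet {X : Path d | X j ⬝ᵥ u + L ≤ X 0 ⬝ᵥ u} := fun j =>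
    DependsUpTo.measurableSet (n := j) fun X Y h => by
      simp only [Set.mem_ofPred_eq, h j le_rfl, h 0 (Nat.zero_le j)]
  have hms' : ∀ k < n, MeasurableSet {X : Path d | X n ⬝ᵥ u + L ≤ X k ⬝ᵥ u} := fun k hk =>
    DependsUpTo.measurableSet (n := n) fun X Y h => by
      simp only [Set.mem_ofPred_eq, h n le_rfl, h k hk.le]
  have h1 : ∀ k < n, quenched ω x {X | X n ⬝ᵥ u + L ≤ X k ⬝ᵥ u} ≤
      ENNReal.ofReal (Real.exp (-s * L) * Real.exp (-c * ((n - 1 - k : ℕ) : ℝ))) := by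
    intro k hk
    have hm := markov ω x k (F := fun _ => 1) (fun _ _ _ => rfl) (hdep (n - k)).measurable
    simp only [one_mul] at hm
    rw [← lintegral_indicator_one (hms' k hk)]
    have h2 : ∀ X : Path d, {X : Path d | X n ⬝ᵥ u + L ≤ X k ⬝ᵥ u}.indicator
        (1 : Path d → ℝ≥0∞) X = {X : Path d | X (n - k) ⬝ᵥ u + L ≤ X 0 ⬝ᵥ u}.indicator
        (1 : Path d → ℝ≥0∞) (shiftPath k X) := fun X => by
      have e : n - k + k = n := by omega
      simp only [Set.indicator_apply, Set.mem_ofPred_eq, shiftPath, zero_add, e]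
      rfl
    simp_rw [h2]
    rw [hm]
    calc _ ≤ ∫⁻ _, ENNReal.ofReal (Real.exp (s * (-L) - c * (n - k : ℕ))) ∂(quenched ω x) := by
          refine lintegral_mono fun X => ?_
          rw [lintegral_indicator_one (hms _)]
          refine le_trans (measure_mono_ae ?_) (H.level_le (X k) (n - k) (-L))
          filter_upwards [quenched_zero ω (X k)] with Y hY h
          have h : Y (n - k) ⬝ᵥ u + L ≤ Y 0 ⬝ᵥ u := h
          rw [hY] at h
          have h' : ((Y (n - k) ⬝ᵥ u : ℤ) : ℝ) + L ≤ ((X k ⬝ᵥ u : ℤ) : ℝ) := by exact_mod_cast h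
          change ((Y (n - k) ⬝ᵥ u : ℤ) : ℝ) ≤ ((X k ⬝ᵥ u : ℤ) : ℝ) + -L
          linarith
      _ ≤ _ := by
          rw [lintegral_const, measure_univ, mul_one, ← Real.exp_add]
          refine ENNReal.ofReal_le_ofReal (Real.exp_le_exp.2 ?_)
          have : ((n - 1 - k : ℕ) : ℝ) ≤ ((n - k : ℕ) : ℝ) := by exact_mod_cast (by omega)
          nlinarith
  calc _ ≤ quenched ω x (⋃ k ∈ Finset.range n, {X | X n ⬝ᵥ u + L ≤ X k ⬝ᵥ u}) := by
        refine measure_mono ?_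
        rintro X ⟨k, hk, h⟩
        exact Set.mem_biUnion (Finset.mem_coe.2 (Finset.mem_range.2 hk)) h
    _ ≤ ∑ k ∈ Finset.range n, quenched ω x {X | X n ⬝ᵥ u + L ≤ X k ⬝ᵥ u} :=
        measure_biUnion_finset_le _ _
    _ ≤ ∑ k ∈ Finset.range n,
          ENNReal.ofReal (Real.exp (-s * L) * Real.exp (-c * ((n - 1 - k : ℕ) : ℝ))) :=
        Finset.sum_le_sum fun k hk => h1 k (Finset.mem_range.1 hk)
    _ = ∑ k ∈ Finset.range n, ENNReal.ofReal (Real.exp (-s * L) * Real.exp (-c * (k : ℝ))) :=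
        Finset.sum_range_reflect
          (fun k : ℕ => ENNReal.ofReal (Real.exp (-s * L) * Real.exp (-c * (k : ℝ)))) n
    _ ≤ ∑' k : ℕ, ENNReal.ofReal (Real.exp (-s * L) * Real.exp (-c * (k : ℝ))) :=
        ENNReal.sum_le_tsum _
    _ = _ := by
        rw [tsum_ofReal_exp (Real.exp_pos _).le hc, div_eq_mul_one_div, mul_comm]

end StepBounds

/-- Seen from the walk at time `n`, the environment at levels `≥ L` is almost independent of the
environment below and distributed as at time `0`: unless the walk has been more than `L` levels
ahead, it has not yet looked at those sites. -/
theorem lintegral_envLaw_le_splice {P : Measure (Env d)} (hP : IsIIDEnv P) {u : Site d}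
    {s c M κ : ℝ} (H : ∀ᵐ ω ∂P, StepBounds u s c M κ ω) (L : ℤ) (n : ℕ) {f : Env d → ℝ≥0∞}
    (hf : Measurable f) (hf1 : ∀ ω, f ω ≤ 1) :
    ∫⁻ ω, f ω ∂(envLaw P n) ≤ ∫⁻ ω, ∫⁻ ω', f (splice u L ω ω') ∂P ∂(envLaw P n) +
      ENNReal.ofReal (1 / (1 - Real.exp (-c)) * Real.exp (-s * L)) := by
  have := hP.isProbabilityMeasure
  let V : Set (Path d) := {X | ∀ k < n, X k ⬝ᵥ u < X n ⬝ᵥ u + L}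
  have hVdep : DependsUpTo n fun X : Path d => X ∈ V := fun X Y h => by
    simp only [V, Set.mem_ofPred_eq, h n le_rfl, eq_iff_iff]
    exact forall₂_congr fun k hk => by rw [h k hk.le]
  have hV := hVdep.measurableSet
  set g : Env d → ℝ≥0∞ := fun ω => ∫⁻ ω', f (splice u L ω ω') ∂P with hg
  have hgm : Measurable g := (hf.comp (measurable_splice u L)).lintegral_prod_right'
  -- the probability of being at `z` at time `n` without having looked beyond level `z·u + L`
  let w : Site d → Env d → ℝ≥0∞ := fun z ω =>
    ∫⁻ X, {X : Path d | X n = z}.indicator (V.indicator 1) X ∂(quenched ω 0)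
  have hwdep : ∀ z, DependsUpTo n fun X : Path d =>
      {X : Path d | X n = z}.indicator (V.indicator (1 : Path d → ℝ≥0∞)) X := fun z =>
    DependsUpTo.indicator (fun X Y h => by simp only [Set.mem_ofPred_eq, h n le_rfl])
      (hVdep.indicator fun _ _ _ => rfl)
  have hwm : ∀ z, Measurable (w z) := fun z =>
    measurable_lintegral_quenched measurable_id 0 n (fun _ => hwdep z) fun X => measurable_const
  have hsplit : ∀ {h : Env d → ℝ≥0∞} (_ : Measurable h),
      ∫⁻ ω, ∫⁻ X, V.indicator (fun X => h (shiftEnv (X n) ω)) X ∂(quenched ω 0) ∂P =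
        ∑' z, ∫⁻ ω, w z ω * h (shiftEnv z ω) ∂P := by
    intro h hh
    have hm : ∀ z, Measurable fun ω => w z ω * h (shiftEnv z ω) := fun z =>
      (hwm z).mul (hh.comp (measurable_shiftEnv z))
    rw [← lintegral_tsum fun z => (hm z).aemeasurable]
    refine lintegral_congr fun ω => ?_
    refine (lintegral_eq_tsum_position n
      (Φ := fun z X => V.indicator (fun _ => h (shiftEnv z ω)) X)
      (fun z => measurable_const.indicator hV)).trans (tsum_congr fun z => ?_)
    rw [← lintegral_mul_const _ (hwdep z).measurable]
    refine lintegral_congr fun X => ?_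
    simp only [Set.indicator_apply, Pi.one_apply]
    split_ifs <;> simp
  have hkey : ∀ z, ∫⁻ ω, w z ω * f (shiftEnv z ω) ∂P = ∫⁻ ω, w z ω * g (shiftEnv z ω) ∂P := by
    intro z
    have hm : Measurable fun ω => w z ω * f (shiftEnv z ω) :=
      (hwm z).mul (hf.comp (measurable_shiftEnv z))
    rw [← hP.lintegral_splice u (L + z ⬝ᵥ u) hm]
    refine lintegral_congr fun ω => ?_
    have h1 : ∀ ω', w z (splice u (L + z ⬝ᵥ u) ω ω') = w z ω := by
      intro ω'
      refine lintegral_quenched_congr (D := {x | x ⬝ᵥ u < L + z ⬝ᵥ u}) (fun x hx => ?_) 0 n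
        (hwdep z) fun X hX i hi => ?_
      · exact if_pos hx
      · have h2 := Set.mem_of_indicator_ne_zero hX
        rw [Set.indicator_of_mem h2] at hX
        have h3 := Set.mem_of_indicator_ne_zero hX i hi
        have h2 : X n = z := h2
        rw [h2] at h3
        change X i ⬝ᵥ u < L + z ⬝ᵥ u
        linarith
    simp_rw [h1, shiftEnv_splice]
    have h2 : Measurable fun ω' => f (splice u L (shiftEnv z ω) ω') :=
      (hf.comp (measurable_splice u L)).comp measurable_prodMk_left
    have h3 : Measurable fun ω' => f (splice u L (shiftEnv z ω) (shiftEnv z ω')) :=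
      h2.comp (measurable_shiftEnv z)
    rw [lintegral_const_mul _ h3, hg]
    congr 1
    exact hP.lintegral_shiftEnv z h2
  rw [lintegral_envLaw P n hf, lintegral_envLaw P n hgm]
  calc _ ≤ ∫⁻ ω, (∫⁻ X, V.indicator (fun X => f (shiftEnv (X n) ω)) X ∂(quenched ω 0) +
          ENNReal.ofReal (1 / (1 - Real.exp (-c)) * Real.exp (-s * L))) ∂P := by
        refine lintegral_mono_ae ?_
        filter_upwards [H] with ω Hω
        have hVc : quenched ω 0 Vᶜ ≤
            ENNReal.ofReal (1 / (1 - Real.exp (-c)) * Real.exp (-s * L)) := by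
          refine le_trans (measure_mono fun X hX => ?_) (Hω.ahead_le 0 L n)
          simp only [V, Set.mem_compl_iff, Set.mem_ofPred_eq, not_forall, not_lt] at hX
          obtain ⟨k, hk, h⟩ := hX
          exact ⟨k, hk, h⟩
        refine le_trans ?_ (add_le_add_right hVc _)
        rw [← lintegral_indicator_one hV.compl,
          ← lintegral_add_right _ (measurable_one.indicator hV.compl)]
        refine lintegral_mono fun X => ?_
        by_cases hX : X ∈ V
        · rw [Set.indicator_of_mem hX]; exact le_self_add
        · rw [Set.indicator_of_notMem hX, Set.indicator_of_mem (Set.mem_compl hX), zero_add]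
          exact hf1 _
    _ = ∫⁻ ω, ∫⁻ X, V.indicator (fun X => g (shiftEnv (X n) ω)) X ∂(quenched ω 0) ∂P +
          ENNReal.ofReal (1 / (1 - Real.exp (-c)) * Real.exp (-s * L)) := by
        rw [lintegral_add_right _ measurable_const, hsplit hf, hsplit hgm]
        simp_rw [hkey]
        simp
    _ ≤ _ := by
        gcongr with ω
        exact lintegral_mono (Set.indicator_le_self _ _)

/-! ### Compactness of the set of good environments -/

theorem summable_prod_pi {f : ℤ → ℝ} (hf0 : 0 ≤ f) (hf : Summable f) (d : ℕ) :
    Summable fun z : Fin d → ℤ => ∏ i, f (z i) := by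
  induction d with
  | zero => exact Summable.of_finite
  | succ d ih =>
    rw [← (Fin.consEquiv fun _ : Fin (d + 1) => ℤ).summable_iff]
    refine (hf.mul_of_nonneg ih hf0 fun z => Finset.prod_nonneg fun i _ => hf0 _).congr fun q => ?_
    simp [Fin.prod_univ_succ, Fin.consEquiv]

theorem summable_exp_neg_abs {t : ℝ} (ht : 0 < t) :
    Summable fun k : ℤ => Real.exp (-t * |(k : ℝ)|) := by
  have h : Summable fun n : ℕ => Real.exp (-t * (n : ℝ)) := by
    refine (summable_geometric_of_lt_one (Real.exp_pos (-t)).le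
      (Real.exp_lt_one_iff.2 (neg_lt_zero.2 ht))).congr fun n => ?_
    rw [← Real.exp_nat_mul, mul_comm]
  refine Summable.of_nat_of_neg (h.congr fun n => ?_) (h.congr fun n => ?_) <;> simp

theorem abs_apply_le_len (z : Site d) (i : Fin d) : |(z i : ℝ)| ≤ len z :=
  PiLp.norm_apply_le (WithLp.toLp 2 fun i => (z i : ℝ)) i

theorem summable_exp_neg_len {s : ℝ} (hs : 0 < s) :
    Summable fun z : Site d => Real.exp (-s * len z) := by
  have hd : (0 : ℝ) < d + 1 := by positivity
  refine Summable.of_nonneg_of_le (fun z => (Real.exp_pos _).le) (fun z => ?_)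
    (summable_prod_pi (fun _ => (Real.exp_pos _).le)
      (summable_exp_neg_abs (t := s / (d + 1)) (by positivity)) d)
  rw [← Real.exp_sum, Real.exp_le_exp, ← Finset.mul_sum]
  have h : ∑ i, |(z i : ℝ)| ≤ (d + 1) * len z := by
    calc _ ≤ ∑ _i : Fin d, len z := Finset.sum_le_sum fun i _ => abs_apply_le_len z i
      _ = d * len z := by simp
      _ ≤ _ := by nlinarith [len_nonneg z]
  have : s / (d + 1) * ∑ i, |(z i : ℝ)| ≤ s * len z :=
    calc _ ≤ s / (d + 1) * ((d + 1) * len z) := by gcongr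
      _ = _ := by field_simp
  linarith

/-- The step laws with drift at least `δ` and the exponential moment bound. -/
def goodLaws (u : Site d) (δ M s₀ : ℝ) : Set (StepLaw d) :=
  {p | DriftGE u δ p ∧ ExpMomentLE s₀ M p}

theorem expMomentLE_iff (s M : ℝ) (p : StepLaw d) : ExpMomentLE s M p ↔
    ∀ F : Finset (Site d), ∑ z ∈ F, Real.exp (s * len z) * p.1 z ≤ Real.exp (s * M) := by
  unfold ExpMomentLE
  have h0 : ∀ z, 0 ≤ Real.exp (s * len z) * p.1 z := fun z =>
    mul_nonneg (Real.exp_pos _).le (p.2.1 z)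
  rw [ENNReal.tsum_eq_iSup_sum, iSup_le_iff]
  refine forall_congr' fun F => ?_
  rw [← ENNReal.ofReal_sum_of_nonneg fun z _ => h0 z,
    ENNReal.ofReal_le_ofReal_iff (Real.exp_pos _).le]

/-- The moment bound gives the pointwise bound `p_z ≤ e^{s₀(M-|z|)}`, which dominates the series
for the total mass and for the drift; so both are continuous on the class. -/
theorem isCompact_goodLaws (u : Site d) (δ M : ℝ) {s₀ : ℝ} (hs₀ : 0 < s₀) :
    IsCompact (goodLaws u δ M s₀) := by
  set b : Site d → ℝ := fun z => Real.exp (s₀ * M) * Real.exp (-s₀ * len z) with hb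
  have hb0 : ∀ z, 0 ≤ b z := fun z => by positivity
  let K : Set (Site d → ℝ) := Set.pi Set.univ fun z => Set.Icc 0 (b z)
  have hK : IsCompact K := isCompact_univ_pi fun z => isCompact_Icc
  have hbs : Summable b := (summable_exp_neg_len hs₀).mul_left _
  have hmem : ∀ {q}, q ∈ K → ∀ z, 0 ≤ q z ∧ q z ≤ b z := fun hq z => hq z (Set.mem_univ z)
  have hsum : ∀ q ∈ K, Summable q := fun q hq =>
    Summable.of_nonneg_of_le (fun z => (hmem hq z).1) (fun z => (hmem hq z).2) hbs
  have hmass : ContinuousOn (fun q : Site d → ℝ => ∑' z, q z) K :=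
    continuousOn_tsum (fun z => (continuous_apply z).continuousOn) hbs fun z q hq => by
      rw [Real.norm_eq_abs, abs_of_nonneg (hmem hq z).1]; exact (hmem hq z).2
  have hdrift : ContinuousOn
      (fun q : Site d → ℝ => ∑' z : Site d, ((z ⬝ᵥ u : ℤ) : ℝ) * q z) K := by
    refine continuousOn_tsum (u := fun z => len u * (2 / s₀) * Real.exp (s₀ * M) *
      Real.exp (-(s₀ / 2) * len z)) (fun z => (continuous_const.mul (continuous_apply z)).continuousOn)
      ((summable_exp_neg_len (half_pos hs₀)).mul_left _) fun z q hq => ?_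
    rw [norm_mul, Real.norm_eq_abs, Real.norm_eq_abs, abs_of_nonneg (hmem hq z).1]
    have h1 := abs_dotProduct_le z u
    have h2 : len z ≤ 2 / s₀ * Real.exp (s₀ / 2 * len z) := by
      have := Real.add_one_le_exp (s₀ / 2 * len z)
      calc len z = 2 / s₀ * (s₀ / 2 * len z) := by field_simp
        _ ≤ _ := by gcongr; linarith
    calc _ ≤ (len u * (2 / s₀ * Real.exp (s₀ / 2 * len z))) * b z := by
          refine mul_le_mul (h1.trans ?_) (hmem hq z).2 (hmem hq z).1 ?_
          · exact mul_le_mul_of_nonneg_left h2 (len_nonneg u)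
          · have := len_nonneg u; positivity
      _ = len u * (2 / s₀) * Real.exp (s₀ * M) *
            (Real.exp (s₀ / 2 * len z) * Real.exp (-s₀ * len z)) := by rw [hb]; ring
      _ = _ := by rw [← Real.exp_add]; congr 2; ring
  have hC1 : IsClosed (K ∩ (fun q : Site d → ℝ => ∑' z, q z) ⁻¹' {1}) :=
    hmass.preimage_isClosed_of_isClosed hK.isClosed isClosed_singleton
  have hC2 : IsClosed (K ∩ (fun q : Site d → ℝ =>
      ∑' z : Site d, ((z ⬝ᵥ u : ℤ) : ℝ) * q z) ⁻¹' Set.Ici δ) :=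
    hdrift.preimage_isClosed_of_isClosed hK.isClosed isClosed_Ici
  have hC3 : IsClosed (⋂ F : Finset (Site d), {q : Site d → ℝ |
      ∑ z ∈ F, Real.exp (s₀ * len z) * q z ≤ Real.exp (s₀ * M)}) :=
    isClosed_iInter fun F => isClosed_le
      (continuous_finsetSum _ fun z _ => continuous_const.mul (continuous_apply z))
      continuous_const
  rw [Subtype.isCompact_iff]
  have himg : Subtype.val '' goodLaws u δ M s₀ =
      K ∩ (((K ∩ (fun q : Site d → ℝ => ∑' z, q z) ⁻¹' {1}) ∩ (K ∩ (fun q : Site d → ℝ =>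
      ∑' z : Site d, ((z ⬝ᵥ u : ℤ) : ℝ) * q z) ⁻¹' Set.Ici δ)) ∩
      ⋂ F : Finset (Site d), {q : Site d → ℝ |
        ∑ z ∈ F, Real.exp (s₀ * len z) * q z ≤ Real.exp (s₀ * M)}) := by
    ext q
    constructor
    · rintro ⟨p, ⟨h1, h2⟩, rfl⟩
      rw [expMomentLE_iff] at h2
      have hpK : p.1 ∈ K := fun z _ => by
        refine ⟨p.2.1 z, ?_⟩
        have h := h2 {z}
        rw [Finset.sum_singleton] at h
        calc p.1 z = Real.exp (-s₀ * len z) * (Real.exp (s₀ * len z) * p.1 z) := by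
              rw [← mul_assoc, ← Real.exp_add]; simp
          _ ≤ Real.exp (-s₀ * len z) * Real.exp (s₀ * M) := by gcongr
          _ = b z := mul_comm _ _
      exact ⟨hpK, ⟨⟨hpK, p.2.2.tsum_eq⟩, hpK, h1⟩, Set.mem_iInter.2 h2⟩
    · rintro ⟨hq, ⟨⟨-, h1⟩, -, h2⟩, h3⟩
      have h1 : ∑' z, q z = 1 := h1
      refine ⟨⟨q, fun z => (hmem hq z).1, h1 ▸ (hsum q hq).hasSum⟩, ⟨h2, ?_⟩, rfl⟩
      rw [expMomentLE_iff]
      exact fun F => Set.mem_iInter.1 h3 F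
  rw [himg]
  exact hK.inter_right ((hC1.inter hC2).inter hC3)

theorem setOf_goodEnv (u : Site d) (δ M s₀ : ℝ) :
    {ω : Env d | GoodEnv u δ M s₀ ω} = Set.pi Set.univ fun _ => goodLaws u δ M s₀ := by
  ext ω
  exact ⟨fun h x _ => h x, fun h x => h x (Set.mem_univ x)⟩

theorem isCompact_goodEnv (u : Site d) (δ M : ℝ) {s₀ : ℝ} (hs₀ : 0 < s₀) :
    IsCompact {ω : Env d | GoodEnv u δ M s₀ ω} := by
  rw [setOf_goodEnv]
  exact isCompact_univ_pi fun _ => isCompact_goodLaws u δ M hs₀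

/-! ### Comparison of measures through continuous functions -/

/-- If integrals of bounded continuous functions with values in `[0,1]` compare up to `ε`, so do
the measures of all measurable sets. -/
theorem measure_le_add_of_forall_lintegral_le {Ω : Type*} [MeasurableSpace Ω] [TopologicalSpace Ω]
    [TopologicalSpace.PseudoMetrizableSpace Ω] [BorelSpace Ω] {μ ν : Measure Ω}
    [IsFiniteMeasure μ] [IsFiniteMeasure ν] {ε : ℝ≥0∞}
    (h : ∀ f : BoundedContinuousFunction Ω NNReal, (∀ ω, f ω ≤ 1) →
      ∫⁻ ω, f ω ∂μ ≤ ∫⁻ ω, f ω ∂ν + ε) {B : Set Ω} (hB : MeasurableSet B) : μ B ≤ ν B + ε := by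
  have hclosed : ∀ F : Set Ω, IsClosed F → μ F ≤ ν F + ε := fun F hF => by
    refine le_of_tendsto_of_tendsto' (HasOuterApproxClosed.tendsto_lintegral_apprSeq hF μ)
      ((HasOuterApproxClosed.tendsto_lintegral_apprSeq hF ν).add_const ε) fun n => ?_
    exact h _ fun ω => HasOuterApproxClosed.apprSeq_apply_le_one hF n ω
  refine ENNReal.le_of_forall_pos_le_add fun r hr _ => ?_
  obtain ⟨F, hFB, hF, hlt⟩ :=
    hB.exists_isClosed_lt_add (measure_ne_top μ B) (ENNReal.coe_pos.2 hr).ne'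
  calc μ B ≤ μ F + r := hlt.le
    _ ≤ ν F + ε + r := by gcongr; exact hclosed F hF
    _ ≤ ν B + ε + r := by gcongr

/-- A bound for the measures of sets extends to functions with values in `[0,1]`, by the layer cake
formula. -/
theorem lintegral_le_add_of_forall_measure_le {Ω : Type*} [MeasurableSpace Ω] {μ ν : Measure Ω}
    {ε : ℝ≥0∞} (h : ∀ B : Set Ω, MeasurableSet B → μ B ≤ ν B + ε) {f : Ω → ℝ≥0∞}
    (hf : Measurable f) (hf1 : ∀ ω, f ω ≤ 1) : ∫⁻ ω, f ω ∂μ ≤ ∫⁻ ω, f ω ∂ν + ε := by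
  have hft : ∀ ω, f ω ≠ ∞ := fun ω => ((hf1 ω).trans_lt ENNReal.one_lt_top).ne
  have hg : Measurable fun ω => (f ω).toReal := hf.ennreal_toReal
  have key : ∀ ρ : Measure Ω,
      ∫⁻ ω, f ω ∂ρ = ∫⁻ t in Set.Ioo (0 : ℝ) 1, ρ {ω | t < (f ω).toReal} := by
    intro ρ
    have h1 := lintegral_eq_lintegral_meas_lt ρ
      (Filter.Eventually.of_forall fun ω => (ENNReal.toReal_nonneg : 0 ≤ (f ω).toReal))
      hg.aemeasurable
    simp only [ENNReal.ofReal_toReal (hft _)] at h1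
    rw [h1, ← Set.Ioo_union_Ici_eq_Ioi zero_lt_one, lintegral_union measurableSet_Ici]
    · rw [setLIntegral_congr_fun (g := fun _ => 0) measurableSet_Ici, lintegral_zero, add_zero]
      intro t ht
      have : {ω | t < (f ω).toReal} = ∅ := by
        ext ω
        have h2 : (f ω).toReal ≤ 1 := ENNReal.toReal_le_of_le_ofReal zero_le_one (by simpa using hf1 ω)
        have ht : (1 : ℝ) ≤ t := ht
        simp only [Set.mem_ofPred_eq, Set.mem_empty_iff_false, iff_false, not_lt]
        linarith
      simp only [this, measure_empty]
    · exact Set.disjoint_left.2 fun t ht ht' => absurd ht.2 (not_lt.2 ht')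
  rw [key μ, key ν]
  calc _ ≤ ∫⁻ t in Set.Ioo (0 : ℝ) 1, (ν {ω | t < (f ω).toReal} + ε) :=
        lintegral_mono fun t => h _ (measurableSet_lt measurable_const hg)
    _ = _ := by
        rw [lintegral_add_right _ measurable_const]
        simp

theorem measure_le_add_symm {Ω : Type*} [MeasurableSpace Ω] {μ ν : Measure Ω}
    [IsProbabilityMeasure μ] [IsProbabilityMeasure ν] {ε : ℝ≥0∞}
    (h : ∀ B : Set Ω, MeasurableSet B → μ B ≤ ν B + ε) (B : Set Ω) (hB : MeasurableSet B) :
    ν B ≤ μ B + ε := by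
  have h1 := h Bᶜ hB.compl
  rw [prob_compl_eq_one_sub hB, prob_compl_eq_one_sub hB, tsub_le_iff_right] at h1
  have h2 : ν B + 1 ≤ ν B + (1 - ν B + ε + μ B) := by gcongr
  have h3 : ν B + (1 - ν B + ε + μ B) = 1 + (μ B + ε) := by
    rw [← add_assoc, ← add_assoc, add_tsub_cancel_of_le prob_le_one]; ring
  rw [h3, add_comm] at h2
  exact (ENNReal.add_le_add_iff_left ENNReal.one_ne_top).1 h2

/-! ### The invariant measure as a limit of averages -/

/-- The average of the laws of the environment process at the times `0, …, n`. -/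
noncomputable def avgLaw (μ : Measure (Env d)) (n : ℕ) : Measure (Env d) :=
  ((n : ℝ≥0∞) + 1)⁻¹ • ∑ k ∈ Finset.range (n + 1), envLaw μ k

theorem lintegral_avgLaw (μ : Measure (Env d)) (n : ℕ) (f : Env d → ℝ≥0∞) :
    ∫⁻ ω, f ω ∂(avgLaw μ n) =
      ((n : ℝ≥0∞) + 1)⁻¹ * ∑ k ∈ Finset.range (n + 1), ∫⁻ ω, f ω ∂(envLaw μ k) := by
  rw [avgLaw, lintegral_smul_measure, lintegral_finsetSum_measure, smul_eq_mul]

theorem natCast_add_one_inv_mul_cancel (n : ℕ) : ((n : ℝ≥0∞) + 1)⁻¹ * (n + 1) = 1 :=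
  ENNReal.inv_mul_cancel (by simp) (by simp)

instance isProbabilityMeasure_avgLaw (μ : Measure (Env d)) [IsProbabilityMeasure μ] (n : ℕ) :
    IsProbabilityMeasure (avgLaw μ n) := by
  constructor
  have h := lintegral_avgLaw μ n fun _ => 1
  simp only [lintegral_one, measure_univ, Finset.sum_const, Finset.card_range, nsmul_eq_mul,
    mul_one, Nat.cast_add, Nat.cast_one, natCast_add_one_inv_mul_cancel] at h
  exact h

theorem lintegral_avgLaw_le_add {μ : Measure (Env d)} {f g : Env d → ℝ≥0∞} {ε : ℝ≥0∞}
    (h : ∀ k, ∫⁻ ω, f ω ∂(envLaw μ k) ≤ ∫⁻ ω, g ω ∂(envLaw μ k) + ε) (n : ℕ) :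
    ∫⁻ ω, f ω ∂(avgLaw μ n) ≤ ∫⁻ ω, g ω ∂(avgLaw μ n) + ε := by
  rw [lintegral_avgLaw, lintegral_avgLaw]
  calc _ ≤ ((n : ℝ≥0∞) + 1)⁻¹ *
        ∑ k ∈ Finset.range (n + 1), (∫⁻ ω, g ω ∂(envLaw μ k) + ε) := by
        gcongr with k; exact h k
    _ = _ := by
        rw [Finset.sum_add_distrib, mul_add, Finset.sum_const, Finset.card_range, nsmul_eq_mul,
          ← mul_assoc, Nat.cast_add, Nat.cast_one, natCast_add_one_inv_mul_cancel, one_mul]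

/-- The averages are invariant up to one boundary term. -/
theorem lintegral_envOp_one_avgLaw_le {μ : Measure (Env d)} [IsProbabilityMeasure μ]
    {f : Env d → ℝ≥0∞} (hf : Measurable f) (hf1 : ∀ ω, f ω ≤ 1) (n : ℕ) :
    ∫⁻ ω, envOp 1 f ω ∂(avgLaw μ n) ≤ ∫⁻ ω, f ω ∂(avgLaw μ n) + ((n : ℝ≥0∞) + 1)⁻¹ := by
  rw [lintegral_avgLaw, lintegral_avgLaw]
  simp_rw [← lintegral_envLaw_succ μ _ hf]
  have h1 : ∫⁻ ω, f ω ∂(envLaw μ (n + 1)) ≤ 1 :=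
    (lintegral_mono hf1).trans (by simp)
  have h2 := Finset.sum_range_succ' (fun k => ∫⁻ ω, f ω ∂(envLaw μ k)) (n + 1)
  rw [Finset.sum_range_succ] at h2
  calc _ ≤ ((n : ℝ≥0∞) + 1)⁻¹ * (∑ k ∈ Finset.range (n + 1), ∫⁻ ω, f ω ∂(envLaw μ k) + 1) := by
        gcongr
        refine le_trans (le_self_add (b := ∫⁻ ω, f ω ∂(envLaw μ 0))) ?_
        rw [← h2]
        gcongr
    _ = _ := by rw [mul_add, mul_one]

instance borelSpace_stepLaw : BorelSpace (StepLaw d) :=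
  Subtype.borelSpace {p : Site d → ℝ | (∀ z, 0 ≤ p z) ∧ HasSum p 1}

instance secondCountableTopology_stepLaw : SecondCountableTopology (StepLaw d) :=
  TopologicalSpace.Subtype.secondCountableTopology {p : Site d → ℝ | (∀ z, 0 ≤ p z) ∧ HasSum p 1}

/-- The averages as elements of the space of probability measures with its weak topology. -/
noncomputable def avgProb (μ : Measure (Env d)) [IsProbabilityMeasure μ] (n : ℕ) :
    ProbabilityMeasure (Env d) := ⟨avgLaw μ n, inferInstance⟩

theorem GoodEnv.shift {u : Site d} {δ M s₀ : ℝ} {ω : Env d} (h : GoodEnv u δ M s₀ ω) (z : Site d) :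
    GoodEnv u δ M s₀ (shiftEnv z ω) := fun x => h (x + z)

theorem measurableSet_goodEnv (u : Site d) (δ M : ℝ) {s₀ : ℝ} (hs₀ : 0 < s₀) :
    MeasurableSet {ω : Env d | GoodEnv u δ M s₀ ω} :=
  (isCompact_goodEnv u δ M hs₀).isClosed.measurableSet

theorem envLaw_compl_goodEnv {P : Measure (Env d)} {u : Site d} {δ M s₀ : ℝ} (hs₀ : 0 < s₀)
    (h : ∀ᵐ ω ∂P, GoodEnv u δ M s₀ ω) (n : ℕ) :
    envLaw P n {ω | GoodEnv u δ M s₀ ω}ᶜ = 0 := by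
  have hm := (measurableSet_goodEnv u δ M hs₀).compl
  rw [← lintegral_indicator_one hm, lintegral_envLaw P n (measurable_one.indicator hm),
    lintegral_eq_zero_iff (measurable_envOp n (measurable_one.indicator hm))]
  filter_upwards [h] with ω hω
  have : ∀ X : Path d, ({ω | GoodEnv u δ M s₀ ω}ᶜ : Set (Env d)).indicator (1 : Env d → ℝ≥0∞)
      (shiftEnv (X n) ω) = 0 := fun X =>
    Set.indicator_of_notMem (Set.notMem_compl_iff.2 (hω.shift (X n))) _
  simp [envOp, this]

theorem avgLaw_compl_goodEnv {P : Measure (Env d)} {u : Site d} {δ M s₀ : ℝ} (hs₀ : 0 < s₀)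
    (h : ∀ᵐ ω ∂P, GoodEnv u δ M s₀ ω) (n : ℕ) :
    avgLaw P n {ω | GoodEnv u δ M s₀ ω}ᶜ = 0 := by
  simp [avgLaw, Measure.finsetSum_apply, envLaw_compl_goodEnv hs₀ h]

open Filter Topology in
/-- By Prokhorov's theorem, applied with the single compact set of good environments, the averages
have a limit point. -/
theorem exists_tendsto_avgLaw {P : Measure (Env d)} [IsProbabilityMeasure P] {u : Site d}
    {δ M s₀ : ℝ} (hs₀ : 0 < s₀) (h : ∀ᵐ ω ∂P, GoodEnv u δ M s₀ ω) :
    ∃ (μ : ProbabilityMeasure (Env d)) (U : Ultrafilter ℕ), (U : Filter ℕ) ≤ atTop ∧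
      (∀ᵐ ω ∂(μ : Measure (Env d)), GoodEnv u δ M s₀ ω) ∧
      Tendsto (avgProb P) U (𝓝 μ) := by
  have hK := isCompact_setOfPred_probabilityMeasure_mass_eq_compl_isCompact_le
    (u := fun _ => 0) (K := fun _ : ℕ => {ω : Env d | GoodEnv u δ M s₀ ω}) tendsto_const_nhds
    (fun _ => isCompact_goodEnv u δ M hs₀) (Or.inr monotone_const)
  obtain ⟨μ, hμ, hcl⟩ := hK.exists_mapClusterPt (f := atTop)
    (u := avgProb P) (by
      refine le_principal_iff.2 (Filter.mem_map.2 (Filter.Eventually.of_forall fun n _ => ?_))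
      rw [← ENNReal.coe_le_coe, ProbabilityMeasure.ennreal_coeFn_eq_coeFn_toMeasure]
      exact (avgLaw_compl_goodEnv hs₀ h n).le)
  obtain ⟨U, hU, hlim⟩ := mapClusterPt_iff_ultrafilter.1 hcl
  refine ⟨μ, U, hU, ?_, hlim⟩
  have h0 := hμ 0
  rw [← ENNReal.coe_le_coe, ProbabilityMeasure.ennreal_coeFn_eq_coeFn_toMeasure] at h0
  exact le_antisymm (by simpa using h0) zero_le

open Filter Topology in
theorem tendsto_lintegral_of_continuous {Ω ι : Type*} [MeasurableSpace Ω] [TopologicalSpace Ω]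
    [OpensMeasurableSpace Ω] {ν : ι → ProbabilityMeasure Ω} {μ : ProbabilityMeasure Ω}
    {l : Filter ι} (h : Tendsto ν l (𝓝 μ)) {f : Ω → ℝ≥0∞} (hf : Continuous f)
    (hf1 : ∀ ω, f ω ≤ 1) :
    Tendsto (fun i => ∫⁻ ω, f ω ∂(ν i : Measure Ω)) l (𝓝 (∫⁻ ω, f ω ∂(μ : Measure Ω))) := by
  have hft : ∀ ω, f ω ≠ ∞ := fun ω => ((hf1 ω).trans_lt ENNReal.one_lt_top).ne
  have hc : Continuous fun ω => (f ω).toNNReal :=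
    ENNReal.continuousOn_toNNReal.comp_continuous hf hft
  have hle : ∀ ω, (f ω).toNNReal ≤ 1 := fun ω => by
    rw [← ENNReal.coe_le_coe, ENNReal.coe_toNNReal (hft ω)]; exact hf1 ω
  let g : BoundedContinuousFunction Ω NNReal :=
    BoundedContinuousFunction.mkOfBound ⟨fun ω => (f ω).toNNReal, hc⟩ 1 fun x y => by
      rw [NNReal.dist_eq, abs_le]
      have h1 : (((f x).toNNReal : NNReal) : ℝ) ≤ 1 := hle x
      have h2 : (((f y).toNNReal : NNReal) : ℝ) ≤ 1 := hle y
      have h3 := ((f x).toNNReal).2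
      have h4 := ((f y).toNNReal).2
      constructor <;> simp only [ContinuousMap.coe_mk] <;> linarith
  have hg : ∀ ω, ((g ω : NNReal) : ℝ≥0∞) = f ω := fun ω => ENNReal.coe_toNNReal (hft ω)
  have := ProbabilityMeasure.tendsto_iff_forall_lintegral_tendsto.1 h g
  simpa only [hg] using this

open Filter Topology in
theorem continuous_lintegral_splice (P : Measure (Env d)) [IsProbabilityMeasure P] (u : Site d)
    (L : ℤ) {f : Env d → ℝ≥0∞} (hf : Continuous f) (hf1 : ∀ ω, f ω ≤ 1) :
    Continuous fun ω => ∫⁻ ω', f (splice u L ω ω') ∂P := by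
  refine continuous_iff_continuousAt.2 fun ω => ?_
  refine tendsto_lintegral_filter_of_dominated_convergence (fun _ => 1)
    (Eventually.of_forall fun ω₁ => ?_)
    (Eventually.of_forall fun ω₁ => Eventually.of_forall fun ω' => hf1 _) (by simp)
    (Eventually.of_forall fun ω' => ?_)
  · exact (hf.measurable.comp (measurable_splice u L)).comp measurable_prodMk_left
  · exact (hf.comp (continuous_splice u L ω')).continuousAt

/-- The law of the environment that is distributed as `μ` below level `L` and, independently, as
`P` from level `L` on. -/
noncomputable def spliceLaw (u : Site d) (L : ℤ) (μ P : Measure (Env d)) : Measure (Env d) :=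
  (μ.prod P).map fun q => splice u L q.1 q.2

instance isProbabilityMeasure_spliceLaw (u : Site d) (L : ℤ) (μ P : Measure (Env d))
    [IsProbabilityMeasure μ] [IsProbabilityMeasure P] :
    IsProbabilityMeasure (spliceLaw u L μ P) :=
  Measure.isProbabilityMeasure_map (measurable_splice u L).aemeasurable

theorem lintegral_spliceLaw (u : Site d) (L : ℤ) (μ P : Measure (Env d)) [SFinite μ] [SFinite P]
    {f : Env d → ℝ≥0∞} (hf : Measurable f) :
    ∫⁻ ω, f ω ∂(spliceLaw u L μ P) = ∫⁻ ω, ∫⁻ ω', f (splice u L ω ω') ∂P ∂μ := by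
  have hm : Measurable fun q : Env d × Env d => f (splice u L q.1 q.2) :=
    hf.comp (measurable_splice u L)
  rw [spliceLaw, lintegral_map hf (measurable_splice u L), lintegral_prod _ hm.aemeasurable]

instance isMarkovKernel_envKernel : IsMarkovKernel (envKernel d) :=
  ⟨fun ω => Measure.isProbabilityMeasure_map ((measurable_of_countable fun z =>
    shiftEnv z ω).comp (measurable_pi_apply 1)).aemeasurable⟩

section limit

open Filter Topology

variable {P : Measure (Env d)} [IsProbabilityMeasure P] {μ : ProbabilityMeasure (Env d)}
  {U : Ultrafilter ℕ}

/-- The splice inequality for the averages passes to their weak limit, since splicing with a fresh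
environment maps continuous functions to continuous functions. -/
theorem measure_le_spliceLaw_add (hlim : Tendsto (avgProb P) U (𝓝 μ)) (hP : IsIIDEnv P)
    {u : Site d} {s c M κ : ℝ} (H : ∀ᵐ ω ∂P, StepBounds u s c M κ ω) (L : ℤ) {B : Set (Env d)}
    (hB : MeasurableSet B) : (μ : Measure (Env d)) B ≤ spliceLaw u L μ P B +
      ENNReal.ofReal (1 / (1 - Real.exp (-c)) * Real.exp (-s * L)) := by
  refine measure_le_add_of_forall_lintegral_le (fun g hg => ?_) hB
  set f : Env d → ℝ≥0∞ := fun ω => g ω with hfdef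
  have hf : Continuous f := ENNReal.continuous_coe.comp g.continuous
  have hf1 : ∀ ω, f ω ≤ 1 := fun ω => ENNReal.coe_le_one_iff.2 (hg ω)
  rw [lintegral_spliceLaw u L _ P hf.measurable]
  refine le_of_tendsto_of_tendsto' (tendsto_lintegral_of_continuous hlim hf hf1)
    ((tendsto_lintegral_of_continuous hlim (continuous_lintegral_splice P u L hf hf1)
      fun ω => ?_).add_const _) fun n => ?_
  · exact (lintegral_mono fun ω' => hf1 _).trans (by simp)
  · exact lintegral_avgLaw_le_add
      (fun k => lintegral_envLaw_le_splice hP H L k hf.measurable hf1) n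

/-- The averages are asymptotically invariant, and the jumps to any finite set of sites form a
continuous part of the transition kernel; hence the limit is invariant. -/
theorem invariant_of_tendsto_avgProb (hU : (U : Filter ℕ) ≤ atTop)
    (hlim : Tendsto (avgProb P) U (𝓝 μ)) : Kernel.Invariant (envKernel d) (μ : Measure (Env d)) := by
  have hle : ∀ g : BoundedContinuousFunction (Env d) NNReal, (∀ ω, g ω ≤ 1) →
      ∫⁻ ω, g ω ∂((μ : Measure (Env d)).bind (envKernel d)) ≤
        ∫⁻ ω, g ω ∂(μ : Measure (Env d)) + 0 := by
    intro g hg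
    set f : Env d → ℝ≥0∞ := fun ω => g ω with hfdef
    have hf : Continuous f := ENNReal.continuous_coe.comp g.continuous
    have hf1 : ∀ ω, f ω ≤ 1 := fun ω => ENNReal.coe_le_one_iff.2 (hg ω)
    have hterm : ∀ y : Site d, Continuous fun ω : Env d =>
        ENNReal.ofReal (transProb ω 0 y) * f (shiftEnv y ω) := by
      intro y
      have h1 : Continuous fun ω : Env d => transProb ω 0 y :=
        (continuous_apply (y - 0)).comp (continuous_subtype_val.comp (continuous_apply 0))
      have h2 : Continuous fun ω : Env d => shiftEnv y ω :=
        continuous_pi fun x => continuous_apply (x + y)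
      have h3 : Continuous fun ω : Env d => Real.toNNReal (transProb ω 0 y) * g (shiftEnv y ω) :=
        (continuous_real_toNNReal.comp h1).mul (g.continuous.comp h2)
      have h4 := ENNReal.continuous_coe.comp h3
      simpa only [Function.comp_def, ENNReal.coe_mul, hfdef, ENNReal.ofReal] using h4
    rw [add_zero, lintegral_bind_envKernel _ hf.measurable]
    simp_rw [envOp_one_eq_tsum]
    rw [lintegral_tsum fun y => (hterm y).measurable.aemeasurable]
    rw [ENNReal.tsum_eq_iSup_sum]
    refine iSup_le fun R => ?_
    rw [← lintegral_finsetSum _ fun y _ => (hterm y).measurable]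
    have hR1 : ∀ ω : Env d, ∑ y ∈ R, ENNReal.ofReal (transProb ω 0 y) * f (shiftEnv y ω) ≤
        envOp 1 f ω := fun ω => by
      rw [envOp_one_eq_tsum]; exact ENNReal.sum_le_tsum R
    have hop1 : ∀ ω : Env d, envOp 1 f ω ≤ 1 := fun ω =>
      (lintegral_mono fun _ => hf1 _).trans (by simp)
    have hinv : Tendsto (fun n : ℕ => ((n : ℝ≥0∞) + 1)⁻¹) U (𝓝 0) := by
      refine Tendsto.mono_left ?_ hU
      have := (tendsto_add_atTop_iff_nat 1).2 ENNReal.tendsto_inv_nat_nhds_zero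
      simpa using this
    have h1 := tendsto_lintegral_of_continuous hlim
      (continuous_finsetSum R fun y _ => hterm y) fun ω => (hR1 ω).trans (hop1 ω)
    have h2 := (tendsto_lintegral_of_continuous hlim hf hf1).add hinv
    rw [add_zero] at h2
    refine le_of_tendsto_of_tendsto' h1 h2 fun n => ?_
    exact (lintegral_mono hR1).trans (lintegral_envOp_one_avgLaw_le hf.measurable hf1 n)
  have hmeas : ∀ B : Set (Env d), MeasurableSet B →
      ((μ : Measure (Env d)).bind (envKernel d)) B ≤ (μ : Measure (Env d)) B + 0 := fun B hB =>
    measure_le_add_of_forall_lintegral_le hle hB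
  refine Measure.ext fun B hB => le_antisymm ?_ ?_
  · simpa using hmeas B hB
  · simpa using measure_le_add_symm hmeas B hB

end limit

/-! ### Comparison on half-spaces -/

/-- Events of the half-space `{x·u ≥ ℓ}` do not see the environment below level `ℓ`. -/
theorem mem_splice_iff (u : Site d) (ℓ : ℤ) {A : Set (Env d)}
    (hA : MeasurableSet[levelSigma u ℓ] A) (ω ω' : Env d) : splice u ℓ ω ω' ∈ A ↔ ω' ∈ A := by
  -- the `σ`-field of all sets that do not see the environment below level `ℓ`
  let m : MeasurableSpace (Env d) :=
    { MeasurableSet' := fun A => ∀ ω ω', splice u ℓ ω ω' ∈ A ↔ ω' ∈ A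
      measurableSet_empty := fun _ _ => Iff.rfl
      measurableSet_compl := fun _ h ω ω' => not_congr (h ω ω')
      measurableSet_iUnion := fun _ h ω ω' => by
        simp only [Set.mem_iUnion]
        exact exists_congr fun i => h i ω ω' }
  have h : levelSigma u ℓ ≤ m := by
    refine iSup₂_le fun x hx => ?_
    rintro _ ⟨B, _, rfl⟩ ω ω'
    have : splice u ℓ ω ω' x = ω' x := if_neg (not_lt.2 hx)
    simp only [Set.mem_preimage, this]
  exact h A hA ω ω'

theorem spliceLaw_apply_of_levelSigma (u : Site d) (ℓ : ℤ) (μ P : Measure (Env d))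
    [IsProbabilityMeasure μ] [IsProbabilityMeasure P] {A : Set (Env d)}
    (hA : MeasurableSet[levelSigma u ℓ] A) : spliceLaw u ℓ μ P A = P A := by
  have hA' := levelSigma_le u ℓ A hA
  rw [← lintegral_indicator_one hA', lintegral_spliceLaw u ℓ μ P (measurable_one.indicator hA')]
  have : ∀ ω ω', A.indicator (1 : Env d → ℝ≥0∞) (splice u ℓ ω ω') = A.indicator 1 ω' := by
    intro ω ω'
    by_cases h : ω' ∈ A
    · rw [Set.indicator_of_mem h, Set.indicator_of_mem ((mem_splice_iff u ℓ hA ω ω').2 h)]; rfl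
    · rw [Set.indicator_of_notMem h,
        Set.indicator_of_notMem fun h' => h ((mem_splice_iff u ℓ hA ω ω').1 h')]
  simp only [this, lintegral_const, measure_univ, mul_one, lintegral_indicator_one hA']

theorem varDist_trim_le {μ P : Measure (Env d)} [IsProbabilityMeasure μ] [IsProbabilityMeasure P]
    {u : Site d} {ℓ : ℤ} {ε : ℝ} (hε : 0 ≤ ε)
    (h : ∀ B : Set (Env d), MeasurableSet B → μ B ≤ spliceLaw u ℓ μ P B + ENNReal.ofReal ε) :
    varDist (μ.trim (levelSigma_le u ℓ)) (P.trim (levelSigma_le u ℓ)) ≤ ε := by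
  unfold varDist
  have : Nonempty {A : Set (Env d) // MeasurableSet[levelSigma u ℓ] A} :=
    ⟨⟨∅, @MeasurableSet.empty _ (levelSigma u ℓ)⟩⟩
  refine ciSup_le fun A => ?_
  have hA := levelSigma_le u ℓ A.1 A.2
  have h1 := h A.1 hA
  rw [spliceLaw_apply_of_levelSigma u ℓ μ P A.2] at h1
  rw [Measure.real, Measure.real, trim_measurableSet_eq _ A.2, trim_measurableSet_eq _ A.2,
    sub_le_iff_le_add']
  rw [← ENNReal.toReal_ofReal hε, ← ENNReal.toReal_add (measure_ne_top _ _) ENNReal.ofReal_ne_top]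
  exact ENNReal.toReal_mono (by finiteness) h1

/-! ### Walks that never fall below their starting level -/

/-- The paths that stay at or above their starting level up to time `i`, when they are at least
`ℓ` levels above it. -/
def confined (u : Site d) (ℓ : ℤ) (i : ℕ) : Set (Path d) :=
  {X | (∀ k ≤ i, X 0 ⬝ᵥ u ≤ X k ⬝ᵥ u) ∧ X 0 ⬝ᵥ u + ℓ ≤ X i ⬝ᵥ u}

theorem dependsUpTo_confined (u : Site d) (ℓ : ℤ) (i : ℕ) :
    DependsUpTo i fun X => X ∈ confined u ℓ i := fun X Y h => by
  simp only [confined, Set.mem_ofPred_eq, h i le_rfl, h 0 (Nat.zero_le i), eq_iff_iff]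
  exact and_congr_left fun _ => forall₂_congr fun k hk => by rw [h k hk]

/-- The probability that the walk from the origin is confined and then sees the environment
in `B`. -/
noncomputable def confinedProb (u : Site d) (ℓ : ℤ) (B : Set (Env d)) (i : ℕ) (ω : Env d) :
    ℝ≥0∞ :=
  ∫⁻ X, (confined u ℓ i).indicator (fun X => B.indicator 1 (shiftEnv (X i) ω)) X ∂(quenched ω 0)

theorem dependsUpTo_confined_indicator (u : Site d) (ℓ : ℤ) (B : Set (Env d)) (i : ℕ)
    (ω : Env d) : DependsUpTo i ((confined u ℓ i).indicator fun X =>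
      (B.indicator 1 (shiftEnv (X i) ω) : ℝ≥0∞)) :=
  (dependsUpTo_confined u ℓ i).indicator
    (dependsUpTo_apply (fun z => (B.indicator 1 (shiftEnv z ω) : ℝ≥0∞)) i)

theorem measurable_confinedProb (u : Site d) (ℓ : ℤ) {B : Set (Env d)} (hB : MeasurableSet B)
    (i : ℕ) : Measurable (confinedProb u ℓ B i) := by
  refine measurable_lintegral_quenched measurable_id 0 i
    (fun ω => dependsUpTo_confined_indicator u ℓ B i ω) fun X => ?_
  by_cases hX : X ∈ confined u ℓ i
  · simp only [Set.indicator_of_mem hX]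
    exact (measurable_one.indicator hB).comp (measurable_shiftEnv _)
  · simp only [Set.indicator_of_notMem hX, measurable_const]

theorem lintegral_confined_eq (u : Site d) (ℓ : ℤ) (B : Set (Env d)) (i : ℕ) (ω : Env d)
    (y : Site d) :
    ∫⁻ X, (confined u ℓ i).indicator (fun X => B.indicator 1 (shiftEnv (X i) ω)) X
      ∂(quenched ω y) = confinedProb u ℓ B i (shiftEnv y ω) := by
  have h := lintegral_quenched_add ω 0 y i (dependsUpTo_confined_indicator u ℓ B i ω)
  rw [zero_add] at h
  rw [h, confinedProb]
  refine lintegral_congr fun X => ?_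
  have h1 : (fun k => X k + y) ∈ confined u ℓ i ↔ X ∈ confined u ℓ i := by
    simp only [confined, Set.mem_ofPred_eq, add_dotProduct]
    refine and_congr (forall₂_congr fun k _ => ?_) ?_ <;> constructor <;> intro h <;> linarith
  by_cases hX : X ∈ confined u ℓ i
  · rw [Set.indicator_of_mem hX, Set.indicator_of_mem (h1.2 hX), shiftEnv_add]
  · rw [Set.indicator_of_notMem hX, Set.indicator_of_notMem fun hh => hX (h1.1 hh)]

/-- If `B` only depends on the levels `≥ -ℓ`, then the confined walk only looks at the levels
`≥ 0`. -/
theorem confinedProb_congr {u : Site d} {ℓ : ℤ} {B : Set (Env d)}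
    (hB : ∀ ω ω' : Env d, (∀ x, -ℓ ≤ x ⬝ᵥ u → ω x = ω' x) → (ω ∈ B ↔ ω' ∈ B)) (i : ℕ)
    {ω ω' : Env d} (h : ∀ x, 0 ≤ x ⬝ᵥ u → ω x = ω' x) :
    confinedProb u ℓ B i ω = confinedProb u ℓ B i ω' := by
  let S : Set (Path d) := {X | X 0 = 0}
  have hS : DependsUpTo i fun X : Path d => X ∈ S := fun X Y h => by
    simp only [S, Set.mem_ofPred_eq, h 0 (Nat.zero_le i)]
  have hrestrict : ∀ ω : Env d, confinedProb u ℓ B i ω =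
      ∫⁻ X, S.indicator ((confined u ℓ i).indicator fun X =>
        B.indicator 1 (shiftEnv (X i) ω)) X ∂(quenched ω 0) := fun ω => by
    refine lintegral_congr_ae ?_
    filter_upwards [quenched_zero ω 0] with X hX
    exact (Set.indicator_of_mem (s := S) hX _).symm
  have hpos : ∀ X ∈ S, X ∈ confined u ℓ i → (∀ k ≤ i, 0 ≤ X k ⬝ᵥ u) ∧ ℓ ≤ X i ⬝ᵥ u := by
    intro X hX0 hX
    have hX0 : X 0 = 0 := hX0
    simpa only [confined, Set.mem_ofPred_eq, hX0, zero_dotProduct, zero_add] using hX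
  have hsame : ∀ X, S.indicator ((confined u ℓ i).indicator fun X =>
        (B.indicator 1 (shiftEnv (X i) ω) : ℝ≥0∞)) X =
      S.indicator ((confined u ℓ i).indicator fun X => B.indicator 1 (shiftEnv (X i) ω')) X := by
    intro X
    by_cases hX0 : X ∈ S
    · rw [Set.indicator_of_mem hX0, Set.indicator_of_mem hX0]
      by_cases hX : X ∈ confined u ℓ i
      · rw [Set.indicator_of_mem hX, Set.indicator_of_mem hX]
        have h1 := hB (shiftEnv (X i) ω) (shiftEnv (X i) ω') fun x hx => h _ (by
          rw [add_dotProduct]; linarith [(hpos X hX0 hX).2])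
        by_cases h2 : shiftEnv (X i) ω ∈ B
        · rw [Set.indicator_of_mem h2, Set.indicator_of_mem (h1.1 h2)]; rfl
        · rw [Set.indicator_of_notMem h2, Set.indicator_of_notMem fun hh => h2 (h1.2 hh)]
      · rw [Set.indicator_of_notMem hX, Set.indicator_of_notMem hX]
    · rw [Set.indicator_of_notMem hX0, Set.indicator_of_notMem hX0]
  rw [hrestrict ω, hrestrict ω']
  simp_rw [hsame]
  refine lintegral_quenched_congr (D := {x | 0 ≤ x ⬝ᵥ u}) h 0 i
    (hS.indicator (dependsUpTo_confined_indicator u ℓ B i ω')) fun X hX k hk => ?_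
  have hX0 := Set.mem_of_indicator_ne_zero hX
  rw [Set.indicator_of_mem hX0] at hX
  exact (hpos X hX0 (Set.mem_of_indicator_ne_zero hX)).1 k hk.le

namespace StepBounds

variable {u : Site d} {s c M κ : ℝ} {ω : Env d}

theorem le_confinedProb_add (H : StepBounds u s c M κ ω) (hκ : 0 ≤ κ) (ℓ : ℤ)
    {B : Set (Env d)} (i : ℕ) :
    ENNReal.ofReal (κ * (1 - Real.exp (-s))) ≤
      confinedProb u ℓ B i ω + confinedProb u ℓ Bᶜ i ω +
        ENNReal.ofReal (Real.exp (s * ℓ - c * i)) := by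
  have hm : MeasurableSet (confined u ℓ i) := (dependsUpTo_confined u ℓ i).measurableSet
  have h1 : confinedProb u ℓ B i ω + confinedProb u ℓ Bᶜ i ω = quenched ω 0 (confined u ℓ i) := by
    unfold confinedProb
    rw [← lintegral_add_left (dependsUpTo_confined_indicator u ℓ B i ω).measurable,
      ← lintegral_indicator_one hm]
    refine lintegral_congr fun X => ?_
    by_cases hX : X ∈ confined u ℓ i
    · rw [Set.indicator_of_mem hX, Set.indicator_of_mem hX, Set.indicator_of_mem hX]
      by_cases h2 : shiftEnv (X i) ω ∈ B
      · rw [Set.indicator_of_mem h2, Set.indicator_of_notMem (Set.notMem_compl_iff.2 h2), add_zero]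
        rfl
      · rw [Set.indicator_of_notMem h2, Set.indicator_of_mem (Set.mem_compl h2), zero_add]
        rfl
    · rw [Set.indicator_of_notMem hX, Set.indicator_of_notMem hX, Set.indicator_of_notMem hX,
        add_zero]
  rw [h1]
  refine (H.no_backtrack hκ 0).trans ?_
  refine le_trans (measure_mono_ae ?_) ((measure_union_le (confined u ℓ i)
    {X : Path d | ((X i ⬝ᵥ u : ℤ) : ℝ) ≤ (((0 : Site d) ⬝ᵥ u : ℤ) : ℝ) + ℓ}).trans
    (add_le_add_right (H.level_le 0 i ℓ) _))
  filter_upwards [quenched_zero ω 0] with X hX h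
  have h : ∀ n, ¬ X n ⬝ᵥ u < X 0 ⬝ᵥ u := firstTime_eq_top_iff.1 h
  by_cases h3 : X i ⬝ᵥ u ≤ (0 : Site d) ⬝ᵥ u + ℓ
  · right
    change ((X i ⬝ᵥ u : ℤ) : ℝ) ≤ (((0 : Site d) ⬝ᵥ u : ℤ) : ℝ) + ℓ
    exact_mod_cast h3
  · left
    refine ⟨fun k _ => not_lt.1 (h k), ?_⟩
    rw [hX]
    exact (not_le.1 h3).le

end StepBounds

/-- The paths that reach level `L` for the first time at time `j`. -/
def firstEntry (u : Site d) (L : ℤ) (j : ℕ) : Set (Path d) :=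
  {X | L ≤ X j ⬝ᵥ u ∧ ∀ i < j, X i ⬝ᵥ u < L}

theorem dependsUpTo_firstEntry (u : Site d) (L : ℤ) (j : ℕ) :
    DependsUpTo j fun X => X ∈ firstEntry u L j := fun X Y h => by
  simp only [firstEntry, Set.mem_ofPred_eq, h j le_rfl, eq_iff_iff]
  exact and_congr_right fun _ => forall₂_congr fun k hk => by rw [h k hk.le]

theorem eq_of_mem_firstEntry {u : Site d} {L : ℤ} {i j : ℕ} {X : Path d}
    (hi : X ∈ firstEntry u L i) (hj : X ∈ firstEntry u L j) : i = j := by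
  rcases lt_trichotomy i j with h | h | h
  · exact absurd hi.1 (not_le.2 (hj.2 i h))
  · exact h
  · exact absurd hj.1 (not_le.2 (hi.2 j h))

theorem sum_indicator_firstEntry_le (u : Site d) (L : ℤ) (J : ℕ) (a : ℝ≥0∞) (X : Path d) :
    ∑ j ∈ Finset.range (J + 1), (firstEntry u L j).indicator (fun _ => a) X ≤ a := by
  by_cases h : ∃ j ∈ Finset.range (J + 1), X ∈ firstEntry u L j
  · obtain ⟨j, hj, hX⟩ := h
    rw [Finset.sum_eq_single_of_mem j hj, Set.indicator_of_mem hX]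
    exact fun i _ hij => Set.indicator_of_notMem (fun hi => hij (eq_of_mem_firstEntry hi hX)) _
  · push Not at h
    rw [Finset.sum_eq_zero fun j hj => Set.indicator_of_notMem (h j hj) _]
    exact zero_le

/-- After the first entry into level `L` at time `j`, a walk that is confined during the remaining
`m - j` steps contributes to `E_0^ω[1_B(T_{X_m} ω)]`. -/
theorem sum_lintegral_confinedProb_le (u : Site d) (L ℓ : ℤ) {B : Set (Env d)} {J m : ℕ}
    (hJ : J ≤ m) (ω : Env d) :
    ∑ j ∈ Finset.range (J + 1), ∫⁻ X, (firstEntry u L j).indicator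
      (fun X => confinedProb u ℓ B (m - j) (shiftEnv (X j) ω)) X ∂(quenched ω 0) ≤
    envOp m (B.indicator 1) ω := by
  have hg : Measurable fun X : Path d => (B.indicator 1 (shiftEnv (X m) ω) : ℝ≥0∞) :=
    (dependsUpTo_apply (fun z => (B.indicator 1 (shiftEnv z ω) : ℝ≥0∞)) m).measurable
  have hstep : ∀ j ≤ m, ∫⁻ X, (firstEntry u L j).indicator
      (fun X => confinedProb u ℓ B (m - j) (shiftEnv (X j) ω)) X ∂(quenched ω 0) ≤
      ∫⁻ X, (firstEntry u L j).indicator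
        (fun _ => (B.indicator 1 (shiftEnv (X m) ω) : ℝ≥0∞)) X ∂(quenched ω 0) := by
    intro j hj
    have hm := markov ω 0 j (F := (firstEntry u L j).indicator 1)
      ((dependsUpTo_firstEntry u L j).indicator fun _ _ _ => rfl)
      (dependsUpTo_confined_indicator u ℓ B (m - j) ω).measurable
    simp_rw [lintegral_confined_eq] at hm
    calc _ = ∫⁻ X, (firstEntry u L j).indicator 1 X *
          confinedProb u ℓ B (m - j) (shiftEnv (X j) ω) ∂(quenched ω 0) := by
          refine lintegral_congr fun X => ?_
          by_cases hX : X ∈ firstEntry u L j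
          · rw [Set.indicator_of_mem hX, Set.indicator_of_mem hX, Pi.one_apply, one_mul]
          · rw [Set.indicator_of_notMem hX, Set.indicator_of_notMem hX, zero_mul]
      _ = _ := hm.symm
      _ ≤ _ := by
          refine lintegral_mono fun X => ?_
          have e : m - j + j = m := Nat.sub_add_cancel hj
          by_cases hX : X ∈ firstEntry u L j
          · rw [Set.indicator_of_mem hX, Set.indicator_of_mem hX, Pi.one_apply, one_mul]
            refine (Set.indicator_le_self _ _ _).trans (le_of_eq ?_)
            simp only [shiftPath, e]
          · rw [Set.indicator_of_notMem hX, zero_mul]; exact zero_le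
  refine (Finset.sum_le_sum fun j hj =>
    hstep j ((Nat.lt_succ_iff.1 (Finset.mem_range.1 hj)).trans hJ)).trans ?_
  rw [← lintegral_finsetSum]
  · exact lintegral_mono fun X => sum_indicator_firstEntry_le u L J _ X
  · intro j _
    exact Measurable.ite (dependsUpTo_firstEntry u L j).measurableSet hg measurable_const

theorem measurable_quenched_firstEntry (u : Site d) (L : ℤ) (j : ℕ) :
    Measurable fun ω : Env d => quenched ω 0 (firstEntry u L j) := by
  have h : ∀ ω : Env d, quenched ω 0 (firstEntry u L j) =
      ∫⁻ X, (firstEntry u L j).indicator 1 X ∂(quenched ω 0) := fun ω =>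
    (lintegral_indicator_one (dependsUpTo_firstEntry u L j).measurableSet).symm
  simp_rw [h]
  exact measurable_lintegral_quenched measurable_id 0 j
    (fun _ => (dependsUpTo_firstEntry u L j).indicator fun _ _ _ => rfl) fun _ => measurable_const

theorem measurable_uncurry_position {g : Site d → Env d → ℝ≥0∞} (hg : ∀ z, Measurable (g z))
    (j : ℕ) : Measurable fun q : Env d × Path d => g (q.2 j) q.1 := by
  have h1 : Measurable fun q : Env d × Site d => g q.2 q.1 :=
    measurable_from_prod_countable_left hg
  have h2 : Measurable fun q : Env d × Path d => (q.1, q.2 j) :=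
    measurable_fst.prodMk ((measurable_pi_apply j).comp measurable_snd)
  exact h1.comp h2

/-- Up to the first entry into level `L` the walk in the spliced environment only looks at `ω`,
and afterwards a confined walk only looks at the independent environment `ω'`. -/
theorem sum_mul_le_lintegral_envOp_splice {P : Measure (Env d)} (hP : IsIIDEnv P) {u : Site d}
    {L ℓ : ℤ} {B : Set (Env d)} (hBm : MeasurableSet B)
    (hB : ∀ ω ω' : Env d, (∀ x, -ℓ ≤ x ⬝ᵥ u → ω x = ω' x) → (ω ∈ B ↔ ω' ∈ B)) {J m : ℕ}
    (hJ : J ≤ m) (ω : Env d) :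
    ∑ j ∈ Finset.range (J + 1), quenched ω 0 (firstEntry u L j) *
        ∫⁻ ω', confinedProb u ℓ B (m - j) ω' ∂P ≤
      ∫⁻ ω', envOp m (B.indicator 1) (splice u L ω ω') ∂P := by
  have := hP.isProbabilityMeasure
  have hjoint : ∀ j, Measurable fun q : Env d × Path d => (firstEntry u L j).indicator
      (fun X => confinedProb u ℓ B (m - j) (shiftEnv (X j) q.1)) q.2 := by
    intro j
    have h2 := measurable_uncurry_position (g := fun z ω => confinedProb u ℓ B (m - j) (shiftEnv z ω))
      (fun z => (measurable_confinedProb u ℓ hBm (m - j)).comp (measurable_shiftEnv z)) j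
    exact Measurable.ite (measurable_snd (dependsUpTo_firstEntry u L j).measurableSet) h2
      measurable_const
  have hterm : ∀ j, quenched ω 0 (firstEntry u L j) * ∫⁻ ω', confinedProb u ℓ B (m - j) ω' ∂P =
      ∫⁻ ω', ∫⁻ X, (firstEntry u L j).indicator
        (fun X => confinedProb u ℓ B (m - j) (shiftEnv (X j) ω')) X ∂(quenched ω 0) ∂P := by
    intro j
    have hE : MeasurableSet (firstEntry u L j) := (dependsUpTo_firstEntry u L j).measurableSet
    rw [lintegral_lintegral_swap (hjoint j).aemeasurable, ← lintegral_indicator_one hE,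
      ← lintegral_mul_const _ (measurable_one.indicator hE)]
    refine lintegral_congr fun X => ?_
    by_cases hX : X ∈ firstEntry u L j
    · simp only [Set.indicator_of_mem hX, Pi.one_apply, one_mul]
      exact (hP.lintegral_shiftEnv (X j) (measurable_confinedProb u ℓ hBm (m - j))).symm
    · simp only [Set.indicator_of_notMem hX, lintegral_zero, zero_mul]
  simp_rw [hterm]
  rw [← lintegral_finsetSum _ fun j _ => (hjoint j).lintegral_prod_right']
  refine lintegral_mono fun ω' => ?_
  refine le_trans (le_of_eq (Finset.sum_congr rfl fun j _ => ?_))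
    (sum_lintegral_confinedProb_le u L ℓ hJ (splice u L ω ω'))
  have hfun : (firstEntry u L j).indicator
        (fun X => confinedProb u ℓ B (m - j) (shiftEnv (X j) (splice u L ω ω'))) =
      (firstEntry u L j).indicator
        fun X => confinedProb u ℓ B (m - j) (shiftEnv (X j) ω') := by
    funext X
    by_cases hX : X ∈ firstEntry u L j
    · rw [Set.indicator_of_mem hX, Set.indicator_of_mem hX]
      refine confinedProb_congr hB _ fun x hx => if_neg (not_lt.2 ?_)
      rw [add_dotProduct]
      linarith [hX.1]
    · rw [Set.indicator_of_notMem hX, Set.indicator_of_notMem hX]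
  rw [hfun]
  refine lintegral_quenched_congr (D := {x | x ⬝ᵥ u < L}) (fun x hx => (if_pos hx).symm) 0 j
    ((dependsUpTo_firstEntry u L j).indicator
      (dependsUpTo_apply (fun z => confinedProb u ℓ B (m - j) (shiftEnv z ω')) j))
    fun X hX i hi => (Set.mem_of_indicator_ne_zero hX).2 i hi

theorem envOp_indicator_le_one (m : ℕ) (B : Set (Env d)) (ω : Env d) :
    envOp m (B.indicator 1) ω ≤ 1 := by
  have h : B.indicator (1 : Env d → ℝ≥0∞) ≤ fun _ => 1 := Set.indicator_le_self' (by simp)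
  exact (envOp_mono h ω).trans (envOp_const m 1 ω).le

theorem sum_lintegral_firstEntry_mul_le {P μ : Measure (Env d)} (hP : IsIIDEnv P)
    [IsProbabilityMeasure μ] {u : Site d} {L ℓ : ℤ} {B C : Set (Env d)} (hBm : MeasurableSet B)
    (hCm : MeasurableSet C)
    (hB : ∀ ω ω' : Env d, (∀ x, -ℓ ≤ x ⬝ᵥ u → ω x = ω' x) → (ω ∈ B ↔ ω' ∈ B))
    (hC : ∀ ω ω' : Env d, (∀ x, x ⬝ᵥ u < L → ω x = ω' x) → (ω ∈ C ↔ ω' ∈ C)) {ε : ℝ≥0∞}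
    (hcomp : ∀ A : Set (Env d), MeasurableSet A → spliceLaw u L μ P A ≤ μ A + ε) {J m : ℕ}
    (hJ : J ≤ m) :
    ∑ j ∈ Finset.range (J + 1), (∫⁻ ω in C, quenched ω 0 (firstEntry u L j) ∂μ) *
        ∫⁻ ω, confinedProb u ℓ B (m - j) ω ∂P ≤
      ∫⁻ ω in C, envOp m (B.indicator 1) ω ∂μ + ε := by
  have := hP.isProbabilityMeasure
  have hop : Measurable (envOp m (B.indicator (1 : Env d → ℝ≥0∞))) :=
    measurable_envOp m (measurable_one.indicator hBm)
  have h1 := lintegral_le_add_of_forall_measure_le hcomp (hop.indicator hCm) fun ω =>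
    (Set.indicator_le_self _ _ ω).trans (envOp_indicator_le_one m B ω)
  rw [lintegral_spliceLaw u L μ P (hop.indicator hCm), lintegral_indicator hCm] at h1
  refine le_trans ?_ h1
  simp_rw [← lintegral_mul_const _ (measurable_quenched_firstEntry u L _)]
  rw [← lintegral_finsetSum _ fun j _ => (measurable_quenched_firstEntry u L j).mul_const _,
    ← lintegral_indicator hCm]
  refine lintegral_mono fun ω => ?_
  by_cases hω : ω ∈ C
  · have h2 : ∀ ω', splice u L ω ω' ∈ C := fun ω' =>
      (hC ω _ fun x hx => (if_pos hx).symm).1 hω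
    rw [Set.indicator_of_mem hω]
    simp only [Set.indicator_of_mem (h2 _)]
    exact sum_mul_le_lintegral_envOp_splice hP hBm hB hJ ω
  · rw [Set.indicator_of_notMem hω]; exact zero_le

/-- Summing over windows of times decouples the entry time from the confined part of the walk. -/
theorem sum_mul_sum_le_of_convolution_le (q a : ℕ → ℝ≥0∞) {K : ℝ≥0∞} {J : ℕ}
    (h : ∀ m, J ≤ m → ∑ j ∈ Finset.range (J + 1), q j * a (m - j) ≤ K) :
    (∑ j ∈ Finset.range (J + 1), q j) * ∑ i ∈ Finset.Ico J (2 * J), a i ≤ 2 * J * K := by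
  have h1 : ∑ m ∈ Finset.Ico J (3 * J), ∑ j ∈ Finset.range (J + 1), q j * a (m - j) ≤
      2 * J * K := by
    calc _ ≤ ∑ m ∈ Finset.Ico J (3 * J), K :=
          Finset.sum_le_sum fun m hm => h m (Finset.mem_Ico.1 hm).1
      _ = _ := by
          rw [Finset.sum_const, Nat.card_Ico, nsmul_eq_mul]
          congr 1
          rw [show 3 * J - J = 2 * J by omega]
          push_cast; rfl
  refine le_trans ?_ h1
  rw [Finset.sum_comm, Finset.sum_mul]
  refine Finset.sum_le_sum fun j hj => ?_
  have hj : j ≤ J := Nat.lt_succ_iff.1 (Finset.mem_range.1 hj)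
  rw [← Finset.mul_sum]
  gcongr
  have h2 := Finset.sum_Ico_add' (fun m => a (m - j)) J (2 * J) j
  simp only [Nat.add_sub_cancel] at h2
  rw [h2]
  exact Finset.sum_le_sum_of_subset (Finset.Ico_subset_Ico (by omega) (by omega))

/-- By time `J` the walk has entered level `L`, up to a small probability. -/
theorem StepBounds.one_le_sum_firstEntry {u : Site d} {s c M κ : ℝ} {ω : Env d}
    (H : StepBounds u s c M κ ω) (L : ℤ) (J : ℕ) :
    1 ≤ ∑ j ∈ Finset.range (J + 1), quenched ω 0 (firstEntry u L j) +
      ENNReal.ofReal (Real.exp (s * L - c * J)) := by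
  rw [← measure_univ (μ := quenched ω 0)]
  refine le_trans (measure_mono fun X _ => ?_) ((measure_union_le
    (⋃ j ∈ Finset.range (J + 1), firstEntry u L j)
    {X : Path d | ((X J ⬝ᵥ u : ℤ) : ℝ) ≤ (((0 : Site d) ⬝ᵥ u : ℤ) : ℝ) + L}).trans
    (add_le_add (measure_biUnion_finset_le _ _) (H.level_le 0 J L)))
  by_cases h : L ≤ X J ⬝ᵥ u
  · left
    classical
    have hex : ∃ j, L ≤ X j ⬝ᵥ u := ⟨J, h⟩
    refine Set.mem_biUnion (x := Nat.find hex) (Finset.mem_coe.2 (Finset.mem_range.2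
      (Nat.lt_succ_of_le (Nat.find_min' hex h)))) ?_
    exact ⟨Nat.find_spec hex, fun i hi => not_le.1 (Nat.find_min hex hi)⟩
  · right
    change ((X J ⬝ᵥ u : ℤ) : ℝ) ≤ (((0 : Site d) ⬝ᵥ u : ℤ) : ℝ) + L
    rw [zero_dotProduct, Int.cast_zero, zero_add]
    exact_mod_cast (not_le.1 h).le

/-! ### Ergodicity -/

theorem envOp_one_congr_ae {μ : Measure (Env d)} (hμ : Kernel.Invariant (envKernel d) μ)
    {f g : Env d → ℝ≥0∞} (hf : Measurable f) (hg : Measurable g) (h : f =ᵐ[μ] g) :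
    envOp 1 f =ᵐ[μ] envOp 1 g := by
  rw [← hμ.def] at h
  filter_upwards [Measure.ae_ae_of_ae_bind (envKernel d).measurable.aemeasurable h] with ω hω
  rw [← lintegral_envKernel ω hf, ← lintegral_envKernel ω hg]
  exact lintegral_congr_ae hω

theorem envOp_ae_eq_self {μ : Measure (Env d)} (hμ : Kernel.Invariant (envKernel d) μ)
    {f : Env d → ℝ≥0∞} (hf : Measurable f) (h : envOp 1 f =ᵐ[μ] f) (n : ℕ) :
    envOp n f =ᵐ[μ] f := by
  induction n with
  | zero => rw [envOp_zero]
  | succ n ih =>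
    rw [envOp_succ]
    exact (envOp_one_congr_ae hμ (measurable_envOp n hf) hf ih).trans h

/-- If `C` approximates an invariant event, then the environment process rarely moves from `C`
to its complement, at any time. -/
theorem setLIntegral_envOp_compl_le {μ : Measure (Env d)} (hμ : Kernel.Invariant (envKernel d) μ)
    {A C : Set (Env d)} (hA : MeasurableSet A) (hC : MeasurableSet C)
    (h : envOp 1 (Aᶜ.indicator 1) =ᵐ[μ] Aᶜ.indicator 1) (m : ℕ) :
    ∫⁻ ω in C, envOp m (Cᶜ.indicator 1) ω ∂μ ≤ 2 * μ (symmDiff C A) := by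
  have hAop : Measurable (Aᶜ.indicator (1 : Env d → ℝ≥0∞)) := measurable_one.indicator hA.compl
  have hD : MeasurableSet (A \ C) := hA.diff hC
  have hDop : Measurable ((A \ C).indicator (1 : Env d → ℝ≥0∞)) := measurable_one.indicator hD
  have h0 := envOp_ae_eq_self hμ hAop h m
  have hle : ∀ ω, envOp m (Cᶜ.indicator 1) ω ≤
      envOp m (Aᶜ.indicator 1) ω + envOp m ((A \ C).indicator 1) ω := by
    intro ω
    unfold envOp
    rw [← lintegral_add_left
      (dependsUpTo_apply (fun z => (Aᶜ.indicator 1 (shiftEnv z ω) : ℝ≥0∞)) m).measurable]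
    refine lintegral_mono fun X => ?_
    by_cases h1 : shiftEnv (X m) ω ∈ C
    · rw [Set.indicator_of_notMem (Set.notMem_compl_iff.2 h1)]; exact zero_le
    · by_cases h2 : shiftEnv (X m) ω ∈ A
      · rw [Set.indicator_of_mem (Set.mem_sdiff_of_mem h2 h1)]
        exact (Set.indicator_le_self' (by simp) _).trans le_add_self
      · rw [Set.indicator_of_mem (Set.mem_compl h2)]
        exact (Set.indicator_le_self' (by simp) _).trans le_self_add
  have h1 : ∫⁻ ω in C, envOp m (Aᶜ.indicator 1) ω ∂μ ≤ μ (C \ A) := by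
    rw [setLIntegral_congr_fun_ae hC (h0.mono fun ω h _ => h)]
    rw [lintegral_indicator_one hA.compl, Measure.restrict_apply hA.compl]
    exact measure_mono fun ω h => ⟨h.2, h.1⟩
  have h2 : ∫⁻ ω in C, envOp m ((A \ C).indicator 1) ω ∂μ ≤ μ (A \ C) := by
    refine (setLIntegral_le_lintegral _ _).trans ?_
    rw [lintegral_envOp_of_invariant hμ m hDop, lintegral_indicator_one hD]
  calc _ ≤ ∫⁻ ω in C, (envOp m (Aᶜ.indicator 1) ω + envOp m ((A \ C).indicator 1) ω) ∂μ :=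
        lintegral_mono hle
    _ = _ := lintegral_add_left (measurable_envOp m hAop) _
    _ ≤ μ (symmDiff C A) + μ (symmDiff C A) := by
        refine add_le_add (h1.trans (measure_mono ?_)) (h2.trans (measure_mono ?_))
        · exact fun ω h => Or.inl h
        · exact fun ω h => Or.inr h
    _ = _ := (two_mul _).symm

/-- Measurable sets of environments are approximated by sets that only depend on the levels
between `-N` and `N`. -/
theorem exists_local_approx (μ : Measure (Env d)) [IsProbabilityMeasure μ] (u : Site d)
    {A : Set (Env d)} (hA : MeasurableSet A) {ε : ℝ≥0∞} (hε : 0 < ε) :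
    ∃ (C : Set (Env d)) (N : ℕ), MeasurableSet C ∧ μ (symmDiff C A) < ε ∧
      ∀ ω ω' : Env d, (∀ x, -(N : ℤ) ≤ x ⬝ᵥ u → x ⬝ᵥ u < N → ω x = ω' x) → (ω ∈ C ↔ ω' ∈ C) := by
  obtain ⟨C, hC, hlt⟩ := exists_measure_symmDiff_lt_of_generateFrom_isSetRing (μ := μ)
    isSetRing_measurableCylinders
    ⟨{Set.univ}, Set.countable_singleton _, by
      rw [Set.singleton_subset_iff]; exact univ_mem_measurableCylinders _, by simp⟩
    (generateFrom_measurableCylinders (α := fun _ : Site d => StepLaw d)).symm hA hε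
  obtain ⟨F, S, hS, rfl⟩ := (mem_measurableCylinders C).1 hC
  refine ⟨_, (∑ x ∈ F, (x ⬝ᵥ u).natAbs) + 1, hS.cylinder, hlt, fun ω ω' h => ?_⟩
  rw [mem_cylinder, mem_cylinder]
  have : F.restrict ω = F.restrict ω' := by
    funext x
    have h1 : (x.1 ⬝ᵥ u).natAbs ≤ ∑ x ∈ F, (x ⬝ᵥ u).natAbs :=
      Finset.single_le_sum (f := fun x : Site d => (x ⬝ᵥ u).natAbs) (fun _ _ => Nat.zero_le _) x.2
    exact h x.1 (by rw [Nat.cast_add, Nat.cast_one]; omega) (by rw [Nat.cast_add, Nat.cast_one]; omega)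
  rw [this]

theorem exists_forall_mul_exp_le (K : ℝ) {b ε : ℝ} (hb : 0 < b) (hε : 0 < ε) :
    ∃ n₀ : ℕ, ∀ n : ℕ, n₀ ≤ n → K * Real.exp (-b * n) ≤ ε := by
  have h1 : Filter.Tendsto (fun n : ℕ => K * Real.exp (-(b * n))) Filter.atTop (nhds (K * 0)) :=
    (Real.tendsto_exp_neg_atTop_nhds_zero.comp
      (tendsto_natCast_atTop_atTop.const_mul_atTop hb)).const_mul K
  rw [mul_zero] at h1
  obtain ⟨n₀, h⟩ := Filter.eventually_atTop.1 (h1.eventually_le_const hε)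
  exact ⟨n₀, fun n hn => by simpa only [neg_mul] using h n hn⟩

section

variable {P μ : Measure (Env d)} [IsProbabilityMeasure μ] {u : Site d} {s c M κ : ℝ}

theorem measure_le_sum_setLIntegral_firstEntry (Hμ : ∀ᵐ ω ∂μ, StepBounds u s c M κ ω) (L : ℤ)
    (J : ℕ) (C : Set (Env d)) :
    μ C ≤ ∑ j ∈ Finset.range (J + 1), ∫⁻ ω in C, quenched ω 0 (firstEntry u L j) ∂μ +
      ENNReal.ofReal (Real.exp (s * L - c * J)) := by
  calc μ C = ∫⁻ _ in C, 1 ∂μ := by simp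
    _ ≤ ∫⁻ ω in C, (∑ j ∈ Finset.range (J + 1), quenched ω 0 (firstEntry u L j) +
          ENNReal.ofReal (Real.exp (s * L - c * J))) ∂μ :=
        lintegral_mono_ae (ae_restrict_of_ae (Hμ.mono fun ω H => H.one_le_sum_firstEntry L J))
    _ ≤ _ := by
        rw [lintegral_add_right _ measurable_const,
          lintegral_finsetSum _ fun j _ => measurable_quenched_firstEntry u L j, lintegral_const]
        gcongr
        exact mul_le_of_le_one_right' ((Measure.restrict_apply_univ C).trans_le prob_le_one)

theorem ofReal_le_lintegral_confinedProb_add [IsProbabilityMeasure P]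
    (HP : ∀ᵐ ω ∂P, StepBounds u s c M κ ω) (hκ : 0 ≤ κ) (ℓ : ℤ) {C : Set (Env d)}
    (hC : MeasurableSet C) (i : ℕ) :
    ENNReal.ofReal (κ * (1 - Real.exp (-s))) ≤
      ∫⁻ ω, confinedProb u ℓ C i ω ∂P + ∫⁻ ω, confinedProb u ℓ Cᶜ i ω ∂P +
        ENNReal.ofReal (Real.exp (s * ℓ - c * i)) := by
  have h := lintegral_mono_ae (HP.mono fun ω H => H.le_confinedProb_add hκ ℓ (B := C) i)
  rw [lintegral_add_right _ measurable_const,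
    lintegral_add_left (measurable_confinedProb u ℓ hC i)] at h
  simpa using h

theorem ofReal_half_le {θ : ℝ} (hθ : 0 ≤ θ) {p : ℝ≥0∞}
    (h : ENNReal.ofReal θ ≤ p + ENNReal.ofReal (θ / 2)) : ENNReal.ofReal (θ / 2) ≤ p := by
  refine (ENNReal.add_le_add_iff_right (a := ENNReal.ofReal (θ / 2)) ENNReal.ofReal_ne_top).1 ?_
  rwa [← ENNReal.ofReal_add (by positivity) (by positivity), add_halves]

/-- Suppose that an invariant event `A` and its complement both have positive probability. The
process started in a local approximation `C` of `A` hardly ever visits `Cᶜ`, and conversely. But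
after its entry into a distant level the walk sees a fresh environment that does not depend on
whether it started in `C` or in `Cᶜ`, and with a fixed probability it stays there, so that at any
later time it sees `C` or `Cᶜ`. These two facts contradict each other. -/
theorem isErgodicFor_of_spliceLaw_le (hP : IsIIDEnv P) (hμ : Kernel.Invariant (envKernel d) μ)
    (HP : ∀ᵐ ω ∂P, StepBounds u s c M κ ω) (Hμ : ∀ᵐ ω ∂μ, StepBounds u s c M κ ω) (hκ : 0 < κ)
    (hs : 0 < s) (hc : 0 < c) {K : ℝ}
    (hcomp : ∀ (L : ℤ) (B : Set (Env d)), MeasurableSet B →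
      spliceLaw u L μ P B ≤ μ B + ENNReal.ofReal (K * Real.exp (-s * L))) :
    IsErgodicFor (envKernel d) μ := by
  have := hP.isProbabilityMeasure
  intro A hA hinv
  by_contra! hne
  have hpos : μ A ≠ 0 ∧ μ Aᶜ ≠ 0 := ⟨hne.1, fun h => hne.2 ((prob_compl_eq_zero_iff hA).1 h)⟩
  set η : ℝ := κ * (1 - Real.exp (-s)) with hηdef
  have hη : 0 < η := mul_pos hκ (one_sub_exp_pos hs)
  have hη1 : η ≤ 1 := by
    obtain ⟨ω, H⟩ := HP.exists
    have h := (H.no_backtrack hκ.le 0).trans prob_le_one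
    exact ENNReal.ofReal_le_one.1 h
  obtain ⟨θ, hθ, hθA, hθA'⟩ : ∃ θ : ℝ, 0 < θ ∧ ENNReal.ofReal θ ≤ μ A ∧
      ENNReal.ofReal θ ≤ μ Aᶜ := by
    refine ⟨min (μ A).toReal (μ Aᶜ).toReal,
      lt_min (ENNReal.toReal_pos hpos.1 (measure_ne_top _ _))
        (ENNReal.toReal_pos hpos.2 (measure_ne_top _ _)), ?_, ?_⟩
    · exact ENNReal.ofReal_le_of_le_toReal (min_le_left _ _)
    · exact ENNReal.ofReal_le_of_le_toReal (min_le_right _ _)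
  -- any `ε < θη/48` leads to the contradiction
  set ε : ℝ := θ * η / 100 with hεdef
  have hε : 0 < ε := by positivity
  have hεθ : ε ≤ θ / 4 := by rw [hεdef]; nlinarith
  obtain ⟨C, N, hC, hCA, hloc⟩ := exists_local_approx μ u hA (ENNReal.ofReal_pos.2 hε)
  have hCA' : μ (symmDiff Cᶜ Aᶜ) < ENNReal.ofReal ε := by rwa [compl_symmDiff_compl]
  obtain ⟨L₀, hL₀⟩ := exists_forall_mul_exp_le K hs hε
  set L : ℕ := max N L₀ with hLdef
  have hNL : (N : ℤ) ≤ (L : ℤ) := by exact_mod_cast le_max_left N L₀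
  have herr : ENNReal.ofReal (K * Real.exp (-s * ((L : ℤ) : ℝ))) ≤ ENNReal.ofReal ε :=
    ENNReal.ofReal_le_ofReal (by exact_mod_cast hL₀ L (le_max_right _ _))
  obtain ⟨J₁, hJ₁⟩ := exists_forall_mul_exp_le (Real.exp (s * L)) hc (ε := θ / 4) (by positivity)
  obtain ⟨J₂, hJ₂⟩ := exists_forall_mul_exp_le (Real.exp (s * N)) hc (ε := η / 2) (by positivity)
  set J : ℕ := max (max J₁ J₂) 1 with hJdef
  have hJ1 : 1 ≤ J := le_max_right _ _
  have hJJ₁ : J₁ ≤ J := (le_max_left _ _).trans (le_max_left _ _)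
  have hJJ₂ : J₂ ≤ J := (le_max_right _ _).trans (le_max_left _ _)
  have hlow : ∀ ω ω' : Env d, (∀ x, -(N : ℤ) ≤ x ⬝ᵥ u → ω x = ω' x) → (ω ∈ C ↔ ω' ∈ C) :=
    fun ω ω' h => hloc ω ω' fun x hx _ => h x hx
  have hup : ∀ ω ω' : Env d, (∀ x, x ⬝ᵥ u < (L : ℤ) → ω x = ω' x) → (ω ∈ C ↔ ω' ∈ C) :=
    fun ω ω' h => hloc ω ω' fun x _ hx => h x (hx.trans_le hNL)
  have hop : envOp 1 (Aᶜ.indicator 1) =ᵐ[μ] Aᶜ.indicator 1 := by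
    filter_upwards [hinv] with ω hω
    rw [← lintegral_envKernel ω (measurable_one.indicator hA.compl),
      lintegral_indicator_one hA.compl, prob_compl_eq_one_sub hA, hω]
    by_cases h : ω ∈ A
    · rw [Set.indicator_of_mem h, Set.indicator_of_notMem (Set.notMem_compl_iff.2 h)]; simp
    · rw [Set.indicator_of_notMem h, Set.indicator_of_mem (Set.mem_compl h)]; simp
  have hop' : envOp 1 (Aᶜᶜ.indicator 1) =ᵐ[μ] Aᶜᶜ.indicator 1 := by
    rw [compl_compl]
    filter_upwards [hinv] with ω hω
    rw [← lintegral_envKernel ω (measurable_one.indicator hA), lintegral_indicator_one hA, hω]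
  -- the walk started in a set `D` that is `C` or `Cᶜ`
  have hmain : ∀ D E : Set (Env d), MeasurableSet D → MeasurableSet E →
      (∀ ω ω' : Env d, (∀ x, x ⬝ᵥ u < (L : ℤ) → ω x = ω' x) → (ω ∈ D ↔ ω' ∈ D)) →
      (∀ ω ω' : Env d, (∀ x, -(N : ℤ) ≤ x ⬝ᵥ u → ω x = ω' x) → (ω ∈ Dᶜ ↔ ω' ∈ Dᶜ)) →
      envOp 1 (Eᶜ.indicator 1) =ᵐ[μ] Eᶜ.indicator 1 → μ (symmDiff D E) < ENNReal.ofReal ε →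
      ENNReal.ofReal θ ≤ μ E →
      ENNReal.ofReal (θ / 2) * ∑ i ∈ Finset.Ico J (2 * J), ∫⁻ ω, confinedProb u N Dᶜ i ω ∂P ≤
        2 * J * ENNReal.ofReal (3 * ε) := by
    intro D E hD hE hD1 hD2 hE1 hDE hθE
    have hp : ENNReal.ofReal (θ / 2) ≤
        ∑ j ∈ Finset.range (J + 1), ∫⁻ ω in D, quenched ω 0 (firstEntry u L j) ∂μ := by
      refine ofReal_half_le hθ.le ?_
      have h1 : μ E ≤ μ D + μ (symmDiff D E) := by
        refine (measure_mono fun ω h => ?_).trans (measure_union_le _ _)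
        by_cases h' : ω ∈ D
        · exact Or.inl h'
        · exact Or.inr (Or.inr ⟨h, h'⟩)
      have h2 : ENNReal.ofReal (Real.exp (s * ((L : ℤ) : ℝ) - c * J)) ≤ ENNReal.ofReal (θ / 4) := by
        refine ENNReal.ofReal_le_ofReal ((le_of_eq ?_).trans (hJ₁ J hJJ₁))
        rw [← Real.exp_add]; congr 1; push_cast; ring
      calc _ ≤ μ D + μ (symmDiff D E) := hθE.trans h1
        _ ≤ (∑ j ∈ Finset.range (J + 1), ∫⁻ ω in D, quenched ω 0 (firstEntry u L j) ∂μ +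
              ENNReal.ofReal (θ / 4)) + ENNReal.ofReal (θ / 4) :=
            add_le_add ((measure_le_sum_setLIntegral_firstEntry Hμ L J D).trans
              (add_le_add_right h2 _)) (hDE.le.trans (ENNReal.ofReal_le_ofReal hεθ))
        _ = _ := by
            rw [add_assoc, ← ENNReal.ofReal_add (by positivity) (by positivity)]
            congr 2; ring
    refine (mul_le_mul_left hp _).trans (sum_mul_sum_le_of_convolution_le _
      (fun i => ∫⁻ ω, confinedProb u N Dᶜ i ω ∂P) fun m hm => ?_)
    refine (sum_lintegral_firstEntry_mul_le hP hD.compl hD hD2 hD1 (hcomp L) hm).trans ?_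
    calc _ ≤ 2 * ENNReal.ofReal ε + ENNReal.ofReal ε :=
          add_le_add ((setLIntegral_envOp_compl_le hμ hE hD hE1 m).trans
            (mul_le_mul_right hDE.le _)) herr
      _ = _ := by
          rw [ENNReal.ofReal_mul (by norm_num), ENNReal.ofReal_ofNat]; ring
  have h1 := hmain C A hC hA hup (fun ω ω' h => not_congr (hlow ω ω' h)) hop hCA hθA
  have h2 := hmain Cᶜ Aᶜ hC.compl hA.compl (fun ω ω' h => not_congr (hup ω ω' h))
    (by rwa [compl_compl]) hop' hCA' hθA'
  rw [compl_compl] at h2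
  have h3 : (J : ℝ≥0∞) * ENNReal.ofReal (η / 2) ≤
      ∑ i ∈ Finset.Ico J (2 * J), ∫⁻ ω, confinedProb u N C i ω ∂P +
        ∑ i ∈ Finset.Ico J (2 * J), ∫⁻ ω, confinedProb u N Cᶜ i ω ∂P := by
    rw [← Finset.sum_add_distrib]
    calc (J : ℝ≥0∞) * ENNReal.ofReal (η / 2) =
          ∑ _i ∈ Finset.Ico J (2 * J), ENNReal.ofReal (η / 2) := by
          rw [Finset.sum_const, Nat.card_Ico, nsmul_eq_mul]
          congr 2; omega
      _ ≤ _ := Finset.sum_le_sum fun i hi => by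
          refine ofReal_half_le hη.le
            ((ofReal_le_lintegral_confinedProb_add HP hκ.le N hC i).trans ?_)
          refine add_le_add_right (ENNReal.ofReal_le_ofReal ((le_of_eq ?_).trans
            (hJ₂ i (hJJ₂.trans (Finset.mem_Ico.1 hi).1)))) _
          rw [← Real.exp_add]; congr 1; push_cast; ring
  have h4 : ENNReal.ofReal (θ / 2 * (J * (η / 2))) ≤ ENNReal.ofReal (4 * J * (3 * ε)) := by
    rw [ENNReal.ofReal_mul (by positivity), ENNReal.ofReal_mul (by positivity),
      ENNReal.ofReal_natCast, ENNReal.ofReal_mul (p := 4 * (J : ℝ)) (by positivity),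
      ENNReal.ofReal_mul (p := 4) (by norm_num), ENNReal.ofReal_natCast, ENNReal.ofReal_ofNat]
    calc _ ≤ _ := mul_le_mul_right h3 _
      _ = _ := mul_add _ _ _
      _ ≤ _ := add_le_add h2 h1
      _ = _ := by ring
  rw [ENNReal.ofReal_le_ofReal_iff (by positivity)] at h4
  have hJ' : (1 : ℝ) ≤ J := by exact_mod_cast hJ1
  have h5 : θ * η * J / 4 ≤ 12 * (θ * η * J) / 100 := by
    calc _ = θ / 2 * (J * (η / 2)) := by ring
      _ ≤ _ := h4
      _ = _ := by rw [hεdef]; ring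
  have h6 : 0 < θ * η * J := by positivity
  linarith

end

end RWRE

open RWRE in
theorem theorem4p1 {d : ℕ} (u : RWRE.Site d) (hu : u ≠ 0) (δ M s₀ : ℝ)
    (hδ : 0 < δ) (hM : 0 < M) (hs₀ : 0 < s₀) :
    ∃ (η γ κ s₁ : ℝ) (C : ℝ → ℝ),
      0 < η ∧ 0 < γ ∧ 0 < κ ∧ 0 < s₁ ∧ s₁ ≤ s₀ ∧ (∀ p, 1 ≤ p → 0 < C p) ∧
      ∀ P : Measure (RWRE.Env d), RWRE.IsIIDEnv P → RWRE.NonNestling u δ P →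
        RWRE.MomentHyp s₀ M P →
        ∃ Pinf : Measure (RWRE.Env d), IsProbabilityMeasure Pinf ∧
          (Kernel.Invariant (RWRE.envKernel d) Pinf ∧
            RWRE.IsErgodicFor (RWRE.envKernel d) Pinf) ∧
          (∃ c K : ℝ, 0 < c ∧ 0 < K ∧ ∀ ℓ : ℤ, 0 ≤ ℓ →
            RWRE.varDist (Pinf.trim (RWRE.levelSigma_le u ℓ)) (P.trim (RWRE.levelSigma_le u ℓ)) ≤
              K * Real.exp (-c * ℓ)) ∧
          (∀ᵐ ω ∂Pinf,
            (∀ x, RWRE.DriftGE u δ (ω x)) ∧ (∀ x, RWRE.ExpMomentLE s₀ M (ω x)) ∧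
            RWRE.QuenchedEstimates u δ M η γ κ s₁ C ω) := by
  set s := expRate u δ M s₀ with hs
  set c := s * δ / 2 with hc
  set κ₀ := δ ^ 2 / momentConst u M s₀ with hκ₀
  -- the truncation makes `1 - κ (1 - e^{-s})`, a bound for a probability, nonnegative also when
  -- no environment satisfies the hypotheses
  set κ := min κ₀ 1 with hκ
  have hs0 : 0 < s := expRate_pos hu hδ hs₀
  have hc0 : 0 < c := by positivity
  have hκ₀0 : 0 < κ₀ := div_pos (by positivity) (momentConst_pos hu hs₀)
  have hκ0 : 0 < κ := lt_min hκ₀0 one_pos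
  have he := one_sub_exp_pos hs0
  have hec := one_sub_exp_pos hc0
  have h1 : κ * (1 - Real.exp (-s)) ≤ 1 :=
    mul_le_one₀ (min_le_right _ _) he.le (by linarith [Real.exp_pos (-s)])
  refine ⟨κ * (1 - Real.exp (-s)), 1, κ, s, momentBound s c M κ, mul_pos hκ0 he, one_pos, hκ0, hs0,
    expRate_le, fun p hp => zero_lt_one.trans_le (one_le_momentBound hp hs0 hc0 hM hκ0 h1),
    fun P hP hN hMom => ?_⟩
  have := hP.isProbabilityMeasure
  have hgood := hP.ae_goodEnv hN hMom
  have hstep : ∀ ω : Env d, GoodEnv u δ M s₀ ω → StepBounds u s c M κ₀ ω := fun ω h =>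
    h.stepBounds hu hδ hM hs₀
  obtain ⟨μ, U, hU, hμgood, hlim⟩ := exists_tendsto_avgLaw hs₀ hgood
  have hinv := invariant_of_tendsto_avgProb hU hlim
  have hle : ∀ (L : ℤ) (B : Set (Env d)), MeasurableSet B →
      (μ : Measure (Env d)) B ≤ spliceLaw u L μ P B +
        ENNReal.ofReal (1 / (1 - Real.exp (-c)) * Real.exp (-s * L)) := fun L B hB =>
    measure_le_spliceLaw_add hlim hP (hgood.mono hstep) L hB
  refine ⟨μ, inferInstance, ⟨hinv, ?_⟩, ⟨s, 1 / (1 - Real.exp (-c)), hs0, by positivity,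
    fun ℓ _ => varDist_trim_le (by positivity) (hle ℓ)⟩, ?_⟩
  · exact isErgodicFor_of_spliceLaw_le hP hinv (hgood.mono hstep) (hμgood.mono hstep) hκ₀0 hs0 hc0
      fun L => measure_le_add_symm (hle L)
  · filter_upwards [hμgood] with ω h
    exact ⟨fun x => (h x).1, fun x => (h x).2,
      h.quenchedEstimates hu hδ hM hs₀ hs hc hκ0 (min_le_left _ _)⟩
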